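/- Let $\Lambda\subset\mathbb Z^D$ be a finite set of sites with one qubit at each site, and let $H=\sum_{l=1}^L H_l$ be a power-law Hamiltonian with exponent $\alpha\ge 0$: each part is $H_l=c_l I+\sum_{i,j\in\Lambda}h_{l,ij}$ with $c_l\in\mathbb R$ and Hermitian $h_{l,ij}$ supported on the sites $i,j$; the interactions $H_{ij}=\sum_l h_{l,ij}$ satisfy $\|H_{ii}\|\le 1$ and $\|H_{ij}\|\le\|i-j\|_2^{-\alpha}$ for $i\ne j$; and $H_l\ge 0$ for every $l$. Let $g\ge 0$ be such that, for every site, the norms of all terms $h_{l,ij}$ acting on it (on-site terms included) sum to at most $g$, and let $M\ge 0$ be such that $\sum_{i,j}\|h_{l,ij}\|\le M$ for every $l$. Let $W(\delta)=e^{-ia_q\delta H_{l_q}}\cdots e^{-ia_1\delta H_{l_1}}$ be a product formula of length $q$ and of order $p\ge 1$, meaning that $W(\delta)=e^{-i\delta\sum_l A_l}+O(\delta^{p+1})$ as $\delta\to0$ whenever the $H_l$ are replaced by arbitrary Hermitian matrices $A_l$, in which each index $l$ occurs at most $\kappa$ times and all $|a_j|\le\kappa$. Let $V(t)=e^{-iHt}$,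 and let $\Pi_{\le\Delta}$ be the projector onto the span of the eigenvectors of $H$ with eigenvalue at most $\Delta$. Write $$X=\frac{t^{1+\frac1p}L^{\frac1p}}{\epsilon^{\frac1p}}(\Delta+gq\log q)^{1+\frac1p},\qquad Y=\frac{t^{1+\frac1{2p+1}}}{\epsilon^{\frac1{2p+1}}}(LMg)^{\frac12+\frac1{4p+2}},\qquad \ell=\log\Bigl(e+q+t(\Delta+g+M)+\frac1\epsilon\Bigr).$$ There are constants $C>0$ and $k\in\mathbb N$, depending only on $p$ and $\kappa$, such that for all such data and all $\Delta\ge0$, $t\ge0$, $\epsilon>0$ there is an integer $r_0\ge1$ with $$r_0\le 1+C\,(X\ell^k+Y),\quad\text{i.e. } r_0=\tilde O(X)+O(Y)\text{ up to rounding},$$ such that $\|(W(t/r)^r-V(t))\Pi_{\le\Delta}\|\le\epsilon$ for every integer $r\ge r_0$; and the number of gates (exponentials $e^{-i\tau H_l}$) in $W(t/r_0)^{r_0}$ is at most $C\,(L+L X\ell^k+L Y)$, i.e. $\tilde O(LX)+O(LY)$ up to rounding. -/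

import Mathlib

open Filter Topology Asymptotics

noncomputable section

namespace LowEnergySim

/-! ### Circuits made of exponentials, and product formulas -/

/-- A finite sequence of gates. The entry `(l, τ)` is the gate `exp (-i τ A_l)`, the evolution
under the `l`-th part for (possibly negative) time `τ`. The head of the list is applied first. -/
abbrev Circuit (L : ℕ) : Type := List (Fin L × ℝ)

/-- The number of gates (exponentials of a single part) of a circuit. -/
def Circuit.gateCount {L : ℕ} (c : Circuit L) : ℕ := c.length

/-- The operator `exp (-i τ_q A_{l_q}) ⋯ exp (-i τ_1 A_{l_1})` implemented by a circuit. -/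
def Circuit.toOp {L : ℕ} {E : Type*} [NormedAddCommGroup E] [InnerProductSpace ℂ E]
    (A : Fin L → E →L[ℂ] E) (c : Circuit L) : E →L[ℂ] E :=
  ((c.map fun s => NormedSpace.exp ((-(Complex.I * (s.2 : ℂ))) • A s.1)).reverse).prod

/-- The exact evolution `V(t) = exp (-i t A)`. -/
def evolution {E : Type*} [NormedAddCommGroup E] [InnerProductSpace ℂ E]
    (A : E →L[ℂ] E) (t : ℝ) : E →L[ℂ] E :=
  NormedSpace.exp ((-(Complex.I * (t : ℂ))) • A)

/-- A product formula for `L` parts, `W(δ) = exp (-i a_q δ A_{l_q}) ⋯ exp (-i a_1 δ A_{l_1})`,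
is given by the sequence `(l_1, a_1), …, (l_q, a_q)`. -/
structure ProductFormula (L : ℕ) where
  /-- the sequence `(l_1, a_1), …, (l_q, a_q)` -/
  seq : List (Fin L × ℝ)

namespace ProductFormula

variable {L : ℕ}

/-- The length `q` of a product formula, i.e. its number of exponentials. -/
def length (W : ProductFormula L) : ℕ := W.seq.length

/-- The circuit of one step of size `δ`. -/
def step (W : ProductFormula L) (δ : ℝ) : Circuit L :=
  W.seq.map fun s => (s.1, s.2 * δ)

/-- The circuit that performs `r` steps, each of size `t / r`. -/
def trotter (W : ProductFormula L) (t : ℝ) (r : ℕ) : Circuit L :=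
  (List.replicate r (W.step (t / r))).flatten

/-- `W` has order `p`: for all Hermitian matrices `A_1, …, A_L` of every size,
`W(δ) = exp (-i δ (A_1 + ⋯ + A_L)) + O(δ ^ (p + 1))` as `δ → 0`. -/
def HasOrder (W : ProductFormula L) (p : ℕ) : Prop :=
  ∀ (d : ℕ) (A : Fin L → EuclideanSpace ℂ (Fin d) →L[ℂ] EuclideanSpace ℂ (Fin d)),
    (∀ l, IsSelfAdjoint (A l)) →
      (fun δ : ℝ => (W.step δ).toOp A - evolution (∑ l, A l) δ)
        =O[𝓝 0] fun δ : ℝ => δ ^ (p + 1)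

/-- Every part occurs at most `κ` times in `W`, and all coefficients are at most `κ` in absolute
value. (The Lie-Trotter formula has `κ = 1`; the Suzuki formula of even order `p` has
`κ = 2 * 5 ^ (p / 2 - 1)`.) -/
def BoundedBy (W : ProductFormula L) (κ : ℝ) : Prop :=
  (∀ l : Fin L, ((W.seq.countP fun s => s.1 = l : ℕ) : ℝ) ≤ κ) ∧ ∀ s ∈ W.seq, |s.2| ≤ κ

end ProductFormula

/-! ### Qubits on a lattice -/

/-- The Hilbert space of qubits placed at the sites in `S`, with computational basis `S → Fin 2`. -/
abbrev Qubits (S : Type*) [Fintype S] : Type _ := EuclideanSpace ℂ (S → Fin 2)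

/-- The operators on the Hilbert space of the qubits. -/
abbrev Op (S : Type*) [Fintype S] [DecidableEq S] : Type _ := Qubits S →L[ℂ] Qubits S

/-- The matrix element `⟨x| A |y⟩` in the computational basis. -/
def matElem {S : Type*} [Fintype S] [DecidableEq S] (A : Op S) (x y : S → Fin 2) : ℂ :=
  A (EuclideanSpace.single y 1) x

/-- `A` is supported on the set of sites `T`, i.e. `A = B ⊗ 1` with `B` acting on the qubits in `T`:
matrix elements vanish unless the two basis states agree outside `T`, and otherwise depend only on
the restrictions of the two basis states to `T`. -/
def SupportedOn {S : Type*} [Fintype S] [DecidableEq S] (T : Set S) (A : Op S) : Prop :=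
  (∀ x y : S → Fin 2, (∃ v, v ∉ T ∧ x v ≠ y v) → matElem A x y = 0) ∧
  ∀ x y x' y' : S → Fin 2,
    (∀ v, v ∉ T → x v = y v) → (∀ v, v ∉ T → x' v = y' v) →
    (∀ v ∈ T, x v = x' v) → (∀ v ∈ T, y v = y' v) → matElem A x y = matElem A x' y'

/-- The spectral projector `Π_{≤ Δ}` of `H`: the orthogonal projection onto the span of the
eigenvectors of `H` with eigenvalue at most `Δ`. -/
def lowEnergyProj {S : Type*} [Fintype S] [DecidableEq S] (H : Op S) (Δ : ℝ) : Op S :=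
  (⨆ (μ : ℝ) (_ : μ ≤ Δ),
    Module.End.eigenspace (H : Module.End ℂ (Qubits S)) (μ : ℂ)).starProjection

/-- The Euclidean distance of two points of `ℤ ^ D`. -/
def latticeDist {D : ℕ} (i j : Fin D → ℤ) : ℝ :=
  √(∑ k, ((i k : ℝ) - (j k : ℝ)) ^ 2)

/-- A power-law Hamiltonian with exponent `α` on a finite set `Λ` of sites of the lattice `ℤ ^ D`,
divided into `L` parts. The `l`-th part consists of Hermitian terms `term l i j` supported on
`{i, j}` and of a multiple of the identity; the total interaction
`H_{ij} = ∑ l, term l i j` obeys the power law. A grouping of the `H_{ij}` into parts is the case in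
which, for each `(i, j)`, at most one of the `term l i j` is nonzero. -/
structure PowerLawHamiltonian (D : ℕ) (α : ℝ) (Λ : Finset (Fin D → ℤ)) (L : ℕ) where
  /-- the two-site (or, for `i = j`, on-site) terms -/
  term : Fin L → Λ → Λ → Op Λ
  /-- the coefficients of the identity in the parts -/
  shift : Fin L → ℝ
  isSelfAdjoint_term : ∀ l i j, IsSelfAdjoint (term l i j)
  supportedOn_term : ∀ l i j, SupportedOn {i, j} (term l i j)
  norm_le_one : ∀ i, ‖∑ l, term l i i‖ ≤ 1
  norm_le_rpow : ∀ i j, i ≠ j →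
    ‖∑ l, term l i j‖ ≤ 1 / latticeDist (i : Fin D → ℤ) (j : Fin D → ℤ) ^ α

namespace PowerLawHamiltonian

variable {D : ℕ} {α : ℝ} {Λ : Finset (Fin D → ℤ)} {L : ℕ}

/-- The part `H_l`. -/
def part (H : PowerLawHamiltonian D α Λ L) (l : Fin L) : Op Λ :=
  (H.shift l : ℂ) • (1 : Op Λ) + ∑ i, ∑ j, H.term l i j

/-- The Hamiltonian `H = H_1 + ⋯ + H_L`. -/
def total (H : PowerLawHamiltonian D α Λ L) : Op Λ := ∑ l, H.part l

/-- The strength of the `l`-th part: the sum of the norms of its terms. -/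
def partStrength (H : PowerLawHamiltonian D α Λ L) (l : Fin L) : ℝ :=
  ∑ i, ∑ j, ‖H.term l i j‖

/-- The interaction strength at the site `v`: the sum of the norms of all terms acting on `v`. -/
def siteStrength (H : PowerLawHamiltonian D α Λ L) (v : Λ) : ℝ :=
  ∑ l, ∑ i, ∑ j, if i = v ∨ j = v then ‖H.term l i j‖ else 0

/-- The error `‖(W(t/r)^r - V(t)) Π_{≤ Δ}‖` of the simulation by `r` steps of the product
formula `W` in the low-energy subspace. -/
def lowEnergyError (H : PowerLawHamiltonian D α Λ L) (W : ProductFormula L)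
    (Δ t : ℝ) (r : ℕ) : ℝ :=
  ‖((W.trotter t r).toOp H.part - evolution H.total t) * lowEnergyProj H.total Δ‖

end PowerLawHamiltonian

end LowEnergySim

end

/-!
# Low-energy simulation by product formulas: the number of steps

The energy levels of `H` are grouped into blocks: block `0` consists of the levels up to `Δ`, and
the following blocks have a width `w` of order `g n`. A part `H_l` is a sum of two-site terms, so
`n` nested commutators with `H` have norm at most `(2 g) ^ n (n + 1)! M`
(`PowerLawHamiltonian.norm_iterate_comm_part_le`), while each commutator gains a factor `w` on a
matrix block between levels that are `w` apart (`gap_mul_norm_le`). Hence the blocks of `H_l`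
between non-neighbouring energy blocks are of size `exp (-n) M`, and `H_l` is close to its
block-tridiagonal part `K_l = bandPart b β n (H_l)` within the blocks `0, …, n`, except on the top
block.

Unlike the `H_l`, the `K_l` have a sum of norm at most `Δ + n w`, and they are positive up to an
exponentially small shift. For positive operators with sum at most `S`, a product of `q`
exponentials at complex times is bounded by `2` on a disc of radius of order `1 / (S log q)`
(`norm_orbit_le`): writing the generators as squares `B_j ^ 2`, the increments of the orbit solve a
linear system whose matrix is a triangular truncation of the Gram matrix `(B_j B_i)`, and triangular
truncation costs only a factor `log q` (`sum_norm_sq_truncation_le`). This is where the positivity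
of the parts enters, and why the bound involves the energy cutoff but not the norm of the
Hamiltonian.

On that disc the Schwarz lemma of order `m` (`norm_le_mul_div_pow_of_isBigO`) turns vanishing to
order `m` at time `0` into a quantitative bound, and it is used twice. The order condition gives an
error `(δ / R) ^ (p + 1)` for one step of the product formula of the `K_l`. The tridiagonal form, by
which an excitation from block `0` to block `n` takes `n` applications of the `K_l`, gives a weight
`(δ / R) ^ n` on the top block (`exists_norm_blockProj_gateProd_bandPart_le`), so that replacing
`H_l` by `K_l` is harmless by Duhamel's formula. With `n` of the order of the logarithm in the
statement, all exponentially small terms are negligible (`exists_parameters`). The leakage out of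
the low-energy subspace thus requires no steps beyond the first summand of the bound on `r₀`; the
second summand and the factor `L ^ (1 / p)` are room to spare.
-/

namespace LowEnergySim

/-! ### Orbits under exponentials of positive operators -/

section
variable {E : Type*} [NormedAddCommGroup E] [InnerProductSpace ℂ E] [CompleteSpace E]

/-- The row `(B_i)` has the same norm as the column `(B_i)`, of which `∑ B_i ^ 2 ≤ S` bounds the
square. -/
theorem norm_sum_sq_le_of_frame {B : ℕ → E →L[ℂ] E} {S : ℝ} (hS0 : 0 ≤ S)
    (hB : ∀ j, IsSelfAdjoint (B j)) (hS : ∀ (s : Finset ℕ) v, ∑ j ∈ s, ‖B j v‖ ^ 2 ≤ S * ‖v‖ ^ 2)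
    (s : Finset ℕ) (y : ℕ → E) :
    ‖∑ i ∈ s, B i (y i)‖ ^ 2 ≤ S * ∑ i ∈ s, ‖y i‖ ^ 2 := by
  set v := ∑ i ∈ s, B i (y i) with hv
  have h1 : ‖v‖ ^ 2 ≤ ∑ i ∈ s, ‖B i v‖ * ‖y i‖ := by
    have : (‖v‖ ^ 2 : ℝ) = (∑ i ∈ s, inner ℂ (B i v) (y i)).re := by
      have h2 : ∑ i ∈ s, inner ℂ (B i v) (y i) = inner ℂ v v := by
        conv_rhs => rw [hv, inner_sum]
        refine Finset.sum_congr rfl fun i _ => ?_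
        rw [← ContinuousLinearMap.adjoint_inner_left, (hB i).adjoint_eq]
      rw [h2, inner_self_eq_norm_sq_to_K]
      norm_cast
    rw [this, Complex.re_sum]
    refine Finset.sum_le_sum fun i _ => ?_
    exact (Complex.re_le_norm _).trans (norm_inner_le_norm _ _)
  have h3 := Finset.sum_mul_sq_le_sq_mul_sq s (fun i => ‖B i v‖) (fun i => ‖y i‖)
  have h4 := hS s v
  have h5 : 0 ≤ ∑ i ∈ s, ‖y i‖ ^ 2 := Finset.sum_nonneg fun i _ => by positivity
  have h6 : (‖v‖ ^ 2) ^ 2 ≤ (S * ‖v‖ ^ 2) * ∑ i ∈ s, ‖y i‖ ^ 2 := by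
    refine (pow_le_pow_left₀ (by positivity) h1 2).trans (h3.trans ?_)
    gcongr
  rcases (norm_nonneg v).eq_or_lt with h0 | h0
  · rw [← h0]; simp; positivity
  · have : 0 < ‖v‖ ^ 2 := by positivity
    nlinarith

/-- Triangular truncation of the Gram matrix `(B_j B_i)` of a family of self-adjoint operators with
`∑ B_j ^ 2 ≤ S` has norm at most `(k + 1) * S` on intervals of length `2 ^ k`. The interval is split
in halves: the two diagonal blocks are bounded inductively, and the off-diagonal block, being
the full product of a column and a row, has norm at most `S`. -/
theorem sum_norm_sq_truncation_le {B : ℕ → E →L[ℂ] E} {S : ℝ} (hS0 : 0 ≤ S)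
    (hB : ∀ j, IsSelfAdjoint (B j)) (hS : ∀ (s : Finset ℕ) v, ∑ j ∈ s, ‖B j v‖ ^ 2 ≤ S * ‖v‖ ^ 2)
    (y : ℕ → E) (k : ℕ) : ∀ a : ℕ,
    ∑ j ∈ Finset.Ico a (a + 2 ^ k), ‖B j (∑ i ∈ Finset.Ico a j, B i (y i))‖ ^ 2 ≤
      (k + 1) ^ 2 * S ^ 2 * ∑ j ∈ Finset.Ico a (a + 2 ^ k), ‖y j‖ ^ 2 := by
  induction k with
  | zero =>
    intro a
    simp
    positivity
  | succ k ih =>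
    intro a
    have e : a + 2 ^ (k + 1) = a + 2 ^ k + 2 ^ k := by ring
    have l1 : a ≤ a + 2 ^ k := Nat.le_add_right _ _
    have l2 : a + 2 ^ k ≤ a + 2 ^ k + 2 ^ k := Nat.le_add_right _ _
    rw [e, ← Finset.sum_Ico_consecutive _ l1 l2, ← Finset.sum_Ico_consecutive _ l1 l2]
    set m := a + 2 ^ k with hm
    set YL := ∑ j ∈ Finset.Ico a m, ‖y j‖ ^ 2 with hYL
    set YR := ∑ j ∈ Finset.Ico m (m + 2 ^ k), ‖y j‖ ^ 2 with hYR
    have hYL0 : 0 ≤ YL := Finset.sum_nonneg fun i _ => by positivity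
    have hYR0 : 0 ≤ YR := Finset.sum_nonneg fun i _ => by positivity
    have hL := ih a
    have hR := ih m
    set v := ∑ i ∈ Finset.Ico a m, B i (y i) with hv
    have hvn : ‖v‖ ^ 2 ≤ S * YL := norm_sum_sq_le_of_frame hS0 hB hS _ y
    have hC : ∑ j ∈ Finset.Ico m (m + 2 ^ k), ‖B j v‖ ^ 2 ≤ S ^ 2 * YL := by
      refine (hS _ v).trans ?_
      nlinarith
    have hsplit : ∀ j ∈ Finset.Ico m (m + 2 ^ k),
        ((k : ℝ) + 1) * ‖B j (∑ i ∈ Finset.Ico a j, B i (y i))‖ ^ 2 ≤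
          ((k : ℝ) + 2) * ‖B j (∑ i ∈ Finset.Ico m j, B i (y i))‖ ^ 2
            + ((k : ℝ) + 1) * ((k : ℝ) + 2) * ‖B j v‖ ^ 2 := by
      intro j hj
      rw [← Finset.sum_Ico_consecutive _ l1 (Finset.mem_Ico.1 hj).1, map_add, ← hv]
      set c := B j v
      set d := B j (∑ i ∈ Finset.Ico m j, B i (y i))
      have h1 : ‖c + d‖ ^ 2 ≤ (‖c‖ + ‖d‖) ^ 2 :=
        pow_le_pow_left₀ (norm_nonneg _) (norm_add_le _ _) 2
      have hk : (0 : ℝ) ≤ k := Nat.cast_nonneg k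
      nlinarith [sq_nonneg (‖d‖ - ((k : ℝ) + 1) * ‖c‖)]
    have hsum := Finset.sum_le_sum hsplit
    rw [← Finset.mul_sum, Finset.sum_add_distrib, ← Finset.mul_sum, ← Finset.mul_sum] at hsum
    set UR := ∑ j ∈ Finset.Ico m (m + 2 ^ k), ‖B j (∑ i ∈ Finset.Ico a j, B i (y i))‖ ^ 2
    have hk : (0 : ℝ) ≤ k := Nat.cast_nonneg k
    have h7 : ((k : ℝ) + 1) * UR ≤
        ((k : ℝ) + 1) * ((k + 2) * (k + 1) * S ^ 2 * YR + (k + 2) * (S ^ 2 * YL)) := by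
      refine hsum.trans ?_
      have := mul_le_mul_of_nonneg_left hR (by positivity : (0 : ℝ) ≤ (k : ℝ) + 2)
      have := mul_le_mul_of_nonneg_left hC (by positivity : (0 : ℝ) ≤ ((k : ℝ) + 1) * (k + 2))
      nlinarith
    have h8 := le_of_mul_le_mul_left h7 (by positivity)
    push_cast
    have h9 : 0 ≤ S ^ 2 * YL := by positivity
    have h10 : 0 ≤ S ^ 2 * YR := by positivity
    nlinarith [mul_nonneg hk h9, mul_nonneg hk h10]

/-- The exponential of `w B ^ 2` differs from `1` by an operator that factors through `B` on both
sides. This lets the sum of the generators, rather than the sum of their norms, control a product of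
exponentials. -/
theorem exists_exp_smul_sq_eq (B : E →L[ℂ] E) (w : ℂ) {ρ : ℝ} (hρ : ‖w‖ * ‖B * B‖ ≤ ρ) :
    ∃ G : E →L[ℂ] E, NormedSpace.exp (w • (B * B)) = 1 + B * G * B ∧
      ‖G‖ ≤ ‖w‖ * Real.exp ρ := by
  set c : ℕ → E →L[ℂ] E := fun n => (((n + 1).factorial : ℂ)⁻¹ * w ^ (n + 1)) • (B * B) ^ n with hc
  have hsum : HasSum (fun n => ‖w‖ * (((n.factorial : ℝ)⁻¹) • (ρ ^ n))) (‖w‖ * Real.exp ρ) := by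
    rw [Real.exp_eq_exp_ℝ]
    exact (NormedSpace.exp_series_hasSum_exp' (𝕂 := ℝ) ρ).mul_left _
  have hle : ∀ n, ‖c n‖ ≤ ‖w‖ * (((n.factorial : ℝ)⁻¹) • (ρ ^ n)) := by
    intro n
    have h1 : ‖(B * B) ^ n‖ ≤ ‖B * B‖ ^ n := by
      rcases n with _ | n
      · rw [pow_zero, pow_zero]
        exact ContinuousLinearMap.norm_id_le
      · exact norm_pow_le' _ (Nat.succ_pos n)
    have h2 : (((n + 1).factorial : ℝ))⁻¹ ≤ ((n.factorial : ℝ))⁻¹ := by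
      gcongr
      exact Nat.le_succ n
    calc ‖c n‖ = ((n + 1).factorial : ℝ)⁻¹ * ‖w‖ ^ (n + 1) * ‖(B * B) ^ n‖ := by
          rw [hc]; simp [norm_smul]
      _ ≤ ((n.factorial : ℝ))⁻¹ * ‖w‖ ^ (n + 1) * ‖B * B‖ ^ n := by gcongr
      _ = ‖w‖ * (((n.factorial : ℝ)⁻¹) * ((‖w‖ * ‖B * B‖) ^ n)) := by rw [mul_pow]; ring
      _ ≤ ‖w‖ * (((n.factorial : ℝ)⁻¹) • (ρ ^ n)) := by
          rw [smul_eq_mul]; gcongr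
  have hcs : Summable c := Summable.of_norm_bounded hsum.summable hle
  refine ⟨∑' n, c n, ?_, ?_⟩
  · have h1 : HasSum (fun n => B * c n * B) (B * (∑' n, c n) * B) :=
      (hcs.hasSum.mul_left B).mul_right B
    have h2 : (fun n => B * c n * B) =
        fun n => (((n + 1).factorial : ℂ)⁻¹) • (w • (B * B)) ^ (n + 1) := by
      funext n
      have h3 : B * (B * B) ^ n * B = (B * B) ^ (n + 1) := by
        rw [← pow_two, ← pow_mul, ← pow_mul, ← pow_succ', ← pow_succ]
        ring_nf
      rw [hc]
      simp only [mul_smul_comm, smul_mul_assoc, h3, smul_pow, smul_smul]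
    rw [h2] at h1
    have h4 := (NormedSpace.exp_series_hasSum_exp' (𝕂 := ℂ) (w • (B * B)))
    have h5 := (hasSum_nat_add_iff' 1).2 h4
    have h6 := h5.unique h1
    simp only [Finset.range_one, Finset.sum_singleton, Nat.factorial_zero, Nat.cast_one, inv_one,
      pow_zero, one_smul] at h6
    rw [← h6]; abel
  · exact (tsum_of_norm_bounded hsum hle)

/-- A product of at most `2 ^ k` exponentials `exp (w_j A_j)` of positive operators with
`∑ A_j ≤ S`, at complex times of size at most `ρ`, is bounded by `2` as soon as `(k + 1) ρ S` is
small; the number of factors enters only through its logarithm. The increments `y_j` of the orbit,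
written as `x_{j+1} = x_j + B_j y_j` with `A_j = B_j ^ 2`, solve a linear system whose matrix is a
triangular truncation. -/
theorem norm_orbit_le {A : ℕ → E →L[ℂ] E} {w : ℕ → ℂ} {S ρ : ℝ} {k : ℕ} (hS0 : 0 ≤ S)
    (hA : ∀ j, (A j).IsPositive)
    (hS : ∀ (s : Finset ℕ) v, ∑ j ∈ s, (inner ℂ v (A j v)).re ≤ S * ‖v‖ ^ 2)
    (hw : ∀ j, ‖w j‖ ≤ ρ) (hρ : 4 * ρ * ((k + 1) * S) ≤ 1)
    {x : ℕ → E} (hx : ∀ j, x (j + 1) = NormedSpace.exp (w j • A j) (x j)) {q : ℕ} (hq : q ≤ 2 ^ k) :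
    ‖x q‖ ≤ 2 * ‖x 0‖ := by
  have hρ0 : 0 ≤ ρ := (norm_nonneg _).trans (hw 0)
  set B : ℕ → E →L[ℂ] E := fun j => CFC.sqrt (A j) with hBdef
  have hBB : ∀ j, B j * B j = A j := fun j =>
    CFC.sqrt_mul_sqrt_self _ ((ContinuousLinearMap.nonneg_iff_isPositive _).2 (hA j))
  have hB : ∀ j, IsSelfAdjoint (B j) := fun j => (CFC.sqrt_nonneg (A j)).isSelfAdjoint
  have hinner : ∀ j v, ‖B j v‖ ^ 2 = (inner ℂ v (A j v)).re := by
    intro j v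
    rw [← hBB j, mul_apply_eq_comp, ← ContinuousLinearMap.adjoint_inner_left,
      (hB j).adjoint_eq, inner_self_eq_norm_sq_to_K]
    norm_cast
  have hS' : ∀ (s : Finset ℕ) v, ∑ j ∈ s, ‖B j v‖ ^ 2 ≤ S * ‖v‖ ^ 2 := by
    intro s v
    simpa only [hinner] using hS s v
  have hAn : ∀ j, ‖B j * B j‖ ≤ S := by
    intro j
    have h1 : ‖B j‖ ≤ √S := by
      refine ContinuousLinearMap.opNorm_le_bound _ (Real.sqrt_nonneg _) fun v => ?_
      have := hS' {j} v
      rw [Finset.sum_singleton] at this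
      refine abs_le_of_sq_le_sq' ?_ (by positivity) |>.2
      rw [mul_pow, Real.sq_sqrt hS0]
      exact this
    calc ‖B j * B j‖ ≤ ‖B j‖ * ‖B j‖ := norm_mul_le _ _
      _ ≤ √S * √S := by gcongr
      _ = S := Real.mul_self_sqrt hS0
  have hk : (0 : ℝ) ≤ k := Nat.cast_nonneg k
  have hρS : ρ * S ≤ 1 / 4 := by nlinarith [mul_nonneg hρ0 hS0, mul_nonneg hk (mul_nonneg hρ0 hS0)]
  have hG : ∀ j, ∃ G : E →L[ℂ] E, NormedSpace.exp (w j • A j) = 1 + B j * G * B j ∧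
      ‖G‖ ≤ 2 * ρ := by
    intro j
    obtain ⟨G, h1, h2⟩ := exists_exp_smul_sq_eq (B j) (w j) (ρ := 1 / 4)
      ((mul_le_mul (hw j) (hAn j) (norm_nonneg _) hρ0).trans hρS)
    rw [hBB] at h1
    refine ⟨G, h1, h2.trans ?_⟩
    have h3 : Real.exp (1 / 4) ≤ 2 := by
      have := Real.exp_bound' (x := 1 / 4) (by norm_num) (by norm_num) (n := 1) (by norm_num)
      norm_num at this
      linarith
    nlinarith [hw j, norm_nonneg (w j), Real.exp_pos (1 / 4)]
  choose G hG1 hG2 using hG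
  set y : ℕ → E := fun j => G j (B j (x j)) with hy
  have hxy : ∀ j, x j = x 0 + ∑ i ∈ Finset.Ico 0 j, B i (y i) := by
    intro j
    induction j with
    | zero => simp
    | succ j ih =>
      rw [hx, hG1, Finset.sum_Ico_succ_top (Nat.zero_le _), ← add_assoc, ← ih]
      simp [hy]
  set u : ℕ → E := fun j => B j (∑ i ∈ Finset.Ico 0 j, B i (y i)) with hu
  have hyu : ∀ j, ‖y j‖ ^ 2 ≤ 8 * ρ ^ 2 * (‖B j (x 0)‖ ^ 2 + ‖u j‖ ^ 2) := by
    intro j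
    have h1 : ‖y j‖ ≤ 2 * ρ * (‖B j (x 0)‖ + ‖u j‖) := by
      calc ‖y j‖ ≤ ‖G j‖ * ‖B j (x j)‖ := (G j).le_opNorm _
        _ ≤ 2 * ρ * ‖B j (x j)‖ := by gcongr; exact hG2 j
        _ ≤ 2 * ρ * (‖B j (x 0)‖ + ‖u j‖) := by
            gcongr
            conv_lhs => rw [hxy j, map_add]
            exact norm_add_le _ _
    calc ‖y j‖ ^ 2 ≤ (2 * ρ * (‖B j (x 0)‖ + ‖u j‖)) ^ 2 := pow_le_pow_left₀ (norm_nonneg _) h1 2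
      _ ≤ _ := by nlinarith [mul_nonneg (sq_nonneg ρ) (sq_nonneg (‖B j (x 0)‖ - ‖u j‖))]
  set Y := ∑ j ∈ Finset.Ico 0 (0 + 2 ^ k), ‖y j‖ ^ 2 with hY
  have hY0 : 0 ≤ Y := Finset.sum_nonneg fun i _ => by positivity
  have hYle : Y ≤ 8 * ρ ^ 2 * (S * ‖x 0‖ ^ 2 + (k + 1) ^ 2 * S ^ 2 * Y) := by
    refine (Finset.sum_le_sum fun j _ => hyu j).trans ?_
    rw [← Finset.mul_sum, Finset.sum_add_distrib]
    gcongr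
    · exact hS' _ _
    · exact sum_norm_sq_truncation_le hS0 hB hS' y k 0
  have hsq : 16 * ρ ^ 2 * ((k + 1) ^ 2 * S ^ 2) ≤ 1 := by
    have h1 : 0 ≤ 4 * ρ * ((k + 1) * S) := by positivity
    nlinarith
  have hsq2 : 16 * ρ ^ 2 * S ^ 2 ≤ 1 := by nlinarith [mul_nonneg hρ0 hS0]
  have hY2 : Y ≤ 16 * ρ ^ 2 * (S * ‖x 0‖ ^ 2) := by nlinarith
  have h1 : ‖x q - x 0‖ ^ 2 ≤ S * Y := by
    have h2 : x q - x 0 = ∑ i ∈ Finset.Ico 0 q, B i (y i) := by rw [hxy q]; simp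
    rw [h2]
    refine (norm_sum_sq_le_of_frame hS0 hB hS' _ y).trans ?_
    gcongr
    exact Finset.sum_le_sum_of_subset_of_nonneg
      (Finset.Ico_subset_Ico le_rfl (by simpa using hq)) fun i _ _ => by positivity
  have h2 : ‖x q - x 0‖ ^ 2 ≤ ‖x 0‖ ^ 2 := by
    nlinarith [mul_le_mul_of_nonneg_left hY2 hS0, sq_nonneg ‖x 0‖]
  have h3 : ‖x q - x 0‖ ≤ ‖x 0‖ := abs_le_of_sq_le_sq' h2 (norm_nonneg _) |>.2
  calc ‖x q‖ = ‖(x q - x 0) + x 0‖ := by rw [sub_add_cancel]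
    _ ≤ ‖x q - x 0‖ + ‖x 0‖ := norm_add_le _ _
    _ ≤ 2 * ‖x 0‖ := by linarith

end

/-! ### Products of exponentials -/

section
variable {E : Type*} [NormedAddCommGroup E] [InnerProductSpace ℂ E]

theorem norm_one_le : ‖(1 : E →L[ℂ] E)‖ ≤ 1 := ContinuousLinearMap.norm_id_le

theorem norm_exp_le [CompleteSpace E] (X : E →L[ℂ] E) : ‖NormedSpace.exp X‖ ≤ Real.exp ‖X‖ := by
  have hsum := NormedSpace.exp_series_hasSum_exp' (𝕂 := ℝ) ‖X‖
  rw [← Real.exp_eq_exp_ℝ] at hsum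
  rw [NormedSpace.exp_eq_tsum (𝕂 := ℂ)]
  refine tsum_of_norm_bounded hsum fun n => ?_
  have h1 : ‖X ^ n‖ ≤ ‖X‖ ^ n := by
    rcases n with _ | n
    · rw [pow_zero, pow_zero]
      exact norm_one_le
    · exact norm_pow_le' _ (Nat.succ_pos n)
  rw [norm_smul, smul_eq_mul]
  simp only [norm_inv, RCLike.norm_natCast]
  gcongr

/-- The Schwarz lemma of order `n` for a bounded entire function. The vanishing to order `n` at `0`
is required along the real axis only. -/
theorem norm_le_mul_div_pow_of_isBigO {G : Type*} [NormedAddCommGroup G] [NormedSpace ℂ G]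
    [CompleteSpace G]
    {R : ℝ} (hR : 0 < R) (n : ℕ) : ∀ {F : ℂ → G} {C : ℝ}, Differentiable ℂ F →
    (∀ z, ‖z‖ ≤ R → ‖F z‖ ≤ C) →
    ((fun δ : ℝ => F δ) =O[𝓝[≠] 0] fun δ : ℝ => δ ^ n) →
    ∀ z, ‖z‖ ≤ R → ‖F z‖ ≤ C * (‖z‖ / R) ^ n := by
  induction n with
  | zero => intro F C _ hb _ z hz; simpa using hb z hz
  | succ n ih =>
    intro F C hF hb hO z hz
    have hofReal : Tendsto (fun δ : ℝ => (δ : ℂ)) (𝓝[≠] 0) (𝓝 0) :=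
      (Complex.continuous_ofReal.tendsto' 0 0 Complex.ofReal_zero).mono_left nhdsWithin_le_nhds
    have hF0 : F 0 = 0 := by
      have h1 : Tendsto (fun δ : ℝ => F δ) (𝓝[≠] 0) (𝓝 (F 0)) :=
        (hF.continuous.tendsto 0).comp hofReal
      have h2 : Tendsto (fun δ : ℝ => F δ) (𝓝[≠] 0) (𝓝 0) := by
        refine hO.trans_tendsto ?_
        have : Tendsto (fun δ : ℝ => δ ^ (n + 1)) (𝓝 0) (𝓝 0) :=
          (continuous_pow (n + 1)).tendsto' 0 0 (by simp)
        exact this.mono_left nhdsWithin_le_nhds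
      exact tendsto_nhds_unique h1 h2
    -- `F z / z` satisfies the hypotheses for `n`, by the maximum principle on the disc
    set F1 := dslope F 0 with hF1
    have hFz : ∀ z, F z = z • F1 z := by
      intro z
      have := sub_smul_dslope F 0 z
      rw [hF0, sub_zero, sub_zero] at this
      exact this.symm
    have hF1d : Differentiable ℂ F1 := by
      rw [← differentiableOn_univ]
      exact (Complex.differentiableOn_dslope univ_mem).2 hF.differentiableOn
    have hb1 : ∀ z, ‖z‖ ≤ R → ‖F1 z‖ ≤ C / R := by
      intro z hz
      have hmem : z ∈ closure (Metric.ball (0 : ℂ) R) := by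
        rw [closure_ball _ hR.ne']; simpa using hz
      refine Complex.norm_le_of_forall_mem_frontier_norm_le Metric.isBounded_ball
        hF1d.diffContOnCl (fun z hz => ?_) hmem
      rw [frontier_ball _ hR.ne'] at hz
      have hz' : ‖z‖ = R := by simpa using hz
      rw [le_div_iff₀ hR]
      calc ‖F1 z‖ * R = ‖F z‖ := by rw [hFz z, norm_smul, hz', mul_comm]
        _ ≤ C := hb z hz'.le
    have hO1 : (fun δ : ℝ => F1 δ) =O[𝓝[≠] 0] fun δ : ℝ => δ ^ n := by
      obtain ⟨c, hc⟩ := hO.bound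
      refine IsBigO.of_bound c ?_
      filter_upwards [hc, self_mem_nhdsWithin] with δ hδ hδ0
      have hδ0' : 0 < ‖δ‖ := norm_pos_iff.2 hδ0
      rw [hFz, norm_smul, Complex.norm_real, pow_succ', norm_mul] at hδ
      refine le_of_mul_le_mul_left (hδ.trans_eq ?_) hδ0'
      ring
    have := ih hF1d hb1 hO1 z hz
    calc ‖F z‖ = ‖z‖ * ‖F1 z‖ := by rw [hFz z, norm_smul]
      _ ≤ ‖z‖ * (C / R * (‖z‖ / R) ^ n) := by gcongr
      _ = C * (‖z‖ / R) ^ (n + 1) := by rw [pow_succ]; ring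

/-- The product of the exponentials `exp (-i z a_j A_{l_j})` at complex time `z`, where
`(l_j, a_j)` are the entries of the list; the head of the list is applied first. -/
noncomputable def gateProd {L : ℕ} (A : Fin L → E →L[ℂ] E) (c : List (Fin L × ℝ))
    (z : ℂ) : E →L[ℂ] E :=
  ((c.map fun s => NormedSpace.exp ((-(Complex.I * (s.2 : ℂ) * z)) • A s.1)).reverse).prod

variable {L : ℕ}

@[simp] theorem gateProd_nil (A : Fin L → E →L[ℂ] E) (z : ℂ) : gateProd A [] z = 1 := rfl

theorem gateProd_append (A : Fin L → E →L[ℂ] E) (c d : List (Fin L × ℝ)) (z : ℂ) :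
    gateProd A (c ++ d) z = gateProd A d z * gateProd A c z := by
  simp [gateProd]

theorem gateProd_singleton (A : Fin L → E →L[ℂ] E) (s : Fin L × ℝ) (z : ℂ) :
    gateProd A [s] z = NormedSpace.exp ((-(Complex.I * (s.2 : ℂ) * z)) • A s.1) := by
  simp [gateProd]

theorem gateProd_cons (A : Fin L → E →L[ℂ] E) (s : Fin L × ℝ) (c : List (Fin L × ℝ)) (z : ℂ) :
    gateProd A (s :: c) z =
      gateProd A c z * NormedSpace.exp ((-(Complex.I * (s.2 : ℂ) * z)) • A s.1) := by
  rw [← List.singleton_append, gateProd_append, gateProd_singleton]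

theorem toOp_eq_gateProd (A : Fin L → E →L[ℂ] E) (W : ProductFormula L) (δ : ℝ) :
    (W.step δ).toOp A = gateProd A W.seq δ := by
  simp only [Circuit.toOp, gateProd, ProductFormula.step, List.map_map]
  congr 3
  funext s
  simp [mul_assoc]

theorem toOp_append (A : Fin L → E →L[ℂ] E) (c d : Circuit L) :
    Circuit.toOp A (c ++ d) = Circuit.toOp A d * Circuit.toOp A c := by
  simp [Circuit.toOp]

theorem toOp_trotter (A : Fin L → E →L[ℂ] E) (W : ProductFormula L) (t : ℝ) (r : ℕ) :
    (W.trotter t r).toOp A = gateProd A W.seq ((t / r : ℝ) : ℂ) ^ r := by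
  rw [ProductFormula.trotter, ← toOp_eq_gateProd]
  generalize W.step (t / r) = c
  induction r with
  | zero => simp [Circuit.toOp]
  | succ r ih => rw [List.replicate_succ, List.flatten_cons, toOp_append, ih, pow_succ]

variable [CompleteSpace E]

theorem differentiable_exp_smul (X : E →L[ℂ] E) (a : ℂ) :
    Differentiable ℂ fun z : ℂ => NormedSpace.exp ((-(a * z)) • X) := by
  intro z
  have h1 : HasDerivAt (fun z : ℂ => NormedSpace.exp (z • X))
      (NormedSpace.exp ((-(a * z)) • X) * X) (-(a * z)) := hasDerivAt_exp_smul_const X _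
  exact h1.differentiableAt.comp (f := fun z => -(a * z)) z (by fun_prop)

theorem differentiable_gateProd (A : Fin L → E →L[ℂ] E) (c : List (Fin L × ℝ)) :
    Differentiable ℂ (gateProd A c) := by
  induction c with
  | nil => exact differentiable_const (1 : E →L[ℂ] E)
  | cons s c ih =>
    have : gateProd A (s :: c) = fun z => gateProd A c z *
      NormedSpace.exp ((-(Complex.I * (s.2 : ℂ) * z)) • A s.1) :=
      funext fun z => gateProd_cons A s c z
    rw [this]
    exact ih.mul (differentiable_exp_smul _ _)

theorem exp_mem_unitary {A : E →L[ℂ] E} (hA : IsSelfAdjoint A) (t : ℝ) :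
    NormedSpace.exp ((-(Complex.I * (t : ℂ))) • A) ∈ unitary (E →L[ℂ] E) := by
  let _ : NormedAlgebra ℚ (E →L[ℂ] E) := NormedAlgebra.restrictScalars ℚ ℂ _
  apply NormedSpace.exp_mem_unitary_of_mem_skewAdjoint
  rw [skewAdjoint.mem_iff, star_smul, hA.star_eq]
  simp

theorem gateProd_mem_unitary {A : Fin L → E →L[ℂ] E} (hA : ∀ l, IsSelfAdjoint (A l))
    (c : List (Fin L × ℝ)) (δ : ℝ) : gateProd A c δ ∈ unitary (E →L[ℂ] E) := by
  induction c with
  | nil => exact one_mem _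
  | cons s c ih =>
    rw [gateProd_cons]
    refine mul_mem ih ?_
    have := exp_mem_unitary (hA s.1) (s.2 * δ)
    rwa [Complex.ofReal_mul, ← mul_assoc] at this

/-- Duhamel's formula as an inequality: the difference of two unitary evolutions on `P` is
controlled by the difference of the generators along one of the orbits. -/
theorem norm_exp_sub_exp_mul_le {A B : E →L[ℂ] E} (hA : IsSelfAdjoint A) (P : E →L[ℂ] E) (τ : ℝ)
    {C : ℝ} (hC : ∀ σ ∈ Set.Icc (0 : ℝ) 1,
      ‖(A - B) * (NormedSpace.exp ((-(Complex.I * ((σ * τ : ℝ) : ℂ))) • B) * P)‖ ≤ C) :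
    ‖(NormedSpace.exp ((-(Complex.I * (τ : ℂ))) • A) -
      NormedSpace.exp ((-(Complex.I * (τ : ℂ))) • B)) * P‖ ≤ |τ| * C := by
  set X : E →L[ℂ] E := (-(Complex.I * (τ : ℂ))) • A with hX
  set Y : E →L[ℂ] E := (-(Complex.I * (τ : ℂ))) • B with hY
  set f : ℝ → E →L[ℂ] E := fun σ => NormedSpace.exp ((1 - σ) • X) * (NormedSpace.exp (σ • Y) * P)
    with hf
  have hd : ∀ σ : ℝ, HasDerivAt f
      (NormedSpace.exp ((1 - σ) • X) * ((Y - X) * (NormedSpace.exp (σ • Y) * P))) σ := by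
    intro σ
    have h1 : HasDerivAt (fun s : ℝ => NormedSpace.exp ((1 - s) • X))
        (-(NormedSpace.exp ((1 - σ) • X) * X)) σ := by
      have := (hasDerivAt_exp_smul_const (𝕂 := ℝ) X (1 - σ)).scomp σ
        ((hasDerivAt_id σ).const_sub 1)
      simpa [Function.comp_def] using this
    have h2 : HasDerivAt (fun s : ℝ => NormedSpace.exp (s • Y))
        (Y * NormedSpace.exp (σ • Y)) σ := hasDerivAt_exp_smul_const' Y σ
    have h3 := h1.mul (h2.mul_const P)
    refine h3.congr_deriv ?_
    simp only [sub_mul, mul_sub, neg_mul, mul_assoc]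
    abel
  have hsm : ∀ (σ : ℝ) (Z : E →L[ℂ] E), σ • ((-(Complex.I * (τ : ℂ))) • Z) =
      (-(Complex.I * ((σ * τ : ℝ) : ℂ))) • Z := by
    intro σ Z
    rw [← Complex.coe_smul, smul_smul]
    congr 1
    push_cast
    ring
  have hbound : ∀ σ ∈ Set.Ico (0 : ℝ) 1,
      ‖NormedSpace.exp ((1 - σ) • X) * ((Y - X) * (NormedSpace.exp (σ • Y) * P))‖ ≤ |τ| * C := by
    intro σ hσ
    rw [hX, hsm, CStarRing.norm_mem_unitary_mul _ (exp_mem_unitary hA _)]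
    have h4 : Y - (-(Complex.I * (τ : ℂ))) • A = (Complex.I * (τ : ℂ)) • (A - B) := by
      rw [hY]; simp only [neg_smul, smul_sub]; abel
    rw [h4, smul_mul_assoc, norm_smul, hY, hsm]
    simp only [norm_mul, Complex.norm_I, one_mul, Complex.norm_real, Real.norm_eq_abs]
    gcongr
    exact hC σ ⟨hσ.1, hσ.2.le⟩
  have := norm_image_sub_le_of_norm_deriv_le_segment' (f := f) (a := 0) (b := 1)
    (fun σ _ => (hd σ).hasDerivWithinAt) hbound 1 ⟨zero_le_one, le_rfl⟩
  have h0 : f 1 - f 0 = -((NormedSpace.exp X - NormedSpace.exp Y) * P) := by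
    simp [hf, sub_mul]
  rw [h0, norm_neg] at this
  simpa using this

end

/-! ### Spectral projections and nested commutators -/

section
variable {E : Type*} [NormedAddCommGroup E] [InnerProductSpace ℂ E]
variable {ι : Type*} [Fintype ι]

/-- The operator that is diagonal in the orthonormal basis `b`, with diagonal entries `f`. -/
noncomputable def diagOp (b : OrthonormalBasis ι ℂ E) (f : ι → ℂ) : E →L[ℂ] E :=
  ∑ i, f i • InnerProductSpace.rankOne ℂ (b i) (b i)

variable (b : OrthonormalBasis ι ℂ E)

theorem diagOp_apply (f : ι → ℂ) (v : E) : diagOp b f v = ∑ i, (f i * b.repr v i) • b i := by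
  simp [diagOp, b.repr_apply_apply, smul_smul]

theorem repr_diagOp (f : ι → ℂ) (v : E) (i : ι) :
    b.repr (diagOp b f v) i = f i * b.repr v i := by
  classical
  rw [diagOp_apply, map_sum]
  simp [OrthonormalBasis.repr_self, Finset.sum_apply, Pi.single_apply]

theorem diagOp_mul (f g : ι → ℂ) : diagOp b f * diagOp b g = diagOp b (f * g) := by
  ext v
  apply b.repr.injective
  ext i
  simp [mul_apply_eq_comp, repr_diagOp, mul_assoc]

theorem diagOp_add (f g : ι → ℂ) : diagOp b f + diagOp b g = diagOp b (f + g) := by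
  simp [diagOp, add_smul, Finset.sum_add_distrib]

theorem diagOp_smul (c : ℂ) (f : ι → ℂ) : c • diagOp b f = diagOp b (c • f) := by
  simp [diagOp, Finset.smul_sum, smul_smul]

theorem diagOp_sub (f g : ι → ℂ) : diagOp b f - diagOp b g = diagOp b (f - g) := by
  simp [diagOp, sub_smul, Finset.sum_sub_distrib]

theorem diagOp_sum {κ : Type*} (s : Finset κ) (f : κ → ι → ℂ) :
    ∑ k ∈ s, diagOp b (f k) = diagOp b (∑ k ∈ s, f k) := by
  simp only [diagOp, Finset.sum_apply, Finset.sum_smul]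
  exact Finset.sum_comm

theorem diagOp_one : diagOp b 1 = 1 := by
  ext v
  apply b.repr.injective
  ext i
  simp [repr_diagOp]

theorem diagOp_zero : diagOp b 0 = 0 := by simp [diagOp]

theorem commute_diagOp (f g : ι → ℂ) : Commute (diagOp b f) (diagOp b g) := by
  rw [commute_iff_eq, diagOp_mul, diagOp_mul, mul_comm]

theorem norm_diagOp_le {f : ι → ℂ} {C : ℝ} (hC : 0 ≤ C) (hf : ∀ i, ‖f i‖ ≤ C) :
    ‖diagOp b f‖ ≤ C := by
  refine ContinuousLinearMap.opNorm_le_bound _ hC fun v => ?_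
  refine abs_le_of_sq_le_sq' ?_ (by positivity) |>.2
  rw [← b.repr.norm_map, ← b.repr.norm_map v, mul_pow, EuclideanSpace.norm_sq_eq,
    EuclideanSpace.norm_sq_eq, Finset.mul_sum]
  refine Finset.sum_le_sum fun i _ => ?_
  rw [repr_diagOp, norm_mul, mul_pow]
  gcongr
  exact hf i

theorem eq_diagOp {H : E →L[ℂ] E} {μ : ι → ℂ} (h : ∀ i, H (b i) = μ i • b i) :
    H = diagOp b μ := by
  classical
  apply ContinuousLinearMap.coe_injective
  refine b.toBasis.ext fun i => ?_
  simp [diagOp_apply, h, b.repr_self]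

theorem star_diagOp [CompleteSpace E] (f : ι → ℂ) : star (diagOp b f) = diagOp b (star f) := by
  simp [diagOp, star_sum, star_smul, ContinuousLinearMap.star_eq_adjoint]

theorem isSelfAdjoint_diagOp_ofReal [CompleteSpace E] (μ : ι → ℝ) :
    IsSelfAdjoint (diagOp b fun i => (μ i : ℂ)) := by
  rw [isSelfAdjoint_iff, star_diagOp]
  congr 1
  ext i
  simp

open Classical in
/-- The orthogonal projection onto the span of the basis vectors whose index satisfies `p`. -/
noncomputable def specProj (p : ι → Prop) : E →L[ℂ] E := diagOp b fun i => if p i then 1 else 0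

theorem isSelfAdjoint_specProj [CompleteSpace E] (p : ι → Prop) : IsSelfAdjoint (specProj b p) := by
  classical
  rw [isSelfAdjoint_iff, specProj, star_diagOp]
  congr 1
  ext i
  by_cases h : p i <;> simp [h]

theorem norm_specProj_le (p : ι → Prop) : ‖specProj b p‖ ≤ 1 := by
  classical
  refine norm_diagOp_le b zero_le_one fun i => ?_
  split_ifs <;> simp

theorem specProj_mul (p q : ι → Prop) :
    specProj b p * specProj b q = specProj b fun i => p i ∧ q i := by
  classical
  rw [specProj, specProj, specProj, diagOp_mul]
  congr 1
  ext i
  by_cases h : p i <;> by_cases h' : q i <;> simp [h, h']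

theorem specProj_add {p q : ι → Prop} (h : ∀ i, ¬(p i ∧ q i)) :
    specProj b p + specProj b q = specProj b fun i => p i ∨ q i := by
  classical
  rw [specProj, specProj, specProj, diagOp_add]
  congr 1
  ext i
  have := h i
  by_cases h : p i <;> by_cases h' : q i <;> simp_all

theorem one_sub_specProj (p : ι → Prop) : 1 - specProj b p = specProj b fun i => ¬ p i := by
  classical
  rw [specProj, specProj, ← diagOp_one b, diagOp_sub]
  congr 1
  ext i
  by_cases h : p i <;> simp [h]

theorem specProj_false {p : ι → Prop} (h : ∀ i, ¬ p i) : specProj b p = 0 := by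
  rw [specProj, ← diagOp_zero b]
  congr 1
  ext i
  simp [h]

/-- The commutator `[H, A]`. -/
def comm (H A : E →L[ℂ] E) : E →L[ℂ] E := H * A - A * H

/-- If the levels selected by `p` lie above those selected by `q` by a gap `w`, then the block
`P A Q` is determined by the block of the commutator with `H`, at the cost of a factor `1 / w`. -/
theorem gap_mul_norm_le {μ : ι → ℝ} {p q : ι → Prop} {e w : ℝ} (hw : 0 < w) (he : 0 ≤ e)
    (hq : ∀ i, q i → 0 ≤ μ i ∧ μ i ≤ e) (hp : ∀ i, p i → e + w ≤ μ i) (A : E →L[ℂ] E) :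
    w * ‖specProj b p * A * specProj b q‖ ≤
      ‖specProj b p * comm (diagOp b fun i => (μ i : ℂ)) A * specProj b q‖ := by
  classical
  set H := diagOp b fun i => (μ i : ℂ) with hH
  set P := specProj b p with hP
  set Q := specProj b q with hQ
  set X := P * A * Q with hX
  -- the spectral parameter is centred at the middle of `[0, e]`
  set Hc := diagOp b fun i => ((μ i - e / 2 : ℝ) : ℂ) with hHc
  have hHHc : H = Hc + ((e / 2 : ℝ) : ℂ) • (1 : E →L[ℂ] E) := by
    rw [hH, hHc, ← diagOp_one b, diagOp_smul, diagOp_add]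
    congr 1
    ext i
    simp
  have hPH : P * Hc = Hc * P := (commute_diagOp b _ _).eq
  have hQH : Q * Hc = Hc * Q := (commute_diagOp b _ _).eq
  have hY : P * comm H A * Q = Hc * X - X * Hc := by
    have h1 : comm H A = Hc * A - A * Hc := by
      rw [comm, hHHc]
      simp only [add_mul, mul_add, smul_mul_assoc, mul_smul_comm, one_mul, mul_one]
      abel
    rw [h1, hX, mul_sub, sub_mul]
    congr 1
    · simp only [← mul_assoc, hPH]
    · simp only [mul_assoc, hQH]
  -- `f` inverts the centred Hamiltonian on the range of `P`
  set f : ι → ℂ := fun i => if p i then (((μ i - e / 2 : ℝ) : ℂ))⁻¹ else 0 with hf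
  have h1 : diagOp b f * (Hc * X) = X := by
    have : diagOp b f * Hc * P = P := by
      rw [hHc, hP, specProj, diagOp_mul, diagOp_mul]
      congr 1
      ext i
      by_cases h : p i
      · have : ((μ i - e / 2 : ℝ) : ℂ) ≠ 0 := by
          rw [Complex.ofReal_ne_zero]
          have := hp i h
          linarith
        simp [hf, h, -Complex.ofReal_sub, inv_mul_cancel₀ this]
      · simp [hf, h]
    rw [hX, ← mul_assoc, ← mul_assoc, ← mul_assoc, this]
  have h2 : ‖diagOp b f‖ ≤ (e / 2 + w)⁻¹ := by
    refine norm_diagOp_le b (by positivity) fun i => ?_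
    rw [hf]
    by_cases h : p i
    · have := hp i h
      simp only [h, if_true, norm_inv, Complex.norm_real, Real.norm_eq_abs]
      gcongr
      rw [abs_of_nonneg] <;> linarith
    · simp [h]
      positivity
  have h3 : ‖X * Hc‖ ≤ ‖X‖ * (e / 2) := by
    have : X * Hc = X * diagOp b fun i => if q i then ((μ i - e / 2 : ℝ) : ℂ) else 0 := by
      rw [hX, mul_assoc, mul_assoc _ Q, hQ, specProj, hHc, diagOp_mul, diagOp_mul]
      congr 2
      ext i
      by_cases h : q i <;> simp [h]
    rw [this]
    refine (norm_mul_le _ _).trans ?_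
    gcongr
    refine norm_diagOp_le b (by positivity) fun i => ?_
    by_cases h : q i
    · have := hq i h
      simp only [h, if_true, Complex.norm_real, Real.norm_eq_abs]
      rw [abs_le]; constructor <;> linarith
    · simp [h]; positivity
  have h4 : (e / 2 + w) * ‖X‖ ≤ ‖Hc * X‖ := by
    have : ‖X‖ ≤ (e / 2 + w)⁻¹ * ‖Hc * X‖ := by
      conv_lhs => rw [← h1]
      exact (norm_mul_le _ _).trans (by gcongr)
    rwa [inv_mul_eq_div, le_div_iff₀ (by positivity), mul_comm] at this
  have h5 : ‖Hc * X‖ ≤ ‖P * comm H A * Q‖ + ‖X * Hc‖ := by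
    rw [hY]
    calc ‖Hc * X‖ = ‖(Hc * X - X * Hc) + X * Hc‖ := by rw [sub_add_cancel]
      _ ≤ _ := norm_add_le _ _
  linarith

/-- A spectral gap `w` suppresses the block `P A Q` by `w ^ (-n)` times the norm of `n` nested
commutators of `A` with the Hamiltonian. -/
theorem gap_pow_mul_norm_le {μ : ι → ℝ} {p q : ι → Prop} {e w : ℝ} (hw : 0 < w) (he : 0 ≤ e)
    (hq : ∀ i, q i → 0 ≤ μ i ∧ μ i ≤ e) (hp : ∀ i, p i → e + w ≤ μ i) (n : ℕ) (A : E →L[ℂ] E) :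
    w ^ n * ‖specProj b p * A * specProj b q‖ ≤
      ‖(comm (diagOp b fun i => (μ i : ℂ)))^[n] A‖ := by
  have key : w ^ n * ‖specProj b p * A * specProj b q‖ ≤
      ‖specProj b p * (comm (diagOp b fun i => (μ i : ℂ)))^[n] A * specProj b q‖ := by
    induction n with
    | zero => simp
    | succ n ih =>
      rw [pow_succ', mul_assoc, Function.iterate_succ_apply']
      exact (mul_le_mul_of_nonneg_left ih hw.le).trans (gap_mul_norm_le b hw he hq hp _)
  refine key.trans ?_
  calc _ ≤ ‖specProj b p‖ * ‖(comm (diagOp b fun i => (μ i : ℂ)))^[n] A‖ * ‖specProj b q‖ :=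
        (norm_mul_le _ _).trans (by gcongr; exact norm_mul_le _ _)
    _ ≤ 1 * ‖(comm (diagOp b fun i => (μ i : ℂ)))^[n] A‖ * 1 := by
        gcongr <;> exact norm_specProj_le b _
    _ = _ := by ring

/-- The projection onto the low-energy eigenvectors, read off from an eigenbasis. -/
theorem starProjection_iSup_eigenspace [FiniteDimensional ℂ E] (μ : ι → ℝ) (Δ : ℝ) :
    (⨆ (x : ℝ) (_ : x ≤ Δ), Module.End.eigenspace
      ((diagOp b fun i => (μ i : ℂ) : E →L[ℂ] E) : Module.End ℂ E) (x : ℂ)).starProjection =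
      specProj b fun i => μ i ≤ Δ := by
  classical
  set H := diagOp b fun i => (μ i : ℂ) with hH
  have hb : ∀ i, H (b i) = (μ i : ℂ) • b i := by
    intro i
    simp [hH, diagOp_apply, b.repr_self]
  ext v
  refine Submodule.eq_starProjection_of_mem_orthogonal ?_ ?_
  · rw [specProj, diagOp_apply]
    refine Submodule.sum_mem _ fun i _ => ?_
    by_cases h : μ i ≤ Δ
    · refine Submodule.smul_mem _ _ ?_
      refine Submodule.mem_iSup_of_mem (μ i) (Submodule.mem_iSup_of_mem h ?_)
      rw [Module.End.mem_eigenspace_iff]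
      exact hb i
    · simp [h]
  · rw [Submodule.mem_orthogonal]
    intro u hu
    have hzero : ∀ i, ¬ μ i ≤ Δ → b.repr u i = 0 := by
      intro i hi
      refine Submodule.iSup_induction' _ (motive := fun u _ => b.repr u i = 0) ?_ ?_ ?_ hu
      · intro x u hu
        by_cases hx : x ≤ Δ
        · simp only [hx, iSup_pos] at hu
          rw [Module.End.mem_eigenspace_iff] at hu
          have h1 : b.repr (H u) i = (μ i : ℂ) * b.repr u i := repr_diagOp b _ u i
          have h2 : H u = (x : ℂ) • u := hu
          rw [h2, map_smul] at h1
          have h3 : ((x : ℂ) - μ i) * b.repr u i = 0 := by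
            rw [sub_mul, ← h1]
            simp
          rcases mul_eq_zero.1 h3 with h4 | h4
          · exfalso
            have : x = μ i := by exact_mod_cast sub_eq_zero.1 h4
            exact hi (this ▸ hx)
          · exact h4
        · simp only [hx, iSup_neg, not_false_eq_true, Submodule.mem_bot] at hu
          simp [hu]
      · simp
      · intro x y _ _ hx hy
        simp [hx, hy]
    have h5 : v - specProj b (fun i => μ i ≤ Δ) v = specProj b (fun i => ¬ μ i ≤ Δ) v := by
      rw [← one_sub_specProj]; rfl
    rw [h5, ← b.repr.inner_map_map, PiLp.inner_apply]
    refine Finset.sum_eq_zero fun i _ => ?_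
    by_cases h : μ i ≤ Δ
    · rw [specProj, repr_diagOp]; simp [h]
    · simp [hzero i h]

end

/-! ### Locality and power-law Hamiltonians -/

section
variable {S : Type*} [Fintype S] [DecidableEq S]

theorem op_ext {A B : Op S} (h : ∀ x y, matElem A x y = matElem B x y) : A = B := by
  apply ContinuousLinearMap.coe_injective
  refine (EuclideanSpace.basisFun (S → Fin 2) ℂ).toBasis.ext fun y => ?_
  ext x
  simpa [matElem] using h x y

theorem matElem_sub (A B : Op S) (x y : S → Fin 2) :
    matElem (A - B) x y = matElem A x y - matElem B x y := by
  simp [matElem]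

theorem matElem_mul (A B : Op S) (x y : S → Fin 2) :
    matElem (A * B) x y = ∑ z, matElem A x z * matElem B z y := by
  have h : B (EuclideanSpace.single y 1) =
      ∑ z, matElem B z y • (EuclideanSpace.single z (1 : ℂ) : Qubits S) := by
    ext z
    simp [matElem, Finset.sum_apply, Pi.single_apply]
  rw [matElem, mul_apply_eq_comp, h, map_sum]
  simp [Finset.sum_apply, matElem, mul_comm]

theorem SupportedOn.mono {T T' : Set S} {A : Op S} (h : SupportedOn T A) (hT : T ⊆ T') :
    SupportedOn T' A := by
  refine ⟨fun x y ⟨v, hv, hxy⟩ => h.1 x y ⟨v, fun hv' => hv (hT hv'), hxy⟩, ?_⟩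
  intro x y x' y' hxy hxy' hx hy
  by_cases hne : ∃ v, v ∉ T ∧ x v ≠ y v
  · rw [h.1 x y hne]
    obtain ⟨v, hv, hvne⟩ := hne
    have hvT : v ∈ T' := by
      by_contra hv'
      exact hvne (hxy v hv')
    rw [h.1 x' y' ⟨v, hv, by rwa [← hx v hvT, ← hy v hvT]⟩]
  · push Not at hne
    refine h.2 x y x' y' hne (fun v hv => ?_) (fun v hv => hx v (hT hv)) fun v hv => hy v (hT hv)
    by_cases hvT : v ∈ T'
    · rw [← hx v hvT, ← hy v hvT, hne v hv]
    · exact hxy' v hvT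

theorem SupportedOn.sub {T : Set S} {A B : Op S} (hA : SupportedOn T A) (hB : SupportedOn T B) :
    SupportedOn T (A - B) := by
  refine ⟨fun x y h => ?_, fun x y x' y' h1 h2 h3 h4 => ?_⟩
  · rw [matElem_sub, hA.1 x y h, hB.1 x y h, sub_zero]
  · rw [matElem_sub, matElem_sub, hA.2 x y x' y' h1 h2 h3 h4, hB.2 x y x' y' h1 h2 h3 h4]

/-- The product of operators supported on `T` is supported on `T`: relabelling the intermediate
state off `T` is a bijection between the sums that compute two matrix elements. -/
theorem SupportedOn.mul {T : Set S} {A B : Op S} (hA : SupportedOn T A) (hB : SupportedOn T B) :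
    SupportedOn T (A * B) := by
  classical
  refine ⟨fun x y ⟨v, hv, hxy⟩ => ?_, fun x y x' y' h1 h2 h3 h4 => ?_⟩
  · rw [matElem_mul]
    refine Finset.sum_eq_zero fun z _ => ?_
    by_cases hz : x v = z v
    · rw [hB.1 z y ⟨v, hv, hz ▸ hxy⟩, mul_zero]
    · rw [hA.1 x z ⟨v, hv, hz⟩, zero_mul]
  · -- only the intermediate states that agree with the outer ones off `T` contribute
    have hres : ∀ x y, ∑ z, matElem A x z * matElem B z y =
        ∑ z with ∀ v, v ∉ T → x v = z v, matElem A x z * matElem B z y := by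
      intro x y
      symm
      refine Finset.sum_subset (Finset.filter_subset _ _) fun z _ hz => ?_
      have : ∃ v, v ∉ T ∧ x v ≠ z v := by simpa using hz
      rw [hA.1 x z this, zero_mul]
    rw [matElem_mul, matElem_mul, hres, hres]
    refine Finset.sum_nbij' (fun z v => if v ∈ T then z v else x' v)
      (fun z v => if v ∈ T then z v else x v) ?_ ?_ ?_ ?_ ?_
    · intro z _
      simp only [Finset.mem_filter, Finset.mem_univ, true_and]
      intro v hv
      simp [hv]
    · intro z _
      simp only [Finset.mem_filter, Finset.mem_univ, true_and]
      intro v hv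
      simp [hv]
    · intro z hz
      simp only [Finset.mem_filter, Finset.mem_univ, true_and] at hz
      funext v
      by_cases hv : v ∈ T
      · simp [hv]
      · simp [hv, hz v hv]
    · intro z hz
      simp only [Finset.mem_filter, Finset.mem_univ, true_and] at hz
      funext v
      by_cases hv : v ∈ T
      · simp [hv]
      · simp [hv, hz v hv]
    · intro z hz
      simp only [Finset.mem_filter, Finset.mem_univ, true_and] at hz
      congr 1
      · refine hA.2 _ _ _ _ hz (fun v hv => by simp [hv]) h3 fun v hv => by simp [hv]
      · refine hB.2 _ _ _ _ (fun v hv => by rw [← hz v hv, h1 v hv])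
          (fun v hv => by simp [hv, h2 v hv]) (fun v hv => by simp [hv]) h4

theorem SupportedOn.comm_eq_zero {T T' : Set S} {A B : Op S} (hA : SupportedOn T A)
    (hB : SupportedOn T' B) (hd : Disjoint T T') : comm A B = 0 := by
  classical
  have hdis : ∀ v, v ∈ T → v ∉ T' := fun v h h' => Set.disjoint_left.1 hd h h'
  rw [comm, sub_eq_zero]
  refine op_ext fun x y => ?_
  rw [matElem_mul, matElem_mul]
  by_cases hne : ∃ v, v ∉ T ∧ v ∉ T' ∧ x v ≠ y v
  · obtain ⟨v, hv, hv', hxy⟩ := hne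
    rw [Finset.sum_eq_zero, Finset.sum_eq_zero]
    · intro z _
      by_cases hz : x v = z v
      · rw [hA.1 z y ⟨v, hv, hz ▸ hxy⟩, mul_zero]
      · rw [hB.1 x z ⟨v, hv', hz⟩, zero_mul]
    · intro z _
      by_cases hz : x v = z v
      · rw [hB.1 z y ⟨v, hv', hz ▸ hxy⟩, mul_zero]
      · rw [hA.1 x z ⟨v, hv, hz⟩, zero_mul]
  · push Not at hne
    -- a single intermediate state contributes on either side
    rw [Finset.sum_eq_single (fun v => if v ∈ T then y v else x v),
      Finset.sum_eq_single (fun v => if v ∈ T' then y v else x v), mul_comm]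
    · congr 1
      · refine hB.2 _ _ _ _ (fun v hv => ?_) (fun v hv => by simp [hv])
          (fun v hv => ?_) fun v hv => by simp [hv]
        · by_cases h : v ∈ T
          · simp [h]
          · simp [h, hne v h hv]
        · have : v ∉ T := fun h => hdis v h hv
          simp [this]
      · refine hA.2 _ _ _ _ (fun v hv => by simp [hv]) (fun v hv => ?_)
          (fun v hv => by simp [hdis v hv]) fun v hv => by simp [hv]
        by_cases h : v ∈ T'
        · simp [h]
        · simp [h, hne v hv h]
    · intro z _ hz
      obtain ⟨v, hv⟩ := Function.ne_iff.1 hz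
      by_cases h : v ∈ T'
      · have h1 : v ∉ T := fun h' => hdis v h' h
        rw [hA.1 z y ⟨v, h1, by simpa [h] using hv⟩, mul_zero]
      · rw [hB.1 x z ⟨v, h, by simpa [h, eq_comm] using hv⟩, zero_mul]
    · simp
    · intro z _ hz
      obtain ⟨v, hv⟩ := Function.ne_iff.1 hz
      by_cases h : v ∈ T
      · rw [hB.1 z y ⟨v, hdis v h, by simpa [h] using hv⟩, mul_zero]
      · rw [hA.1 x z ⟨v, h, by simpa [h, eq_comm] using hv⟩, zero_mul]
    · simp

end

section
variable {E : Type*} [NormedAddCommGroup E] [InnerProductSpace ℂ E]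

theorem iterate_comm_sum {κ : Type*} (H : E →L[ℂ] E) (s : Finset κ) (A : κ → E →L[ℂ] E) (n : ℕ) :
    (comm H)^[n] (∑ k ∈ s, A k) = ∑ k ∈ s, (comm H)^[n] (A k) := by
  induction n with
  | zero => rfl
  | succ n ih =>
    simp only [Function.iterate_succ_apply', ih, comm, Finset.mul_sum, Finset.sum_mul,
      Finset.sum_sub_distrib]

theorem isSelfAdjoint_finset_sum [CompleteSpace E] {κ : Type*} {s : Finset κ} {f : κ → E →L[ℂ] E}
    (h : ∀ k, IsSelfAdjoint (f k)) : IsSelfAdjoint (∑ k ∈ s, f k) :=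
  isSelfAdjoint_sum s fun k _ => h k

theorem isSelfAdjoint_smul_one_add [CompleteSpace E] {c : ℝ} {A : E →L[ℂ] E}
    (h : IsSelfAdjoint A) : IsSelfAdjoint ((c : ℂ) • (1 : E →L[ℂ] E) + A) := by
  refine IsSelfAdjoint.add ?_ h
  rw [isSelfAdjoint_iff, star_smul, star_one]
  simp

theorem norm_comm_le (A B : E →L[ℂ] E) : ‖comm A B‖ ≤ 2 * ‖A‖ * ‖B‖ := by
  calc ‖comm A B‖ ≤ ‖A * B‖ + ‖B * A‖ := norm_sub_le _ _
    _ ≤ ‖A‖ * ‖B‖ + ‖B‖ * ‖A‖ := add_le_add (norm_mul_le _ _) (norm_mul_le _ _)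
    _ = _ := by ring

end

section
variable {S : Type*} [Fintype S] [DecidableEq S]

/-- Nested commutators of a local operator with a Hamiltonian made of two-site terms whose norms sum
to at most `g` at every site: each commutator enlarges the support by at most one site, and
only the terms that touch the current support contribute to the next one. -/
theorem norm_iterate_comm_le {κ : Type*} [Fintype κ] {H : Op S} {c : ℂ} {h : κ → Op S}
    {X : κ → Finset S} {g : ℝ} (hg0 : 0 ≤ g) (hH : H = c • 1 + ∑ k, h k)
    (hX : ∀ k, SupportedOn (X k : Set S) (h k)) (hcard : ∀ k, (X k).card ≤ 2)
    (hg : ∀ v, ∑ k with v ∈ X k, ‖h k‖ ≤ g) (n : ℕ) :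
    ∀ (m : ℕ) (T : Finset S) (A : Op S), T.card ≤ m → SupportedOn (T : Set S) A →
      ‖(comm H)^[n] A‖ ≤ (2 * g) ^ n * m.ascFactorial n * ‖A‖ := by
  induction n with
  | zero => intro m T A _ _; simp
  | succ n ih =>
    intro m T A hT hA
    have h1 : comm H A = ∑ k with ¬ Disjoint (X k) T, comm (h k) A := by
      have : comm H A = ∑ k, comm (h k) A := by
        rw [hH]
        simp only [comm, add_mul, mul_add, smul_mul_assoc, mul_smul_comm, one_mul, mul_one,
          Finset.sum_mul, Finset.mul_sum, Finset.sum_sub_distrib]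
        abel
      rw [this, Finset.sum_filter]
      refine Finset.sum_congr rfl fun k _ => ?_
      by_cases hd : Disjoint (X k) T
      · rw [if_neg (not_not.2 hd), (hX k).comm_eq_zero hA (Finset.disjoint_coe.2 hd)]
      · rw [if_pos hd]
    rw [Function.iterate_succ_apply, h1, iterate_comm_sum]
    have h2 : ∀ k ∈ Finset.univ.filter (fun k => ¬ Disjoint (X k) T),
        ‖(comm H)^[n] (comm (h k) A)‖ ≤
          (2 * g) ^ n * (m + 1).ascFactorial n * (2 * ‖h k‖ * ‖A‖) := by
      intro k hk
      have hk' : ¬ Disjoint (X k) T := (Finset.mem_filter.1 hk).2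
      refine (ih (m + 1) (X k ∪ T) _ ?_ ?_).trans ?_
      · have h3 := Finset.card_union_add_card_inter (X k) T
        have h4 : 0 < (X k ∩ T).card :=
          Finset.card_pos.2 (Finset.not_disjoint_iff_nonempty_inter.1 hk')
        have := hcard k
        omega
      · have e1 : ((X k : Finset S) : Set S) ⊆ ((X k ∪ T : Finset S) : Set S) := by simp
        have e2 : ((T : Finset S) : Set S) ⊆ ((X k ∪ T : Finset S) : Set S) := by simp
        exact (((hX k).mono e1).mul (hA.mono e2)).sub ((hA.mono e2).mul ((hX k).mono e1))
      · gcongr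
        exact norm_comm_le _ _
    have h5 : ∑ k with ¬ Disjoint (X k) T, ‖h k‖ ≤ m * g := by
      calc ∑ k with ¬ Disjoint (X k) T, ‖h k‖
          ≤ ∑ k, ∑ v ∈ T, if v ∈ X k then ‖h k‖ else 0 := by
            rw [Finset.sum_filter]
            refine Finset.sum_le_sum fun k _ => ?_
            have h6 : ∀ v ∈ T, 0 ≤ if v ∈ X k then ‖h k‖ else 0 := fun v _ => by
              split_ifs <;> simp
            by_cases hd : Disjoint (X k) T
            · rw [if_neg (not_not.2 hd)]
              exact Finset.sum_nonneg h6
            · rw [if_pos hd]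
              obtain ⟨v, hv, hvT⟩ := Finset.not_disjoint_iff.1 hd
              exact (by simp [hv] : ‖h k‖ ≤ if v ∈ X k then ‖h k‖ else 0).trans
                (Finset.single_le_sum h6 hvT)
        _ = ∑ v ∈ T, ∑ k with v ∈ X k, ‖h k‖ := by
            rw [Finset.sum_comm]
            simp only [Finset.sum_filter]
        _ ≤ ∑ v ∈ T, g := Finset.sum_le_sum fun v _ => hg v
        _ = T.card * g := by simp
        _ ≤ m * g := by gcongr
    calc ‖∑ k with ¬ Disjoint (X k) T, (comm H)^[n] (comm (h k) A)‖
        ≤ ∑ k with ¬ Disjoint (X k) T, (2 * g) ^ n * (m + 1).ascFactorial n * (2 * ‖h k‖ * ‖A‖) :=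
          (norm_sum_le _ _).trans (Finset.sum_le_sum h2)
      _ = (2 * g) ^ n * (m + 1).ascFactorial n * 2 * ‖A‖ *
            ∑ k with ¬ Disjoint (X k) T, ‖h k‖ := by
          rw [Finset.mul_sum]
          exact Finset.sum_congr rfl fun k _ => by ring
      _ ≤ (2 * g) ^ n * (m + 1).ascFactorial n * 2 * ‖A‖ * (m * g) := by gcongr
      _ = (2 * g) ^ (n + 1) * ((m * (m + 1).ascFactorial n : ℕ) : ℝ) * ‖A‖ := by
          push_cast; ring
      _ = (2 * g) ^ (n + 1) * m.ascFactorial (n + 1) * ‖A‖ := by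
          rw [Nat.succ_ascFactorial, ← Nat.ascFactorial_succ]

end

namespace PowerLawHamiltonian
variable {D : ℕ} {α : ℝ} {Λ : Finset (Fin D → ℤ)} {L : ℕ}

theorem total_eq (H : PowerLawHamiltonian D α Λ L) :
    H.total = ((∑ l, H.shift l : ℝ) : ℂ) • (1 : Op Λ) +
      ∑ k : Fin L × Λ × Λ, H.term k.1 k.2.1 k.2.2 := by
  simp only [total, part, Finset.sum_add_distrib, Fintype.sum_prod_type, Complex.ofReal_sum]
  congr 1
  exact Finset.sum_smul.symm

theorem isSelfAdjoint_part (H : PowerLawHamiltonian D α Λ L) (l : Fin L) :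
    IsSelfAdjoint (H.part l) :=
  isSelfAdjoint_smul_one_add (isSelfAdjoint_finset_sum fun i => isSelfAdjoint_finset_sum fun j =>
    H.isSelfAdjoint_term l i j)

theorem norm_part_sub_shift_le (H : PowerLawHamiltonian D α Λ L) (l : Fin L) :
    ‖H.part l - (H.shift l : ℂ) • (1 : Op Λ)‖ ≤ H.partStrength l := by
  rw [part, add_sub_cancel_left]
  exact (norm_sum_le _ _).trans (Finset.sum_le_sum fun i _ => norm_sum_le _ _)

/-- Nested commutators of a part with the Hamiltonian grow factorially only: the terms start with
a support of two sites, and each commutator adds at most one. -/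
theorem norm_iterate_comm_part_le (H : PowerLawHamiltonian D α Λ L) {g : ℝ} (hg0 : 0 ≤ g)
    (hg : ∀ v, H.siteStrength v ≤ g) (n : ℕ) (l : Fin L) :
    ‖(comm H.total)^[n] (H.part l - (H.shift l : ℂ) • (1 : Op Λ))‖ ≤
      (2 * g) ^ n * (n + 1).factorial * H.partStrength l := by
  classical
  have key : ∀ i j, ‖(comm H.total)^[n] (H.term l i j)‖ ≤
      (2 * g) ^ n * (n + 1).factorial * ‖H.term l i j‖ := by
    intro i j
    have := norm_iterate_comm_le (S := Λ) hg0 H.total_eq (X := fun k => {k.2.1, k.2.2}) (g := g)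
      (fun k => by simpa using H.supportedOn_term k.1 k.2.1 k.2.2) (fun k => Finset.card_le_two)
      (fun v => by
        refine le_trans (le_of_eq ?_) (hg v)
        rw [Finset.sum_filter, siteStrength, Fintype.sum_prod_type]
        refine Finset.sum_congr rfl fun l _ => ?_
        rw [Fintype.sum_prod_type]
        refine Finset.sum_congr rfl fun i _ => Finset.sum_congr rfl fun j _ => ?_
        simp [eq_comm])
      n 2 {i, j} (H.term l i j) Finset.card_le_two (by simpa using H.supportedOn_term l i j)
    refine this.trans_eq ?_
    congr 3
    have := Nat.factorial_mul_ascFactorial 1 n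
    rw [Nat.factorial_one, one_mul] at this
    rw [this, add_comm]
  rw [part, add_sub_cancel_left, iterate_comm_sum]
  simp only [iterate_comm_sum, partStrength, Finset.mul_sum]
  exact (norm_sum_le _ _).trans (Finset.sum_le_sum fun i _ =>
    (norm_sum_le _ _).trans (Finset.sum_le_sum fun j _ => key i j))

end PowerLawHamiltonian

/-! ### Consequences of the order condition -/

section
variable {E : Type*} [NormedAddCommGroup E] [InnerProductSpace ℂ E] {L : ℕ}

/-- If the generators commute, a product of exponentials is the exponential of the sum. -/
theorem gateProd_of_commute [CompleteSpace E] {A : Fin L → E →L[ℂ] E}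
    (hA : ∀ l l', Commute (A l) (A l')) (c : List (Fin L × ℝ)) (z : ℂ) :
    gateProd A c z =
      NormedSpace.exp ((-(Complex.I * z)) • (c.map fun s => (s.2 : ℂ) • A s.1).sum) := by
  let _ : NormedAlgebra ℚ (E →L[ℂ] E) := NormedAlgebra.restrictScalars ℚ ℂ _
  induction c with
  | nil => simp
  | cons s c ih =>
    have hcomm : Commute ((c.map fun s => (s.2 : ℂ) • A s.1).sum) (A s.1) := by
      refine Commute.list_sum_left _ _ fun x hx => ?_
      obtain ⟨y, -, rfl⟩ := List.mem_map.1 hx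
      exact (hA y.1 s.1).smul_left _
    rw [gateProd_cons, ih, ← NormedSpace.exp_add_of_commute
      ((hcomm.smul_left _).smul_right _), List.map_cons, List.sum_cons, smul_add, smul_smul,
      add_comm]
    congr 3
    ring

theorem hasDerivAt_exp_neg_I_smul [CompleteSpace E] (X : E →L[ℂ] E) :
    HasDerivAt (fun δ : ℝ => NormedSpace.exp ((-(Complex.I * (δ : ℂ))) • X))
      ((-Complex.I) • X) 0 := by
  have h := hasDerivAt_exp_smul_const (𝕂 := ℝ) ((-Complex.I) • X) 0
  simp only [zero_smul, NormedSpace.exp_zero, one_mul] at h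
  refine h.congr_of_eventuallyEq (Eventually.of_forall fun δ => ?_)
  dsimp only
  rw [← Complex.coe_smul, smul_smul]
  congr 2
  ring

/-- The order condition, stated for matrices, holds on every finite-dimensional Hilbert space. -/
theorem ProductFormula.HasOrder.isBigO [FiniteDimensional ℂ E] {W : ProductFormula L} {p : ℕ}
    (hW : W.HasOrder p) {A : Fin L → E →L[ℂ] E} (hA : ∀ l, IsSelfAdjoint (A l)) :
    (fun δ : ℝ => gateProd A W.seq δ - NormedSpace.exp ((-(Complex.I * (δ : ℂ))) • ∑ l, A l))
      =O[𝓝 0] fun δ : ℝ => δ ^ (p + 1) := by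
  have : CompleteSpace E := FiniteDimensional.complete ℂ E
  set e := (stdOrthonormalBasis ℂ E).repr
  set Φ := e.conjStarAlgEquiv with hΦ
  have hnorm : ∀ X, ‖Φ X‖ = ‖X‖ := fun X => NonUnitalStarAlgHom.norm_map Φ Φ.injective X
  have hcont : Continuous Φ := by
    refine AddMonoidHomClass.continuous_of_bound Φ 1 fun X => ?_
    rw [hnorm, one_mul]
  have hexp : ∀ X, Φ (NormedSpace.exp X) = NormedSpace.exp (Φ X) := fun X => by
    let _ : NormedAlgebra ℚ (E →L[ℂ] E) := NormedAlgebra.restrictScalars ℚ ℂ _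
    exact NormedSpace.map_exp Φ hcont X
  have hprod : ∀ (c : List (Fin L × ℝ)) (z : ℂ),
      Φ (gateProd A c z) = gateProd (fun l => Φ (A l)) c z := by
    intro c z
    induction c with
    | nil => simp
    | cons s c ih => rw [gateProd_cons, gateProd_cons, map_mul, ih, hexp, map_smul]
  have h := hW _ (fun l => Φ (A l)) fun l => (hA l).map Φ
  refine IsBigO.trans (IsBigO.of_bound 1 (Eventually.of_forall fun δ => ?_)) h
  rw [one_mul, toOp_eq_gateProd, evolution, ← hprod, ← map_sum, ← map_smul, ← hexp, ← map_sub,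
    hnorm]

/-- For commuting generators, the generators weighted with the coefficients of the product formula
add up to the Hamiltonian, by comparison of the derivatives at `δ = 0`. -/
theorem ProductFormula.HasOrder.sum_eq [FiniteDimensional ℂ E] {W : ProductFormula L} {p : ℕ}
    (hp : 1 ≤ p) (hW : W.HasOrder p) {A : Fin L → E →L[ℂ] E} (hA : ∀ l, IsSelfAdjoint (A l))
    (hc : ∀ l l', Commute (A l) (A l')) :
    (W.seq.map fun s => (s.2 : ℂ) • A s.1).sum = ∑ l, A l := by
  have : CompleteSpace E := FiniteDimensional.complete ℂ E
  have h := hW.isBigO hA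
  simp only [gateProd_of_commute hc] at h
  set X := (W.seq.map fun s => (s.2 : ℂ) • A s.1).sum
  set Y := ∑ l, A l
  have h1 := (hasDerivAt_exp_neg_I_smul X).sub (hasDerivAt_exp_neg_I_smul Y)
  have h2 : HasDerivAt (fun δ : ℝ => NormedSpace.exp ((-(Complex.I * (δ : ℂ))) • X) -
      NormedSpace.exp ((-(Complex.I * (δ : ℂ))) • Y)) 0 0 := by
    rw [hasDerivAt_iff_isLittleO]
    have h3 : (fun δ : ℝ => δ ^ (p + 1)) =o[𝓝 0] fun δ : ℝ => δ :=
      isLittleO_pow_id (by omega)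
    exact (h.trans_isLittleO h3).congr (fun δ => by simp) fun δ => by simp
  have h4 := h1.unique h2
  rw [← smul_sub, smul_eq_zero] at h4
  exact sub_eq_zero.1 (h4.resolve_left (by simp))

theorem ProductFormula.HasOrder.gateProd_eq_of_commute [FiniteDimensional ℂ E]
    {W : ProductFormula L} {p : ℕ}
    (hp : 1 ≤ p) (hW : W.HasOrder p) {A : Fin L → E →L[ℂ] E} (hA : ∀ l, IsSelfAdjoint (A l))
    (hc : ∀ l l', Commute (A l) (A l')) (δ : ℝ) :
    gateProd A W.seq δ = evolution (∑ l, A l) δ := by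
  have : CompleteSpace E := FiniteDimensional.complete ℂ E
  rw [gateProd_of_commute hc, hW.sum_eq hp hA hc, evolution]

theorem list_sum_smul_eq_zero {A : Fin L → E →L[ℂ] E} {c : List (Fin L × ℝ)}
    (h : ∀ s ∈ c, A s.1 = 0) : (c.map fun s => (s.2 : ℂ) • A s.1).sum = 0 := by
  refine List.sum_eq_zero fun x hx => ?_
  obtain ⟨s, hs, rfl⟩ := List.mem_map.1 hx
  rw [h s hs, smul_zero]

/-- Every part occurs in a product formula of positive order. It suffices to take the `l`-th
generator to be `1` and the other generators to be `0`, on a one-dimensional space. -/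
theorem ProductFormula.HasOrder.exists_mem {W : ProductFormula L} {p : ℕ}
    (hp : 1 ≤ p) (hW : W.HasOrder p) (l : Fin L) : ∃ s ∈ W.seq, s.1 = l := by
  by_contra! hne
  set A : Fin L → EuclideanSpace ℂ (Fin 1) →L[ℂ] EuclideanSpace ℂ (Fin 1) :=
    fun l' => if l' = l then 1 else 0 with hA
  have h := hW.sum_eq hp (A := A) (fun l' => by rw [hA]; dsimp only; split_ifs <;> simp)
    (fun l' l'' => by
      rw [hA]; dsimp only
      split_ifs <;> simp)
  have h0 : (W.seq.map fun s => (s.2 : ℂ) • A s.1).sum = 0 :=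
    list_sum_smul_eq_zero fun s hs => by simp [hA, hne s hs]
  rw [h0] at h
  simp [hA] at h

theorem ProductFormula.HasOrder.le_length {W : ProductFormula L} {p : ℕ}
    (hp : 1 ≤ p) (hW : W.HasOrder p) : L ≤ W.length := by
  classical
  have h1 : (Finset.univ : Finset (Fin L)) ⊆ (W.seq.map Prod.fst).toFinset := by
    intro l _
    obtain ⟨s, hs, rfl⟩ := hW.exists_mem hp l
    exact List.mem_toFinset.2 (List.mem_map_of_mem hs)
  have h2 := Finset.card_le_card h1
  rw [Finset.card_univ, Fintype.card_fin] at h2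
  refine h2.trans ((List.toFinset_card_le _).trans ?_)
  rw [List.length_map, ProductFormula.length]

theorem evolution_natCast_mul [CompleteSpace E] (A : E →L[ℂ] E) (δ : ℝ) (r : ℕ) :
    evolution A (r * δ) = evolution A δ ^ r := by
  let _ : NormedAlgebra ℚ (E →L[ℂ] E) := NormedAlgebra.restrictScalars ℚ ℂ _
  rw [evolution, evolution, ← NormedSpace.exp_nsmul, ← Nat.cast_smul_eq_nsmul ℂ, smul_smul]
  congr 2
  push_cast
  ring

/-- Errors of repeated steps add up, provided that the exact evolution preserves the subspace. -/
theorem norm_pow_sub_pow_mul_le {U V P : E →L[ℂ] E} [CompleteSpace E]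
    (hU : U ∈ unitary (E →L[ℂ] E)) (hV : V ∈ unitary (E →L[ℂ] E)) (hVP : Commute V P) (r : ℕ) :
    ‖(U ^ r - V ^ r) * P‖ ≤ r * ‖(U - V) * P‖ := by
  induction r with
  | zero => simp
  | succ r ih =>
    have h : (U ^ (r + 1) - V ^ (r + 1)) * P =
        U ^ r * ((U - V) * P) + ((U ^ r - V ^ r) * P) * V := by
      have h1 : V * P = P * V := hVP.eq
      have h2 : (U ^ r - V ^ r) * P * V = (U ^ r - V ^ r) * V * P := by
        rw [mul_assoc, mul_assoc, h1]
      rw [h2, pow_succ, pow_succ]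
      noncomm_ring
    rw [h]
    refine (norm_add_le _ _).trans ?_
    rw [CStarRing.norm_mem_unitary_mul _ (pow_mem hU r), CStarRing.norm_mul_mem_unitary _ hV]
    push_cast
    linarith

end

/-! ### Growth of products of exponentials -/

section
variable {E : Type*} [NormedAddCommGroup E] [InnerProductSpace ℂ E] {L : ℕ}

theorem list_sum_map_fst_eq (c : List (Fin L × ℝ)) (f : Fin L → ℝ) :
    (c.map fun s => f s.1).sum = ∑ l, (c.countP fun s => s.1 = l : ℕ) * f l := by
  induction c with
  | nil => simp
  | cons s c ih =>
    simp only [List.map_cons, List.sum_cons, ih, List.countP_cons, Nat.cast_add, add_mul,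
      Finset.sum_add_distrib]
    simp [add_comm]

theorem ProductFormula.BoundedBy.length_le {c : List (Fin L × ℝ)} {κ : ℝ}
    (h : (ProductFormula.mk c).BoundedBy κ) : (c.length : ℝ) ≤ κ * L := by
  have h1 := list_sum_map_fst_eq c fun _ => 1
  simp only [List.map_const', List.sum_replicate, nsmul_eq_mul, mul_one] at h1
  rw [h1]
  calc _ ≤ ∑ l : Fin L, κ := Finset.sum_le_sum fun l _ => h.1 l
    _ = κ * L := by simp [mul_comm]

variable [CompleteSpace E]

/-- A product formula for positive parts with sum at most `S` stays bounded at complex times of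
size `1 / (S log q)`, whatever the norms of the individual parts. -/
theorem norm_gateProd_le_two {A : Fin L → E →L[ℂ] E} {S κ ρ : ℝ} {k : ℕ} (hS0 : 0 ≤ S)
    (hκ : 0 ≤ κ) (hA : ∀ l, (A l).IsPositive)
    (hS : ∀ v, ∑ l, (inner ℂ v (A l v)).re ≤ S * ‖v‖ ^ 2)
    {gs : List (Fin L × ℝ)} (hc : (ProductFormula.mk gs).BoundedBy κ) (hlen : gs.length ≤ 2 ^ k)
    (hρ : 4 * κ ^ 2 * (k + 1) * S * ρ ≤ 1) {z : ℂ} (hz : ‖z‖ ≤ ρ) :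
    ‖gateProd A gs z‖ ≤ 2 := by
  have hρ0 : 0 ≤ ρ := (norm_nonneg _).trans hz
  have hpos : ∀ l v, 0 ≤ (inner ℂ v (A l v)).re := fun l v =>
    (Complex.nonneg_iff.1 ((hA l).inner_nonneg_right v)).1
  set A' : ℕ → E →L[ℂ] E := fun j => if h : j < gs.length then A gs[j].1 else 0 with hA'
  set w : ℕ → ℂ := fun j =>
    if h : j < gs.length then -(Complex.I * (gs[j].2 : ℂ) * z) else 0 with hw
  refine ContinuousLinearMap.opNorm_le_bound _ zero_le_two fun v => ?_
  have h := norm_orbit_le (A := A') (w := w) (S := κ * S) (ρ := κ * ρ) (k := k)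
    (x := fun j => gateProd A (gs.take j) z v) (by positivity) ?_ ?_ ?_ (by linarith) ?_ hlen
  · simpa using h
  · intro j
    by_cases hj : j < gs.length
    · simpa [hA', hj] using hA _
    · simp [hA', hj]
  · intro s u
    have h1 : ∀ j ∉ Finset.range gs.length, (inner ℂ u (A' j u)).re = 0 := by
      intro j hj
      have : ¬ j < gs.length := by simpa using hj
      simp [hA', this]
    have h0 : ∀ j, 0 ≤ (inner ℂ u (A' j u)).re := by
      intro j
      by_cases hj : j < gs.length
      · simpa [hA', hj] using hpos _ u
      · simp [hA', hj]
    calc ∑ j ∈ s, (inner ℂ u (A' j u)).re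
        ≤ ∑ j ∈ s ∪ Finset.range gs.length, (inner ℂ u (A' j u)).re :=
          Finset.sum_le_sum_of_subset_of_nonneg Finset.subset_union_left fun j _ _ => h0 j
      _ = ∑ j ∈ Finset.range gs.length, (inner ℂ u (A' j u)).re :=
          (Finset.sum_subset Finset.subset_union_right fun j _ hj => h1 j hj).symm
      _ = (gs.map fun s => (inner ℂ u (A s.1 u)).re).sum := by
          rw [Finset.sum_range, ← Fin.sum_univ_fun_getElem]
          refine Finset.sum_congr rfl fun j _ => ?_
          simp [hA']
      _ = ∑ l, (gs.countP fun s => s.1 = l : ℕ) * (inner ℂ u (A l u)).re :=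
          list_sum_map_fst_eq gs fun l => (inner ℂ u (A l u)).re
      _ ≤ ∑ l, κ * (inner ℂ u (A l u)).re := by
          refine Finset.sum_le_sum fun l _ => ?_
          exact mul_le_mul_of_nonneg_right (hc.1 l) (hpos l u)
      _ ≤ κ * S * ‖u‖ ^ 2 := by
          rw [← Finset.mul_sum, mul_assoc]
          exact mul_le_mul_of_nonneg_left (hS u) hκ
  · intro j
    by_cases hj : j < gs.length
    · have := hc.2 gs[j] (List.getElem_mem hj)
      simp only [hw, hj, dif_pos, norm_neg, norm_mul, Complex.norm_I, one_mul, Complex.norm_real,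
        Real.norm_eq_abs]
      gcongr
    · simp [hw, hj]
      positivity
  · intro j
    by_cases hj : j < gs.length
    · rw [List.take_succ_eq_append_getElem hj, gateProd_append, gateProd_singleton]
      simp [hA', hw, hj, mul_apply_eq_comp]
    · rw [List.take_of_length_le (by omega), List.take_of_length_le (by omega)]
      simp [hA', hw, hj]

/-- A shift of the generators by `η` changes a product of exponentials by a scalar factor only. -/
theorem norm_gateProd_le_of_add_smul_one {A : Fin L → E →L[ℂ] E} {κ η : ℝ}
    (hη : 0 ≤ η) {c : List (Fin L × ℝ)} (hc : ∀ s ∈ c, |s.2| ≤ κ) (z : ℂ) :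
    ‖gateProd A c z‖ ≤ Real.exp (κ * ‖z‖ * η * c.length) *
      ‖gateProd (fun l => A l + (η : ℂ) • (1 : E →L[ℂ] E)) c z‖ := by
  let _ : NormedAlgebra ℚ (E →L[ℂ] E) := NormedAlgebra.restrictScalars ℚ ℂ _
  have key : ∃ θ : ℂ, gateProd A c z = θ • gateProd (fun l => A l + (η : ℂ) • (1 : E →L[ℂ] E)) c z ∧
      ‖θ‖ ≤ Real.exp (κ * ‖z‖ * η * c.length) := by
    induction c with
    | nil => exact ⟨1, by simp, by simp⟩
    | cons s c ih =>
      obtain ⟨θ, h1, h2⟩ := ih fun s hs => hc s (List.mem_cons_of_mem _ hs)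
      obtain ⟨w, hw⟩ : ∃ w : ℂ, w = -(Complex.I * (s.2 : ℂ) * z) := ⟨_, rfl⟩
      have hexp1 : NormedSpace.exp (-(w * η) • (1 : E →L[ℂ] E)) = Complex.exp (-(w * η)) • 1 := by
        rw [← Algebra.algebraMap_eq_smul_one, ← NormedSpace.algebraMap_exp_comm,
          Complex.exp_eq_exp_ℂ, Algebra.algebraMap_eq_smul_one]
      have h3 : NormedSpace.exp (w • A s.1) = Complex.exp (-(w * η)) •
          NormedSpace.exp (w • (A s.1 + (η : ℂ) • (1 : E →L[ℂ] E))) := by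
        have h4 : w • A s.1 = w • (A s.1 + (η : ℂ) • (1 : E →L[ℂ] E)) +
            (-(w * η)) • (1 : E →L[ℂ] E) := by
          rw [smul_add, smul_smul, neg_smul]; abel
        have h5 : Commute (w • (A s.1 + (η : ℂ) • (1 : E →L[ℂ] E)))
            ((-(w * η)) • (1 : E →L[ℂ] E)) := (Commute.one_right _).smul_right _
        rw [h4, NormedSpace.exp_add_of_commute h5, hexp1, mul_smul_comm, mul_one]
      refine ⟨θ * Complex.exp (-(w * η)), ?_, ?_⟩
      · rw [gateProd_cons, gateProd_cons, h1, ← hw, h3, smul_mul_assoc, mul_smul_comm, smul_smul]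
      · rw [norm_mul, List.length_cons, Nat.cast_succ, mul_add, Real.exp_add, mul_one]
        gcongr
        rw [Complex.norm_exp]
        refine Real.exp_le_exp.2 ((Complex.re_le_norm _).trans ?_)
        rw [hw]
        simp only [neg_mul, neg_neg, norm_mul, Complex.norm_I, one_mul, Complex.norm_real,
          Real.norm_eq_abs, abs_of_nonneg hη]
        gcongr
        exact hc s List.mem_cons_self
  obtain ⟨θ, h1, h2⟩ := key
  rw [h1, norm_smul]
  gcongr

end

/-! ### Band parts relative to blocks of energy levels -/

section
variable {E : Type*} [NormedAddCommGroup E] [InnerProductSpace ℂ E]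
variable {ι : Type*} [Fintype ι] (b : OrthonormalBasis ι ℂ E) (β : ι → ℕ) (n : ℕ)

/-- The projection onto the `a`-th block of energy levels. The levels are the vectors of the
orthonormal basis `b`, and `β` assigns to each of them the number of its block. -/
noncomputable def blockProj (a : ℕ) : E →L[ℂ] E := specProj b fun i => β i = a

/-- The block-tridiagonal part of `A` within the blocks `0, …, n`. -/
noncomputable def bandPart (A : E →L[ℂ] E) : E →L[ℂ] E :=
  ∑ x ∈ Finset.range (n + 1), ∑ y ∈ Finset.range (n + 1),
    if x ≤ y + 1 ∧ y ≤ x + 1 then blockProj b β x * A * blockProj b β y else 0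

theorem norm_specProj_mul_mul_specProj_le (p q : ι → Prop) (A : E →L[ℂ] E) :
    ‖specProj b p * A * specProj b q‖ ≤ ‖A‖ := by
  calc _ ≤ ‖specProj b p‖ * ‖A‖ * ‖specProj b q‖ :=
        (norm_mul_le _ _).trans (by gcongr; exact norm_mul_le _ _)
    _ ≤ 1 * ‖A‖ * 1 := by gcongr <;> exact norm_specProj_le b _
    _ = ‖A‖ := by ring

theorem norm_specProj_mul_le (p : ι → Prop) (A : E →L[ℂ] E) :
    ‖specProj b p * A‖ ≤ ‖A‖ := by
  calc _ ≤ ‖specProj b p‖ * ‖A‖ := norm_mul_le _ _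
    _ ≤ 1 * ‖A‖ := by gcongr; exact norm_specProj_le b _
    _ = ‖A‖ := by ring

theorem specProj_mul_of_imp {p q : ι → Prop} (h : ∀ i, p i → q i) :
    specProj b p * specProj b q = specProj b p := by
  rw [specProj_mul]
  congr 1
  ext i
  exact ⟨fun hi => hi.1, fun hi => ⟨hi, h i hi⟩⟩

theorem specProj_mul_of_imp' {p q : ι → Prop} (h : ∀ i, p i → q i) :
    specProj b q * specProj b p = specProj b p := by
  rw [specProj_mul]
  congr 1
  ext i
  exact ⟨fun hi => hi.2, fun hi => ⟨h i hi, hi⟩⟩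

theorem blockProj_mul_self (a : ℕ) : blockProj b β a * blockProj b β a = blockProj b β a :=
  specProj_mul_of_imp b fun _ h => h

theorem blockProj_mul_of_ne {a a' : ℕ} (h : a ≠ a') : blockProj b β a * blockProj b β a' = 0 := by
  rw [blockProj, blockProj, specProj_mul]
  exact specProj_false b fun i hi => h (hi.1.symm.trans hi.2)

theorem sum_blockProj (s : Finset ℕ) :
    ∑ a ∈ s, blockProj b β a = specProj b fun i => β i ∈ s := by
  classical
  simp only [blockProj, specProj, diagOp_sum]
  congr 1
  ext i
  simp only [Finset.sum_apply]
  by_cases h : β i ∈ s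
  · refine (Finset.sum_eq_single_of_mem (β i) h ?_).trans (by simp [h])
    intro a _ ha
    exact if_neg ha.symm
  · rw [if_neg h]
    refine Finset.sum_eq_zero fun a ha => if_neg ?_
    rintro rfl
    exact h ha

theorem sum_bandPart {L : ℕ} (A : Fin L → E →L[ℂ] E) :
    ∑ l, bandPart b β n (A l) = bandPart b β n (∑ l, A l) := by
  simp only [bandPart]
  rw [Finset.sum_comm]
  refine Finset.sum_congr rfl fun x _ => ?_
  rw [Finset.sum_comm]
  refine Finset.sum_congr rfl fun y _ => ?_
  split_ifs
  · rw [Finset.mul_sum, Finset.sum_mul]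
  · simp

theorem isSelfAdjoint_bandPart [CompleteSpace E] {A : E →L[ℂ] E} (hA : IsSelfAdjoint A) :
    IsSelfAdjoint (bandPart b β n A) := by
  rw [isSelfAdjoint_iff, bandPart, star_sum, Finset.sum_comm]
  refine Finset.sum_congr rfl fun x _ => ?_
  rw [star_sum]
  refine Finset.sum_congr rfl fun y _ => ?_
  rw [apply_ite star, star_mul, star_mul, hA.star_eq, blockProj, blockProj,
    (isSelfAdjoint_specProj b _).star_eq, (isSelfAdjoint_specProj b _).star_eq, star_zero,
    mul_assoc]
  simp only [and_comm]

theorem specProj_mul_bandPart (A : E →L[ℂ] E) :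
    specProj b (fun i => β i ≤ n) * bandPart b β n A = bandPart b β n A := by
  rw [bandPart, Finset.mul_sum]
  refine Finset.sum_congr rfl fun x hx => ?_
  rw [Finset.mul_sum]
  refine Finset.sum_congr rfl fun y _ => ?_
  have hx' : x < n + 1 := Finset.mem_range.1 hx
  rw [mul_ite, mul_zero, ← mul_assoc, ← mul_assoc, blockProj,
    specProj_mul_of_imp' b (p := fun i => β i = x) fun i hi => by omega]

theorem bandPart_mul_blockProj (A : E →L[ℂ] E) {y : ℕ} (hy : y ≤ n) :
    bandPart b β n A * blockProj b β y =
      specProj b (fun i => β i ≤ n ∧ β i ≤ y + 1 ∧ y ≤ β i + 1) * A * blockProj b β y := by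
  have h1 : ∀ x, (∑ y' ∈ Finset.range (n + 1), if x ≤ y' + 1 ∧ y' ≤ x + 1 then
      blockProj b β x * A * blockProj b β y' else 0) * blockProj b β y =
      (if x ≤ y + 1 ∧ y ≤ x + 1 then blockProj b β x else 0) * A * blockProj b β y := by
    intro x
    rw [Finset.sum_mul, Finset.sum_eq_single y]
    · split_ifs
      · rw [mul_assoc, blockProj_mul_self]
      · simp
    · intro y' _ hne
      rw [ite_mul, mul_assoc, blockProj_mul_of_ne b β hne]
      simp
    · intro h
      exact absurd (Finset.mem_range.2 (by omega)) h
  rw [bandPart, Finset.sum_mul, Finset.sum_congr rfl fun x _ => h1 x, ← Finset.sum_mul,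
    ← Finset.sum_mul, ← Finset.sum_filter, sum_blockProj]
  congr 3
  ext i
  simp

theorem bandPart_mul_specProj (A : E →L[ℂ] E) :
    bandPart b β n A * specProj b (fun i => β i ≤ n) = bandPart b β n A := by
  rw [bandPart, Finset.sum_mul]
  refine Finset.sum_congr rfl fun x _ => ?_
  rw [Finset.sum_mul]
  refine Finset.sum_congr rfl fun y hy => ?_
  have hy' : y < n + 1 := Finset.mem_range.1 hy
  rw [ite_mul, zero_mul, mul_assoc, blockProj, blockProj,
    specProj_mul_of_imp b (p := fun i => β i = y) fun i hi => by omega]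

open Classical in
theorem bandPart_diagOp (f : ι → ℂ) :
    bandPart b β n (diagOp b f) = diagOp b fun i => if β i ≤ n then f i else 0 := by
  have h : ∀ x y, (if x ≤ y + 1 ∧ y ≤ x + 1 then
      blockProj b β x * diagOp b f * blockProj b β y else 0) =
      diagOp b fun i => if β i = x then (if y = x then f i else 0) else 0 := by
    intro x y
    rw [blockProj, blockProj, specProj, specProj, diagOp_mul, diagOp_mul, ← diagOp_zero b,
      ← apply_ite (diagOp b)]
    congr 1
    ext i
    by_cases h1 : β i = x
    · by_cases h2 : y = x
      · subst h2; simp [h1]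
      · have : ¬ β i = y := fun h3 => h2 (h3.symm.trans h1)
        split_ifs <;> simp_all
    · split_ifs <;> simp [h1]
  simp only [bandPart, h, diagOp_sum]
  congr 1
  ext i
  simp only [Finset.sum_apply]
  by_cases h1 : β i ≤ n
  · rw [Finset.sum_eq_single (β i)]
    · simp [h1]
    · intro x _ hx
      simp [hx.symm]
    · intro h2
      exact absurd (Finset.mem_range.2 (by omega)) h2
  · rw [if_neg h1]
    refine Finset.sum_eq_zero fun x hx => ?_
    have : ¬ β i = x := by have := Finset.mem_range.1 hx; omega
    simp [this]

variable {A : E →L[ℂ] E} {c : ℂ} {τ M : ℝ}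

theorem norm_sub_bandPart_mul_blockProj_le
    (hup : ∀ y, ‖specProj b (fun i => y + 1 < β i) * A * blockProj b β y‖ ≤ τ)
    (hdown : ∀ y, ‖specProj b (fun i => β i + 1 < y) * A * blockProj b β y‖ ≤ τ)
    {y : ℕ} (hy : y < n) :
    ‖(A - bandPart b β n A) * blockProj b β y‖ ≤ 2 * τ := by
  have h : (A - bandPart b β n A) * blockProj b β y =
      specProj b (fun i => y + 1 < β i) * A * blockProj b β y +
        specProj b (fun i => β i + 1 < y) * A * blockProj b β y := by
    rw [sub_mul, bandPart_mul_blockProj b β n A hy.le, ← add_mul, ← add_mul,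
      specProj_add b fun i hi => by omega, mul_assoc _ A, ← one_sub_mul, one_sub_specProj,
      mul_assoc]
    congr 2
    ext i
    omega
  rw [h, two_mul]
  exact (norm_add_le _ _).trans (add_le_add (hup y) (hdown y))

/-- On the top block the truncation removes a part of `A` that need not be small, but which is off
the diagonal, so that a multiple of the identity in `A` does not contribute to it. -/
theorem norm_sub_bandPart_mul_blockProj_le_of_top (hM : ‖A - c • (1 : E →L[ℂ] E)‖ ≤ M) :
    ‖(A - bandPart b β n A) * blockProj b β n‖ ≤ M := by
  have h : (A - bandPart b β n A) * blockProj b β n =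
      specProj b (fun i => ¬ (β i ≤ n ∧ β i ≤ n + 1 ∧ n ≤ β i + 1)) *
        (A - c • (1 : E →L[ℂ] E)) * blockProj b β n := by
    have h0 : specProj b (fun i => ¬ (β i ≤ n ∧ β i ≤ n + 1 ∧ n ≤ β i + 1)) *
        blockProj b β n = 0 := by
      rw [blockProj, specProj_mul]
      exact specProj_false b fun i hi => by omega
    conv_rhs =>
      rw [mul_sub, sub_mul, mul_smul_comm, mul_one, smul_mul_assoc, h0, smul_zero, sub_zero]
    rw [sub_mul, bandPart_mul_blockProj b β n A le_rfl, mul_assoc _ A, ← one_sub_mul,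
      one_sub_specProj, mul_assoc]
  rw [h]
  exact (norm_specProj_mul_mul_specProj_le b _ _ _).trans hM

/-- On the blocks `0, …, n`, the operator `A` differs from its band part by little, except on the
top block `n`. -/
theorem norm_sub_bandPart_mul_le
    (hup : ∀ y, ‖specProj b (fun i => y + 1 < β i) * A * blockProj b β y‖ ≤ τ)
    (hdown : ∀ y, ‖specProj b (fun i => β i + 1 < y) * A * blockProj b β y‖ ≤ τ)
    (hM : ‖A - c • (1 : E →L[ℂ] E)‖ ≤ M)
    {X : E →L[ℂ] E} (hX : specProj b (fun i => β i ≤ n) * X = X) :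
    ‖(A - bandPart b β n A) * X‖ ≤ 2 * n * τ * ‖X‖ + M * ‖blockProj b β n * X‖ := by
  have hX' : X = ∑ y ∈ Finset.range n, blockProj b β y * X + blockProj b β n * X := by
    rw [← Finset.sum_range_succ (fun y => blockProj b β y * X), ← Finset.sum_mul, sum_blockProj]
    conv_lhs => rw [← hX]
    simp
  have h : (A - bandPart b β n A) * X =
      ∑ y ∈ Finset.range n, ((A - bandPart b β n A) * blockProj b β y) * X +
        ((A - bandPart b β n A) * blockProj b β n) * (blockProj b β n * X) := by
    have h1 : ((A - bandPart b β n A) * blockProj b β n) * (blockProj b β n * X) =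
        (A - bandPart b β n A) * (blockProj b β n * X) := by
      rw [mul_assoc, ← mul_assoc (blockProj b β n) (blockProj b β n) X, blockProj_mul_self]
    simp only [h1, mul_assoc _ _ X]
    rw [← Finset.mul_sum, ← mul_add, ← hX']
  rw [h]
  refine (norm_add_le _ _).trans (add_le_add ?_ ?_)
  · refine (norm_sum_le _ _).trans ?_
    calc _ ≤ ∑ y ∈ Finset.range n, 2 * τ * ‖X‖ := by
          refine Finset.sum_le_sum fun y hy => (norm_mul_le _ _).trans ?_
          gcongr
          exact norm_sub_bandPart_mul_blockProj_le b β n hup hdown (Finset.mem_range.1 hy)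
      _ = 2 * n * τ * ‖X‖ := by simp; ring
  · refine (norm_mul_le _ _).trans ?_
    gcongr
    exact norm_sub_bandPart_mul_blockProj_le_of_top b β n hM

/-- The band part nearly equals the compression of `A` to the blocks `0, …, n`, which inherits the
positivity of `A`. -/
theorem norm_compression_sub_bandPart_le
    (hup : ∀ y, ‖specProj b (fun i => y + 1 < β i) * A * blockProj b β y‖ ≤ τ)
    (hdown : ∀ y, ‖specProj b (fun i => β i + 1 < y) * A * blockProj b β y‖ ≤ τ) :
    ‖specProj b (fun i => β i ≤ n) * A * specProj b (fun i => β i ≤ n) - bandPart b β n A‖ ≤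
      2 * (n + 1) * τ := by
  have h : specProj b (fun i => β i ≤ n) * A * specProj b (fun i => β i ≤ n) - bandPart b β n A =
      ∑ y ∈ Finset.range (n + 1), specProj b (fun i => β i ≤ n) *
        (specProj b (fun i => y + 1 < β i) * A * blockProj b β y +
          specProj b (fun i => β i + 1 < y) * A * blockProj b β y) := by
    have h1 : specProj b (fun i => β i ≤ n) = ∑ y ∈ Finset.range (n + 1), blockProj b β y := by
      rw [sum_blockProj]; simp
    rw [← bandPart_mul_specProj]
    conv_lhs =>
      rw [← sub_mul]
      arg 2
      rw [h1]
    rw [Finset.mul_sum]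
    refine Finset.sum_congr rfl fun y hy => ?_
    have hy' : y ≤ n := by have := Finset.mem_range.1 hy; omega
    rw [sub_mul, bandPart_mul_blockProj b β n A hy', ← add_mul, ← add_mul,
      specProj_add b fun i hi => by omega, ← mul_assoc, ← mul_assoc, specProj_mul,
      sub_eq_iff_eq_add, ← add_mul, ← add_mul, specProj_add b fun i hi => by omega]
    congr 3
    ext i
    omega
  rw [h]
  refine (norm_sum_le _ _).trans ?_
  calc _ ≤ ∑ y ∈ Finset.range (n + 1), 2 * τ := by
        refine Finset.sum_le_sum fun y _ => (norm_specProj_mul_le b _ _).trans ?_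
        rw [two_mul]
        exact (norm_add_le _ _).trans (add_le_add (hup y) (hdown y))
    _ = 2 * (n + 1) * τ := by simp; ring

variable {L : ℕ}

/-- Each application of a band operator raises the block index by at most one. Conjugation with the
weight `z ^ β` turns `z K` into a polynomial in `z`, so that the matrix elements of a product of
exponentials of `z K_l` between the blocks `0` and `n` are of order `z ^ n`. -/
theorem exists_norm_blockProj_gateProd_bandPart_le [CompleteSpace E] (A : Fin L → E →L[ℂ] E)
    (gs : List (Fin L × ℝ)) :
    ∃ C : ℝ, ∀ z : ℂ, z ≠ 0 → ‖z‖ ≤ 1 →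
      ‖blockProj b β n * gateProd (fun l => bandPart b β n (A l)) gs z * blockProj b β 0‖ ≤
        C * ‖z‖ ^ n := by
  let _ : NormedAlgebra ℚ (E →L[ℂ] E) := NormedAlgebra.restrictScalars ℚ ℂ _
  set T : ℂ → E →L[ℂ] E := fun z => diagOp b fun i => z ^ β i with hT
  set T' : ℂ → E →L[ℂ] E := fun z => diagOp b fun i => (z ^ β i)⁻¹ with hT'
  have hTT : ∀ z, z ≠ 0 → T z * T' z = 1 := by
    intro z hz
    rw [hT, hT', diagOp_mul, ← diagOp_one b]
    congr 1
    ext i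
    simp [hz]
  have hTT' : ∀ z, z ≠ 0 → T' z * T z = 1 := by
    intro z hz
    rw [← hTT z hz]
    exact (commute_diagOp b _ _).eq
  have hTQ : ∀ z x, T z * blockProj b β x = z ^ x • blockProj b β x := by
    intro z x
    rw [hT, blockProj, specProj, diagOp_mul, diagOp_smul]
    congr 1
    ext i
    by_cases h : β i = x <;> simp [h]
  have hQT : ∀ z x, blockProj b β x * T z = z ^ x • blockProj b β x := by
    intro z x
    rw [← hTQ]
    exact (commute_diagOp b _ _).eq
  have hTQ' : ∀ z x, T' z * blockProj b β x = (z ^ x)⁻¹ • blockProj b β x := by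
    intro z x
    rw [hT', blockProj, specProj, diagOp_mul, diagOp_smul]
    congr 1
    ext i
    by_cases h : β i = x <;> simp [h]
  have hconj : ∀ (l : Fin L) z, z ≠ 0 → ‖z‖ ≤ 1 →
      ‖z • (T' z * bandPart b β n (A l) * T z)‖ ≤ ((n + 1) * ((n + 1) * ‖A l‖)) := by
    intro l z hz hz1
    rw [bandPart, Finset.mul_sum, Finset.sum_mul, Finset.smul_sum]
    refine (norm_sum_le _ _).trans ?_
    calc _ ≤ ∑ x ∈ Finset.range (n + 1), ((n + 1) * ‖A l‖) := ?_
      _ = _ := by simp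
    refine Finset.sum_le_sum fun x _ => ?_
    rw [Finset.mul_sum, Finset.sum_mul, Finset.smul_sum]
    refine (norm_sum_le _ _).trans ?_
    calc _ ≤ ∑ y ∈ Finset.range (n + 1), ‖A l‖ := ?_
      _ = _ := by simp
    refine Finset.sum_le_sum fun y _ => ?_
    split_ifs with hxy
    · have h1 : z • (T' z * (blockProj b β x * A l * blockProj b β y) * T z) =
          (z ^ (y + 1 - x)) • (blockProj b β x * A l * blockProj b β y) := by
        rw [← mul_assoc, ← mul_assoc, hTQ', mul_assoc _ (blockProj b β y), hQT, smul_mul_assoc,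
          smul_mul_assoc, mul_smul_comm, smul_smul, smul_smul]
        congr 1
        rw [pow_sub₀ z hz hxy.1]
        ring
      rw [h1, norm_smul, norm_pow]
      calc _ ≤ 1 * ‖A l‖ := by
            gcongr
            · exact pow_le_one₀ (norm_nonneg _) hz1
            · exact norm_specProj_mul_mul_specProj_le b _ _ _
        _ = _ := one_mul _
    · simp
  have key : ∃ C : ℝ, ∀ z : ℂ, z ≠ 0 → ‖z‖ ≤ 1 →
      ‖T' z * gateProd (fun l => bandPart b β n (A l)) gs z * T z‖ ≤ C := by
    induction gs with
    | nil =>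
      refine ⟨1, fun z hz _ => ?_⟩
      rw [gateProd_nil, mul_one, hTT' z hz]
      exact norm_one_le
    | cons s c ih =>
      obtain ⟨C, hC⟩ := ih
      refine ⟨C * Real.exp (|s.2| * ((n + 1) * ((n + 1) * ‖A s.1‖))), fun z hz hz1 => ?_⟩
      set X := gateProd (fun l => bandPart b β n (A l)) c z
      set Y := NormedSpace.exp ((-(Complex.I * (s.2 : ℂ) * z)) • bandPart b β n (A s.1)) with hY
      have h1 : T' z * (X * Y) * T z = (T' z * X * T z) * (T' z * Y * T z) := by
        calc T' z * (X * Y) * T z = T' z * X * 1 * Y * T z := by simp only [mul_assoc, one_mul]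
          _ = _ := by rw [← hTT z hz]; simp only [mul_assoc]
      have h2 : T' z * Y * T z = NormedSpace.exp ((-(Complex.I * (s.2 : ℂ))) •
          (z • (T' z * bandPart b β n (A s.1) * T z))) := by
        have := NormedSpace.exp_units_conj
          (⟨T' z, T z, hTT' z hz, hTT z hz⟩ : (E →L[ℂ] E)ˣ)
          ((-(Complex.I * (s.2 : ℂ) * z)) • bandPart b β n (A s.1))
        simp only [Units.inv_mk, Units.val_mk] at this
        rw [hY, ← this, smul_smul, mul_smul_comm, smul_mul_assoc]
        congr 2
        ring
      rw [gateProd_cons, h1, h2]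
      refine (norm_mul_le _ _).trans ?_
      have hC0 : 0 ≤ C := (norm_nonneg _).trans (hC z hz hz1)
      gcongr
      · exact hC z hz hz1
      · refine (norm_exp_le _).trans (Real.exp_le_exp.2 ?_)
        rw [norm_smul]
        simp only [norm_neg, norm_mul, Complex.norm_I, one_mul, Complex.norm_real,
          Real.norm_eq_abs]
        gcongr
        exact hconj s.1 z hz hz1
  obtain ⟨C, hC⟩ := key
  refine ⟨C, fun z hz hz1 => ?_⟩
  set X := gateProd (fun l => bandPart b β n (A l)) gs z
  have h1 : blockProj b β n * X * blockProj b β 0 =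
      z ^ n • (blockProj b β n * (T' z * X * T z) * blockProj b β 0) := by
    have h2 : T' z * blockProj b β 0 = blockProj b β 0 := by simpa using hTQ' z 0
    calc blockProj b β n * X * blockProj b β 0
        = blockProj b β n * (T z * T' z) * X * (T z * (T' z * blockProj b β 0)) := by
          rw [hTT z hz, mul_one, ← mul_assoc (T z), hTT z hz, one_mul]
      _ = (blockProj b β n * T z) * (T' z * X * T z) * blockProj b β 0 := by
          rw [h2]; simp only [mul_assoc]
      _ = _ := by rw [hQT, smul_mul_assoc, smul_mul_assoc]
  rw [h1, norm_smul, norm_pow, mul_comm]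
  gcongr
  exact (norm_specProj_mul_mul_specProj_le b _ _ _).trans (hC z hz hz1)

end

/-! ### The error of one step -/

section
variable {E : Type*} [NormedAddCommGroup E] [InnerProductSpace ℂ E] [CompleteSpace E] {L : ℕ}

theorem commute_gateProd {A : Fin L → E →L[ℂ] E} {Z : E →L[ℂ] E} (h : ∀ l, Commute Z (A l))
    (gs : List (Fin L × ℝ)) (z : ℂ) : Commute Z (gateProd A gs z) := by
  induction gs with
  | nil => exact Commute.one_right Z
  | cons s c ih =>
    rw [gateProd_cons]
    exact ih.mul_right ((h s.1).smul_right _).exp_right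

theorem isPositive_smul_one_add_of_norm_sub_le {A B : E →L[ℂ] E} {η : ℝ}
    (hA : A.IsPositive) (hB : IsSelfAdjoint B) (h : ‖A - B‖ ≤ η) :
    (B + (η : ℂ) • (1 : E →L[ℂ] E)).IsPositive := by
  have hsa : IsSelfAdjoint (B + (η : ℂ) • (1 : E →L[ℂ] E)) := by
    rw [add_comm]; exact isSelfAdjoint_smul_one_add hB
  refine ⟨hsa.isSymmetric, fun v => ?_⟩
  have h1 : (B + (η : ℂ) • (1 : E →L[ℂ] E)) v = A v - (A - B) v + (η : ℂ) • v := by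
    simp
  have h2 : ‖(A - B) v‖ * ‖v‖ ≤ η * ‖v‖ ^ 2 := by
    rw [pow_two, ← mul_assoc]
    gcongr
    exact ContinuousLinearMap.le_of_opNorm_le _ h v
  have h3 : (inner ℂ ((A - B) v) v).re ≤ ‖(A - B) v‖ * ‖v‖ :=
    (Complex.re_le_norm _).trans (norm_inner_le_norm _ _)
  have h4 : 0 ≤ (inner ℂ (A v) v).re := hA.2 v
  have h5 : inner ℂ v v = ((‖v‖ ^ 2 : ℝ) : ℂ) := by
    rw [inner_self_eq_norm_sq_to_K]; norm_cast
  rw [ContinuousLinearMap.reApplyInnerSelf_apply, h1, inner_add_left, inner_sub_left,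
    inner_smul_left, h5]
  simp only [Complex.conj_ofReal, map_add, map_sub, RCLike.re_to_complex, ← Complex.ofReal_mul,
    Complex.ofReal_re]
  linarith

theorem ProductFormula.BoundedBy.of_append {gs gs' : List (Fin L × ℝ)} {κ : ℝ}
    (h : (ProductFormula.mk (gs ++ gs')).BoundedBy κ) : (ProductFormula.mk gs).BoundedBy κ := by
  refine ⟨fun l => le_trans ?_ (h.1 l), fun s hs => h.2 s (List.mem_append_left _ hs)⟩
  simp only [List.countP_append]
  push_cast
  have : (0 : ℝ) ≤ ((gs'.countP fun s => s.1 = l : ℕ) : ℝ) := Nat.cast_nonneg _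
  linarith

/-- Interpolation within the last gate, as needed for Duhamel's formula. -/
theorem ProductFormula.BoundedBy.scale_last {gs : List (Fin L × ℝ)} {s : Fin L × ℝ} {κ σ : ℝ}
    (hσ : σ ∈ Set.Icc (0 : ℝ) 1) (h : (ProductFormula.mk (gs ++ [s])).BoundedBy κ) :
    (ProductFormula.mk (gs ++ [(s.1, σ * s.2)])).BoundedBy κ := by
  refine ⟨fun l => le_of_eq_of_le ?_ (h.1 l), fun s' hs' => ?_⟩
  · simp only [List.countP_append, List.countP_singleton]
  · rcases List.mem_append.1 hs' with h1 | h1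
    · exact h.2 s' (List.mem_append_left _ h1)
    · rw [List.mem_singleton.1 h1]
      have h2 := h.2 s (List.mem_append_right _ (List.mem_singleton_self s))
      calc |σ * s.2| = σ * |s.2| := by rw [abs_mul, abs_of_nonneg hσ.1]
        _ ≤ 1 * |s.2| := by gcongr; exact hσ.2
        _ ≤ κ := by rwa [one_mul]

variable {ι : Type*} [Fintype ι] (b : OrthonormalBasis ι ℂ E)
  {μ : ι → ℝ} {β : ι → ℕ} {n : ℕ} {H : Fin L → E →L[ℂ] E} {c : Fin L → ℂ} {τ M Δ κ R : ℝ} {k : ℕ}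

/-- The product formula of the band parts is bounded on a complex disc whose inverse radius is of
the order of the energy cutoff `Δ`, times `k ≥ log₂ q`. The band parts are positive only up to a
shift by `2 (n + 1) τ`, which costs a constant factor. -/
theorem norm_gateProd_bandPart_le (hμ : ∀ i, 0 ≤ μ i) (hΔ : ∀ i, β i ≤ n → μ i ≤ Δ)
    (hΔ0 : 0 ≤ Δ) (hτ0 : 0 ≤ τ)
    (hpos : ∀ l, (H l).IsPositive) (hsum : ∑ l, H l = diagOp b fun i => (μ i : ℂ))
    (hup : ∀ l y, ‖specProj b (fun i => y + 1 < β i) * H l * blockProj b β y‖ ≤ τ)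
    (hdown : ∀ l y, ‖specProj b (fun i => β i + 1 < y) * H l * blockProj b β y‖ ≤ τ)
    (hκ : 1 ≤ κ) (hR : 4 * κ ^ 2 * (k + 1) * (Δ + L * (2 * (n + 1) * τ)) * R ≤ 1)
    {gs : List (Fin L × ℝ)} (hgs : (ProductFormula.mk gs).BoundedBy κ) (hlen : gs.length ≤ 2 ^ k)
    {z : ℂ} (hz : ‖z‖ ≤ R) :
    ‖gateProd (fun l => bandPart b β n (H l)) gs z‖ ≤ 4 := by
  set η := 2 * (n + 1) * τ with hη
  have hη0 : 0 ≤ η := by positivity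
  have hR0 : 0 ≤ R := (norm_nonneg z).trans hz
  have hk : (0 : ℝ) ≤ k := Nat.cast_nonneg k
  have hposK : ∀ l, (bandPart b β n (H l) + (η : ℂ) • (1 : E →L[ℂ] E)).IsPositive := by
    intro l
    refine isPositive_smul_one_add_of_norm_sub_le ?_
      (isSelfAdjoint_bandPart b β n (hpos l).isSelfAdjoint)
      (norm_compression_sub_bandPart_le b β n (hup l) (hdown l))
    have := (hpos l).conj_adjoint (specProj b fun i => β i ≤ n)
    rwa [(isSelfAdjoint_specProj b _).adjoint_eq] at this
  have hS : ∀ v, ∑ l, (inner ℂ v ((bandPart b β n (H l) + (η : ℂ) • (1 : E →L[ℂ] E)) v)).re ≤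
      (Δ + L * η) * ‖v‖ ^ 2 := by
    intro v
    have h1 : ∑ l, inner ℂ v ((bandPart b β n (H l) + (η : ℂ) • (1 : E →L[ℂ] E)) v) =
        inner ℂ v (bandPart b β n (∑ l, H l) v) + ((L * η * ‖v‖ ^ 2 : ℝ) : ℂ) := by
      rw [← sum_bandPart, sum_apply, inner_sum]
      simp only [_root_.add_apply, smul_apply, one_apply_eq_self,
        inner_add_right, inner_smul_right, Finset.sum_add_distrib, inner_self_eq_norm_sq_to_K]
      simp
      ring
    have h2 : ‖bandPart b β n (∑ l, H l)‖ ≤ Δ := by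
      rw [hsum, bandPart_diagOp]
      refine norm_diagOp_le b hΔ0 fun i => ?_
      split_ifs with h
      · rw [Complex.norm_real, Real.norm_of_nonneg (hμ i)]
        exact hΔ i h
      · simpa using hΔ0
    rw [← Complex.re_sum, h1, Complex.add_re, Complex.ofReal_re, add_mul]
    gcongr
    calc _ ≤ ‖v‖ * ‖bandPart b β n (∑ l, H l) v‖ :=
          (Complex.re_le_norm _).trans (norm_inner_le_norm _ _)
      _ ≤ ‖v‖ * (Δ * ‖v‖) := by
          gcongr
          exact ContinuousLinearMap.le_of_opNorm_le _ h2 v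
      _ = Δ * ‖v‖ ^ 2 := by ring
  have h1 := norm_gateProd_le_two (by positivity) (by positivity) hposK hS hgs hlen hR hz
  have h2 := norm_gateProd_le_of_add_smul_one (A := fun l => bandPart b β n (H l)) hη0 hgs.2 z
  have h3 : κ * ‖z‖ * η * gs.length ≤ 1 / 4 := by
    have h4 := hgs.length_le
    calc κ * ‖z‖ * η * gs.length ≤ κ * R * η * (κ * L) := by gcongr
      _ = κ ^ 2 * (L * η) * R := by ring
      _ ≤ κ ^ 2 * ((k + 1) * (Δ + L * η)) * R := by
          have h6 : 0 ≤ L * η := by positivity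
          have h7 : L * η ≤ (k + 1) * (Δ + L * η) := by nlinarith
          exact mul_le_mul_of_nonneg_right (mul_le_mul_of_nonneg_left h7 (sq_nonneg κ)) hR0
      _ ≤ 1 / 4 := by linarith
  have h5 : Real.exp (κ * ‖z‖ * η * gs.length) ≤ 2 := by
    refine (Real.exp_le_exp.2 h3).trans ?_
    have := Real.exp_bound' (x := 1 / 4) (by norm_num) (by norm_num) (n := 1) (by norm_num)
    norm_num at this
    linarith
  calc _ ≤ _ := h2
    _ ≤ 2 * 2 := by gcongr
    _ = 4 := by norm_num

/-- The weight that a product formula of band operators moves from block `0` to block `n`. -/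
theorem norm_blockProj_gateProd_bandPart_le (hR0 : 0 < R) {gs : List (Fin L × ℝ)}
    (h4 : ∀ z : ℂ, ‖z‖ ≤ R → ‖gateProd (fun l => bandPart b β n (H l)) gs z‖ ≤ 4)
    {δ : ℝ} (hδ : |δ| ≤ R) :
    ‖blockProj b β n * gateProd (fun l => bandPart b β n (H l)) gs δ * blockProj b β 0‖ ≤
      4 * (|δ| / R) ^ n := by
  obtain ⟨C, hC⟩ := exists_norm_blockProj_gateProd_bandPart_le b β n H gs
  have hδ' : ‖(δ : ℂ)‖ ≤ R := by rwa [Complex.norm_real]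
  have h := norm_le_mul_div_pow_of_isBigO hR0 n (C := 4)
    (F := fun z => blockProj b β n * gateProd (fun l => bandPart b β n (H l)) gs z *
      blockProj b β 0)
    (((differentiable_gateProd _ gs).const_mul _).mul_const _)
    (fun z hz => (norm_specProj_mul_mul_specProj_le b _ _ _).trans (h4 z hz)) ?_ δ hδ'
  · simpa [Complex.norm_real] using h
  · refine IsBigO.of_bound C ?_
    have h1 : ∀ᶠ δ : ℝ in 𝓝[≠] 0, |δ| < 1 :=
      nhdsWithin_le_nhds ((continuous_abs.tendsto' (0 : ℝ) 0 abs_zero).eventually_lt_const one_pos)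
    filter_upwards [h1, self_mem_nhdsWithin] with x hx hx0
    have := hC x (by exact_mod_cast hx0) (by rw [Complex.norm_real]; exact hx.le)
    simpa [Complex.norm_real] using this

/-- The product formulas of the parts and of their band parts agree on the block `0`, up to the
off-band blocks and to the weight that reaches the top block. -/
theorem norm_gateProd_sub_bandPart_mul_le (hτ0 : 0 ≤ τ) (hM0 : 0 ≤ M)
    (hsa : ∀ l, IsSelfAdjoint (H l))
    (hup : ∀ l y, ‖specProj b (fun i => y + 1 < β i) * H l * blockProj b β y‖ ≤ τ)
    (hdown : ∀ l y, ‖specProj b (fun i => β i + 1 < y) * H l * blockProj b β y‖ ≤ τ)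
    (hM : ∀ l, ‖H l - c l • (1 : E →L[ℂ] E)‖ ≤ M) (hR0 : 0 < R)
    (h4 : ∀ gs : List (Fin L × ℝ), (ProductFormula.mk gs).BoundedBy κ → gs.length ≤ 2 ^ k →
      ∀ z : ℂ, ‖z‖ ≤ R → ‖gateProd (fun l => bandPart b β n (H l)) gs z‖ ≤ 4)
    {δ : ℝ} (hδ : |δ| ≤ R) (gs : List (Fin L × ℝ)) :
    (ProductFormula.mk gs).BoundedBy κ → gs.length ≤ 2 ^ k →
    ‖(gateProd H gs δ - gateProd (fun l => bandPart b β n (H l)) gs δ) * blockProj b β 0‖ ≤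
      κ * gs.length * |δ| * (2 * n * τ + M * (4 * (|δ| / R) ^ n)) := by
  set K : Fin L → E →L[ℂ] E := fun l => bandPart b β n (H l) with hK
  set B := 2 * n * τ + M * (4 * (|δ| / R) ^ n) with hB
  have hB0 : 0 ≤ B := by positivity
  have hKsa : ∀ l, IsSelfAdjoint (K l) := fun l => isSelfAdjoint_bandPart b β n (hsa l)
  induction gs using List.reverseRecOn with
  | nil => intro _ _; simp
  | append_singleton gs s ih =>
    intro hgs hlen
    have hlen' : gs.length + 1 ≤ 2 ^ k := by simpa using hlen
    have ih' := ih hgs.of_append (by omega)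
    set WH := gateProd H gs δ
    set WK := gateProd K gs δ
    set UH := NormedSpace.exp ((-(Complex.I * (s.2 : ℂ) * δ)) • H s.1) with hUH
    set UK := NormedSpace.exp ((-(Complex.I * (s.2 : ℂ) * δ)) • K s.1) with hUK
    have e1 : ∀ a : ℝ, -(Complex.I * (a : ℂ) * (δ : ℂ)) = -(Complex.I * ((a * δ : ℝ) : ℂ)) := by
      intro a; push_cast; ring
    have hsplit : (UH * WH - UK * WK) * blockProj b β 0 =
        UH * ((WH - WK) * blockProj b β 0) + (UH - UK) * (WK * blockProj b β 0) := by
      noncomm_ring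
    have hU : UH ∈ unitary (E →L[ℂ] E) := by
      rw [hUH, e1]; exact exp_mem_unitary (hsa s.1) _
    have h2 : ‖(UH - UK) * (WK * blockProj b β 0)‖ ≤ |s.2 * δ| * B := by
      rw [hUH, hUK, e1]
      refine norm_exp_sub_exp_mul_le (hsa s.1) _ _ fun σ hσ => ?_
      set X := gateProd K (gs ++ [(s.1, σ * s.2)]) δ * blockProj b β 0 with hX
      have hXe : NormedSpace.exp ((-(Complex.I * ((σ * (s.2 * δ) : ℝ) : ℂ))) • K s.1) *
          (WK * blockProj b β 0) = X := by
        rw [hX, gateProd_append, gateProd_singleton, mul_assoc]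
        congr 3
        push_cast
        ring
      rw [hXe]
      have hb := hgs.scale_last hσ
      have hcomm : Commute (specProj b fun i => β i ≤ n)
          (gateProd K (gs ++ [(s.1, σ * s.2)]) δ) := by
        refine commute_gateProd (fun l => ?_) _ _
        rw [commute_iff_eq, hK, specProj_mul_bandPart, bandPart_mul_specProj]
      have hPX : specProj b (fun i => β i ≤ n) * X = X := by
        rw [hX, ← mul_assoc, hcomm.eq, mul_assoc, blockProj,
          specProj_mul_of_imp' b (p := fun i => β i = 0) fun i hi => by omega]
      have hX1 : ‖X‖ ≤ 1 := by
        rw [hX, CStarRing.norm_mem_unitary_mul _ (gateProd_mem_unitary hKsa _ δ)]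
        exact norm_specProj_le b _
      have hX2 : ‖blockProj b β n * X‖ ≤ 4 * (|δ| / R) ^ n := by
        rw [hX, ← mul_assoc]
        exact norm_blockProj_gateProd_bandPart_le b hR0
          (h4 _ hb (by simpa using hlen)) hδ
      refine (norm_sub_bandPart_mul_le b β n (hup s.1) (hdown s.1) (hM s.1) hPX).trans ?_
      calc _ ≤ 2 * n * τ * 1 + M * (4 * (|δ| / R) ^ n) := by gcongr
        _ = B := by rw [mul_one]
    rw [gateProd_append, gateProd_append, gateProd_singleton, gateProd_singleton, hsplit]
    refine (norm_add_le _ _).trans ?_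
    rw [CStarRing.norm_mem_unitary_mul _ hU]
    have h3 : |s.2 * δ| * B ≤ κ * |δ| * B := by
      rw [abs_mul]
      gcongr
      exact hgs.2 s (List.mem_append_right _ (List.mem_singleton_self s))
    rw [List.length_append, List.length_singleton]
    push_cast
    linarith

/-- The error of a single step on the block `0`. It consists of the cost of replacing the parts by
their band parts, and of the error of the product formula of the band parts, to which the Schwarz
lemma of order `p + 1` applies because the order condition is available for them as well. The exact
evolutions agree on the block `0`, where the sum of the band parts equals the Hamiltonian. -/
theorem norm_step_sub_evolution_mul_le [FiniteDimensional ℂ E] {W : ProductFormula L} {p : ℕ}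
    (hW : W.HasOrder p)
    (hb : W.BoundedBy κ) (hlen : W.length ≤ 2 ^ k)
    (hμ : ∀ i, 0 ≤ μ i) (hΔ : ∀ i, β i ≤ n → μ i ≤ Δ)
    (hΔ0 : 0 ≤ Δ) (hτ0 : 0 ≤ τ) (hM0 : 0 ≤ M)
    (hpos : ∀ l, (H l).IsPositive) (hsum : ∑ l, H l = diagOp b fun i => (μ i : ℂ))
    (hup : ∀ l y, ‖specProj b (fun i => y + 1 < β i) * H l * blockProj b β y‖ ≤ τ)
    (hdown : ∀ l y, ‖specProj b (fun i => β i + 1 < y) * H l * blockProj b β y‖ ≤ τ)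
    (hM : ∀ l, ‖H l - c l • (1 : E →L[ℂ] E)‖ ≤ M)
    (hκ : 1 ≤ κ) (hR0 : 0 < R)
    (hR : 4 * κ ^ 2 * (k + 1) * (Δ + L * (2 * (n + 1) * τ)) * R ≤ 1)
    {δ : ℝ} (hδ : |δ| ≤ R) :
    ‖(gateProd H W.seq δ - evolution (∑ l, H l) δ) * blockProj b β 0‖ ≤
      κ * W.length * |δ| * (2 * n * τ + M * (4 * (|δ| / R) ^ n)) + 6 * (|δ| / R) ^ (p + 1) := by
  classical
  have hk : (0 : ℝ) ≤ k := Nat.cast_nonneg k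
  set K : Fin L → E →L[ℂ] E := fun l => bandPart b β n (H l) with hK
  have h4 : ∀ gs : List (Fin L × ℝ), (ProductFormula.mk gs).BoundedBy κ → gs.length ≤ 2 ^ k →
      ∀ z : ℂ, ‖z‖ ≤ R → ‖gateProd K gs z‖ ≤ 4 := fun gs hgs hlen z hz =>
    norm_gateProd_bandPart_le b hμ hΔ hΔ0 hτ0 hpos hsum hup hdown hκ hR hgs hlen hz
  have h1 := norm_gateProd_sub_bandPart_mul_le b hτ0 hM0 (fun l => (hpos l).isSelfAdjoint) hup
    hdown hM hR0 h4 hδ W.seq hb hlen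
  have hKsum : ∑ l, K l = diagOp b fun i => if β i ≤ n then (μ i : ℂ) else 0 := by
    rw [hK, sum_bandPart, hsum, bandPart_diagOp]
  have hKnorm : ‖∑ l, K l‖ ≤ Δ := by
    rw [hKsum]
    refine norm_diagOp_le b hΔ0 fun i => ?_
    split_ifs with h
    · rw [Complex.norm_real, Real.norm_of_nonneg (hμ i)]
      exact hΔ i h
    · simpa using hΔ0
  have h2 : ‖(gateProd K W.seq δ - evolution (∑ l, K l) δ) * blockProj b β 0‖ ≤
      6 * (|δ| / R) ^ (p + 1) := by
    have hδ' : ‖(δ : ℂ)‖ ≤ R := by rwa [Complex.norm_real]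
    have h := norm_le_mul_div_pow_of_isBigO hR0 (p + 1) (C := 6)
      (F := fun z => (gateProd K W.seq z -
        NormedSpace.exp ((-(Complex.I * z)) • ∑ l, K l)) * blockProj b β 0)
      (((differentiable_gateProd _ _).sub (differentiable_exp_smul _ _)).mul_const _) ?_ ?_ δ hδ'
    · rw [evolution]
      simpa [Complex.norm_real] using h
    · intro z hz
      have h5 : ‖NormedSpace.exp ((-(Complex.I * z)) • ∑ l, K l)‖ ≤ 2 := by
        refine (norm_exp_le _).trans ?_
        have h6 : ‖(-(Complex.I * z)) • ∑ l, K l‖ ≤ 1 / 4 := by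
          rw [norm_smul, norm_neg, norm_mul, Complex.norm_I, one_mul]
          have h7 : 0 ≤ L * (2 * (n + 1) * τ) := by positivity
          have h8 : 1 ≤ κ ^ 2 * (k + 1) := by nlinarith
          calc ‖z‖ * ‖∑ l, K l‖ ≤ R * Δ := by gcongr
            _ ≤ 1 * ((Δ + L * (2 * (n + 1) * τ)) * R) := by nlinarith
            _ ≤ κ ^ 2 * (k + 1) * ((Δ + L * (2 * (n + 1) * τ)) * R) := by gcongr
            _ ≤ 1 / 4 := by linarith
        refine (Real.exp_le_exp.2 h6).trans ?_
        have := Real.exp_bound' (x := 1 / 4) (by norm_num) (by norm_num) (n := 1) (by norm_num)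
        norm_num at this
        linarith
      calc _ ≤ ‖gateProd K W.seq z - NormedSpace.exp ((-(Complex.I * z)) • ∑ l, K l)‖ *
            ‖blockProj b β 0‖ := norm_mul_le _ _
        _ ≤ (4 + 2) * 1 := by
            gcongr
            · exact (norm_sub_le _ _).trans (add_le_add (h4 W.seq hb hlen z hz) h5)
            · exact norm_specProj_le b _
        _ = 6 := by norm_num
    · have h9 := (hW.isBigO fun l =>
        isSelfAdjoint_bandPart b β n (hpos l).isSelfAdjoint).mono
          (nhdsWithin_le_nhds (s := {(0 : ℝ)}ᶜ))
      refine IsBigO.trans (IsBigO.of_bound 1 (Eventually.of_forall fun x => ?_)) h9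
      rw [one_mul]
      refine (norm_mul_le _ _).trans ?_
      exact mul_le_of_le_one_right (norm_nonneg _) (norm_specProj_le b _)
  have h3 : ‖(evolution (∑ l, H l) δ - evolution (∑ l, K l) δ) * blockProj b β 0‖ ≤ |δ| * 0 := by
    refine norm_exp_sub_exp_mul_le ?_ _ _ fun σ _ => ?_
    · rw [hsum]; exact isSelfAdjoint_diagOp_ofReal b μ
    · rw [hsum, hKsum, diagOp_sub, ← mul_assoc,
        (((commute_diagOp b _ _).smul_right _).exp_right : Commute _ _).eq, mul_assoc, blockProj,
        specProj, diagOp_mul]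
      refine le_of_eq (norm_eq_zero.2 ?_)
      convert mul_zero _
      rw [← diagOp_zero b]
      congr 1
      ext i
      by_cases h : β i = 0 <;> simp [h]
  have hsplit : (gateProd H W.seq δ - evolution (∑ l, H l) δ) * blockProj b β 0 =
      (gateProd H W.seq δ - gateProd K W.seq δ) * blockProj b β 0 +
        (gateProd K W.seq δ - evolution (∑ l, K l) δ) * blockProj b β 0 -
        (evolution (∑ l, H l) δ - evolution (∑ l, K l) δ) * blockProj b β 0 := by
    noncomm_ring
  rw [hsplit]
  refine (norm_sub_le _ _).trans ?_
  rw [mul_zero] at h3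
  have := norm_add_le ((gateProd H W.seq δ - gateProd K W.seq δ) * blockProj b β 0)
    ((gateProd K W.seq δ - evolution (∑ l, K l) δ) * blockProj b β 0)
  have h1' : ‖(gateProd H W.seq δ - gateProd K W.seq δ) * blockProj b β 0‖ ≤
      κ * W.length * |δ| * (2 * n * τ + M * (4 * (|δ| / R) ^ n)) := h1
  linarith

end

/-! ### The error of the whole simulation -/

theorem ProductFormula.BoundedBy.mono {L : ℕ} {W : ProductFormula L} {κ κ' : ℝ}
    (h : W.BoundedBy κ) (hκ : κ ≤ κ') : W.BoundedBy κ' :=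
  ⟨fun l => (h.1 l).trans hκ, fun s hs => (h.2 s hs).trans hκ⟩

theorem factorial_succ_le_exp (n : ℕ) :
    ((n + 1).factorial : ℝ) ≤ (n + 1) ^ n * Real.exp n := by
  rw [Nat.factorial_succ]
  push_cast
  have h1 : (n.factorial : ℝ) ≤ (n + 1) ^ n := by
    exact_mod_cast (Nat.factorial_le_pow n).trans (Nat.pow_le_pow_left (Nat.le_succ n) n)
  have h2 := Real.add_one_le_exp (n : ℝ)
  calc ((n : ℝ) + 1) * n.factorial ≤ Real.exp n * (n + 1) ^ n := by gcongr
    _ = _ := mul_comm _ _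

section
variable {E : Type*} [NormedAddCommGroup E] [InnerProductSpace ℂ E]

theorem norm_swap_specProj_mul [CompleteSpace E] {ι : Type*} [Fintype ι]
    (b : OrthonormalBasis ι ℂ E) (p q : ι → Prop) {A : E →L[ℂ] E} (hA : IsSelfAdjoint A) :
    ‖specProj b p * A * specProj b q‖ = ‖specProj b q * A * specProj b p‖ := by
  rw [← norm_star (specProj b q * A * specProj b p), star_mul, star_mul, hA.star_eq,
    (isSelfAdjoint_specProj b p).star_eq, (isSelfAdjoint_specProj b q).star_eq, mul_assoc]

theorem specProj_mul_sub_smul_one_mul {ι : Type*} [Fintype ι] (b : OrthonormalBasis ι ℂ E)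
    {p q : ι → Prop} (hpq : ∀ i, ¬ (p i ∧ q i)) (A : E →L[ℂ] E) (c : ℂ) :
    specProj b p * (A - c • (1 : E →L[ℂ] E)) * specProj b q = specProj b p * A * specProj b q := by
  rw [mul_sub, sub_mul, mul_smul_comm, mul_one, smul_mul_assoc, specProj_mul,
    specProj_false b hpq, smul_zero, sub_zero]

theorem nonneg_of_isPositive_diagOp {ι : Type*} [Fintype ι] {b : OrthonormalBasis ι ℂ E}
    {μ : ι → ℝ} (h : (diagOp b fun i => (μ i : ℂ)).IsPositive) (i : ι) : 0 ≤ μ i := by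
  classical
  have h1 := (Complex.nonneg_iff.1 (h.inner_nonneg_right (b i))).1
  have h2 : diagOp b (fun i => (μ i : ℂ)) (b i) = (μ i : ℂ) • b i := by
    simp [diagOp_apply, b.repr_self]
  rw [h2, inner_smul_right, inner_self_eq_norm_sq_to_K, b.norm_eq_one] at h1
  simpa using h1

theorem isPositive_finset_sum {L : ℕ} {A : Fin L → E →L[ℂ] E} (h : ∀ l, (A l).IsPositive) :
    (∑ l, A l).IsPositive := by
  classical
  induction (Finset.univ : Finset (Fin L)) using Finset.induction_on with
  | empty => simp
  | insert a s ha ih => rw [Finset.sum_insert ha]; exact (h a).add ih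

theorem norm_unitary_sub_mul_le_two [CompleteSpace E] {U V P : E →L[ℂ] E}
    (hU : U ∈ unitary (E →L[ℂ] E)) (hV : V ∈ unitary (E →L[ℂ] E)) (hP : ‖P‖ ≤ 1) :
    ‖(U - V) * P‖ ≤ 2 := by
  rw [sub_mul]
  refine (norm_sub_le _ _).trans ?_
  rw [CStarRing.norm_mem_unitary_mul _ hU, CStarRing.norm_mem_unitary_mul _ hV]
  linarith

theorem exists_eigenbasis [CompleteSpace E] [FiniteDimensional ℂ E] {A : E →L[ℂ] E}
    (hA : IsSelfAdjoint A) :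
    ∃ (m : ℕ) (b : OrthonormalBasis (Fin m) ℂ E) (μ : Fin m → ℝ),
      A = diagOp b fun i => (μ i : ℂ) := by
  have hT : (A : E →ₗ[ℂ] E).IsSymmetric := hA.isSymmetric
  exact ⟨_, hT.eigenvectorBasis rfl, hT.eigenvalues rfl,
    eq_diagOp _ fun i => hT.apply_eigenvectorBasis rfl i⟩

end

namespace PowerLawHamiltonian
variable {D : ℕ} {α : ℝ} {Λ : Finset (Fin D → ℤ)} {L : ℕ} (H : PowerLawHamiltonian D α Λ L)
  {W : ProductFormula L}

theorem lowEnergyError_le_two (Δ t : ℝ) (r : ℕ) : H.lowEnergyError W Δ t r ≤ 2 := by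
  rw [lowEnergyError, toOp_trotter]
  refine norm_unitary_sub_mul_le_two (pow_mem (gateProd_mem_unitary H.isSelfAdjoint_part _ _) r)
    (exp_mem_unitary (isSelfAdjoint_finset_sum H.isSelfAdjoint_part) t) ?_
  exact Submodule.starProjection_norm_le _

theorem lowEnergyError_le_of_step {r : ℕ} (hr : 1 ≤ r) (Δ t : ℝ) :
    H.lowEnergyError W Δ t r ≤ r *
      ‖(gateProd H.part W.seq ((t / r : ℝ) : ℂ) - evolution H.total (t / r)) *
        lowEnergyProj H.total Δ‖ := by
  have hr0 : (r : ℝ) ≠ 0 := by positivity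
  have ht : evolution H.total t = evolution H.total (t / r) ^ r := by
    rw [← evolution_natCast_mul, mul_div_cancel₀ t hr0]
  have hsa : IsSelfAdjoint H.total := isSelfAdjoint_finset_sum H.isSelfAdjoint_part
  rw [lowEnergyError, toOp_trotter, ht]
  refine norm_pow_sub_pow_mul_le (gateProd_mem_unitary H.isSelfAdjoint_part _ _)
    (exp_mem_unitary hsa _) ?_ r
  obtain ⟨m, b, μ, hb⟩ := exists_eigenbasis hsa
  have h1 : lowEnergyProj H.total Δ = specProj b fun i => μ i ≤ Δ := by
    rw [hb]; exact starProjection_iSup_eigenspace b μ Δ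
  rw [h1, hb]
  exact (((commute_diagOp b _ _).smul_right _).exp_right : Commute _ _).symm

/-- If the parts commute with each other, then the product formula is exact. -/
theorem lowEnergyError_eq_zero_of_commute {p : ℕ} (hp : 1 ≤ p) (hW : W.HasOrder p)
    (hc : ∀ l l', Commute (H.part l) (H.part l')) {r : ℕ} (hr : 1 ≤ r) (Δ t : ℝ) :
    H.lowEnergyError W Δ t r = 0 := by
  have h := H.lowEnergyError_le_of_step (W := W) hr Δ t
  rw [hW.gateProd_eq_of_commute hp H.isSelfAdjoint_part hc, ← total, sub_self, zero_mul, norm_zero,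
    mul_zero] at h
  exact le_antisymm h (norm_nonneg _)

theorem term_eq_zero_of_siteStrength_le_zero (hg : ∀ v, H.siteStrength v ≤ 0) (l : Fin L)
    (i j : Λ) : H.term l i j = 0 := by
  have h0 : ∀ l' i' j', 0 ≤ if i' = i ∨ j' = i then ‖H.term l' i' j'‖ else 0 := by
    intro l' i' j'
    split_ifs <;> simp
  have h1 : ‖H.term l i j‖ ≤ H.siteStrength i := by
    calc ‖H.term l i j‖ = if i = i ∨ j = i then ‖H.term l i j‖ else 0 := by simp
      _ ≤ ∑ j', if i = i ∨ j' = i then ‖H.term l i j'‖ else 0 :=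
          Finset.single_le_sum (f := fun j' => if i = i ∨ j' = i then ‖H.term l i j'‖ else 0)
            (fun j' _ => h0 l i j') (Finset.mem_univ j)
      _ ≤ ∑ i', ∑ j', if i' = i ∨ j' = i then ‖H.term l i' j'‖ else 0 :=
          Finset.single_le_sum (f := fun i' => ∑ j', if i' = i ∨ j' = i then
            ‖H.term l i' j'‖ else 0) (fun i' _ => Finset.sum_nonneg fun j' _ => h0 l i' j')
            (Finset.mem_univ i)
      _ ≤ H.siteStrength i :=
          Finset.single_le_sum (f := fun l' => ∑ i', ∑ j', if i' = i ∨ j' = i then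
            ‖H.term l' i' j'‖ else 0) (fun l' _ => Finset.sum_nonneg fun i' _ =>
            Finset.sum_nonneg fun j' _ => h0 l' i' j') (Finset.mem_univ l)
  exact norm_le_zero_iff.1 (h1.trans (hg i))

theorem commute_part_of_siteStrength_le_zero (hg : ∀ v, H.siteStrength v ≤ 0) (l l' : Fin L) :
    Commute (H.part l) (H.part l') := by
  simp only [part, H.term_eq_zero_of_siteStrength_le_zero hg, Finset.sum_const_zero, add_zero]
  exact ((Commute.one_left _).smul_left _).smul_right _

/-- The blocks of a part between levels separated by `2 e² g (n + 1)` are exponentially small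
in `n`, since `n` nested commutators with `H` have norm at most `(2 g) ^ n (n + 1)! M`. -/
theorem norm_specProj_part_specProj_le {ι : Type*} [Fintype ι]
    {b : OrthonormalBasis ι ℂ (Qubits Λ)} {μ : ι → ℝ} (hb : H.total = diagOp b fun i => (μ i : ℂ))
    (hμ : ∀ i, 0 ≤ μ i) {g M : ℝ} (hg0 : 0 < g) (hg : ∀ v, H.siteStrength v ≤ g)
    (hM : ∀ l, H.partStrength l ≤ M) (n : ℕ) {p q : ι → Prop} {e : ℝ} (he : 0 ≤ e)
    (hq : ∀ i, q i → μ i ≤ e) (hp : ∀ i, p i → e + 2 * Real.exp 2 * g * (n + 1) ≤ μ i)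
    (l : Fin L) :
    ‖specProj b p * H.part l * specProj b q‖ ≤ M * Real.exp (-n) := by
  set w := 2 * Real.exp 2 * g * (n + 1) with hw
  have hw0 : 0 < w := by positivity
  have hpq : ∀ i, ¬ (p i ∧ q i) := by
    rintro i ⟨h1, h2⟩
    have := hq i h2
    have := hp i h1
    linarith
  rw [← specProj_mul_sub_smul_one_mul b hpq (H.part l) (H.shift l : ℂ)]
  have h1 := gap_pow_mul_norm_le b hw0 he (fun i hi => ⟨hμ i, hq i hi⟩) hp n
    (H.part l - (H.shift l : ℂ) • (1 : Op Λ))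
  rw [← hb] at h1
  have h2 := h1.trans (H.norm_iterate_comm_part_le hg0.le hg n l)
  have h3 : (2 * g) ^ n * (n + 1).factorial * H.partStrength l ≤ w ^ n * (M * Real.exp (-n)) := by
    have hM0 : 0 ≤ H.partStrength l :=
      Finset.sum_nonneg fun i _ => Finset.sum_nonneg fun j _ => norm_nonneg _
    have e1 : Real.exp 2 ^ n * Real.exp (-n) = Real.exp n := by
      rw [← Real.exp_nat_mul, ← Real.exp_add]
      congr 1
      ring
    calc (2 * g) ^ n * (n + 1).factorial * H.partStrength l
        ≤ (2 * g) ^ n * ((n + 1) ^ n * Real.exp n) * M := by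
          gcongr
          · exact factorial_succ_le_exp n
          · exact hM l
      _ = w ^ n * (M * Real.exp (-n)) := by
          rw [← e1, hw]
          simp only [mul_pow]
          ring
  exact le_of_mul_le_mul_left (h2.trans h3) (by positivity)

/-- The error of the simulation, with the number `n` of blocks above the low-energy subspace and the
radius `R` of the disc as free parameters. -/
theorem lowEnergyError_le (hpos : ∀ l, (H.part l).IsPositive) {g M Δ t κ R : ℝ} {p k n r : ℕ}
    (hg0 : 0 < g) (hg : ∀ v, H.siteStrength v ≤ g) (hM0 : 0 ≤ M)
    (hM : ∀ l, H.partStrength l ≤ M) (hW : W.HasOrder p) (hκ : 1 ≤ κ) (hb : W.BoundedBy κ)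
    (hΔ : 0 ≤ Δ) (ht : 0 ≤ t) (hr : 1 ≤ r) (hlen : W.length ≤ 2 ^ k) (hR0 : 0 < R)
    (hR : 4 * κ ^ 2 * (k + 1) * ((Δ + n * (2 * Real.exp 2 * g * (n + 1))) +
      L * (2 * (n + 1) * (M * Real.exp (-n)))) * R ≤ 1) (htr : t / r ≤ R) :
    H.lowEnergyError W Δ t r ≤ r * (κ * W.length * (t / r) *
      (2 * n * (M * Real.exp (-n)) + M * (4 * (t / r / R) ^ n)) + 6 * (t / r / R) ^ (p + 1)) := by
  refine (H.lowEnergyError_le_of_step hr Δ t).trans ?_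
  have hsaT : IsSelfAdjoint H.total := isSelfAdjoint_finset_sum H.isSelfAdjoint_part
  obtain ⟨m, b, μ, hbμ⟩ := exists_eigenbasis hsaT
  have hμ : ∀ i, 0 ≤ μ i := by
    have : (diagOp b fun i => (μ i : ℂ)).IsPositive := by
      rw [← hbμ]; exact isPositive_finset_sum hpos
    exact nonneg_of_isPositive_diagOp this
  set w := 2 * Real.exp 2 * g * (n + 1) with hw
  have hw0 : 0 < w := by positivity
  -- block `0` is the low-energy subspace, and the blocks above it have width `w`
  set β : Fin m → ℕ := fun i => ⌈(μ i - Δ) / w⌉₊ with hβ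
  have hβle : ∀ i (y : ℕ), β i ≤ y ↔ μ i ≤ Δ + y * w := by
    intro i y
    rw [hβ, Nat.ceil_le, div_le_iff₀ hw0, sub_le_iff_le_add, add_comm]
  have hβlt : ∀ i (y : ℕ), y < β i → Δ + y * w ≤ μ i := by
    intro i y h
    have := (not_congr (hβle i y)).1 (not_le.2 h)
    linarith
  have hproj : lowEnergyProj H.total Δ = blockProj b β 0 := by
    rw [hbμ, blockProj]
    refine (starProjection_iSup_eigenspace b μ Δ).trans ?_
    congr 1
    ext i
    have := hβle i 0
    simp only [Nat.cast_zero, zero_mul, add_zero] at this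
    rw [← this]
    omega
  have hsa := H.isSelfAdjoint_part
  have hup : ∀ l y, ‖specProj b (fun i => y + 1 < β i) * H.part l * blockProj b β y‖ ≤
      M * Real.exp (-n) := by
    intro l y
    refine H.norm_specProj_part_specProj_le hbμ hμ hg0 hg hM n (e := Δ + y * w) (by positivity)
      (fun i hi => (hβle i y).1 hi.le) (fun i hi => ?_) l
    have := hβlt i (y + 1) hi
    push_cast at this
    linarith
  have hdown : ∀ l y, ‖specProj b (fun i => β i + 1 < y) * H.part l * blockProj b β y‖ ≤
      M * Real.exp (-n) := by
    intro l y
    by_cases hy : y < 2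
    · rw [specProj_false b fun i hi => by omega, zero_mul, zero_mul, norm_zero]
      positivity
    · obtain ⟨y, rfl⟩ : ∃ y', y = y' + 2 := ⟨y - 2, by omega⟩
      rw [blockProj, norm_swap_specProj_mul b _ _ (hsa l)]
      refine H.norm_specProj_part_specProj_le hbμ hμ hg0 hg hM n (e := Δ + y * w) (by positivity)
        (fun i hi => (hβle i y).1 (by omega)) (fun i hi => ?_) l
      have := hβlt i (y + 1) (by omega)
      push_cast at this
      linarith
  have h := norm_step_sub_evolution_mul_le b (n := n) (H := H.part) (c := fun l => (H.shift l : ℂ))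
    hW hb hlen hμ (Δ := Δ + n * w) (fun i hi => (hβle i n).1 hi) (by positivity)
    (τ := M * Real.exp (-n)) (by positivity) hM0 hpos hbμ hup hdown
    (fun l => (H.norm_part_sub_shift_le l).trans (hM l)) hκ hR0 hR (δ := t / r)
    (by rwa [abs_of_nonneg (by positivity)])
  rw [abs_of_nonneg (by positivity : 0 ≤ t / r)] at h
  rw [hproj]
  gcongr
  exact h

end PowerLawHamiltonian

/-! ### Choice of the parameters -/

theorem rpow_one_add_inv_pow {x : ℝ} (hx : 0 ≤ x) {p : ℕ} (hp : 1 ≤ p) :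
    (x ^ (1 + 1 / (p : ℝ))) ^ p = x ^ (p + 1) := by
  have hp0 : (p : ℝ) ≠ 0 := by positivity
  rw [← Real.rpow_mul_natCast hx, ← Real.rpow_natCast]
  congr 1
  push_cast
  field_simp

theorem rpow_inv_pow {x : ℝ} (hx : 0 ≤ x) {p : ℕ} (hp : 1 ≤ p) :
    (x ^ (1 / (p : ℝ))) ^ p = x := by
  have hp0 : (p : ℝ) ≠ 0 := by positivity
  rw [← Real.rpow_mul_natCast hx, one_div_mul_cancel hp0, Real.rpow_one]

/-- The number of steps makes `t Z` times the logarithmic factors small in the sense required by the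
Schwarz lemma. Since `3 (p + 1) ≤ 6 p`, the sixth power of the logarithm suffices for all `p`. -/
theorem mul_pow_succ_le_of_steps {p : ℕ} (hp : 1 ≤ p) {B c N t Z ε r : ℝ} (hB : 1 ≤ B) (hc : 1 ≤ c)
    (hN : 1 ≤ N) (ht : 0 ≤ t) (hZ : 0 ≤ Z) (hε : 0 < ε)
    (h : B * c ^ (p + 1) * (t ^ (1 + 1 / (p : ℝ)) / ε ^ (1 / (p : ℝ)) *
      Z ^ (1 + 1 / (p : ℝ)) * N ^ 6) ≤ r) :
    B * (c * N ^ 3 * (t * Z)) ^ (p + 1) ≤ ε * r ^ p := by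
  have hD : 1 ≤ B * c ^ (p + 1) := one_le_mul_of_one_le_of_one_le hB (one_le_pow₀ hc)
  have h1 := pow_le_pow_left₀ (by positivity) h p
  have hX : (t ^ (1 + 1 / (p : ℝ)) / ε ^ (1 / (p : ℝ)) * Z ^ (1 + 1 / (p : ℝ))) ^ p =
      (t * Z) ^ (p + 1) / ε := by
    rw [mul_pow, div_pow, rpow_one_add_inv_pow ht hp, rpow_one_add_inv_pow hZ hp,
      rpow_inv_pow hε.le hp, mul_pow]
    ring
  rw [mul_pow _ _ p, mul_pow _ (N ^ 6) p, hX] at h1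
  have h2 : N ^ (3 * (p + 1)) ≤ (N ^ 6) ^ p := by
    rw [← pow_mul]
    exact pow_le_pow_right₀ hN (by omega)
  have h3 : B * c ^ (p + 1) ≤ (B * c ^ (p + 1)) ^ p := le_self_pow₀ hD (by omega)
  calc B * (c * N ^ 3 * (t * Z)) ^ (p + 1)
      = ε * (B * c ^ (p + 1) * ((t * Z) ^ (p + 1) / ε * N ^ (3 * (p + 1)))) := by
        rw [mul_pow, mul_pow, ← pow_mul]
        field_simp
    _ ≤ ε * ((B * c ^ (p + 1)) ^ p * ((t * Z) ^ (p + 1) / ε * (N ^ 6) ^ p)) := by gcongr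
    _ ≤ ε * r ^ p := by gcongr

theorem mul_pow_succ_le_of_add {p : ℕ} {A x y ε r : ℝ} (hA : 0 ≤ A) (hx : 0 ≤ x) (hy : 0 ≤ y)
    (hAxy : A ≤ x + y) (hr : 1 ≤ r) (hε : 0 < ε)
    (h1 : 24 * 8 ^ (p + 1) * 2 ^ p * x ^ (p + 1) ≤ ε * r ^ p)
    (h2 : 24 * 8 ^ (p + 1) * 2 ^ p * y ≤ ε) (hy1 : y ≤ 1) :
    12 * 8 ^ (p + 1) * A ^ (p + 1) ≤ ε * r ^ p := by
  have h3 : y ^ (p + 1) ≤ y := by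
    rw [pow_succ]
    exact mul_le_of_le_one_left hy (pow_le_one₀ hy hy1)
  have h4 : 24 * 8 ^ (p + 1) * 2 ^ p * y ^ (p + 1) ≤ ε * r ^ p := by
    calc _ ≤ 24 * 8 ^ (p + 1) * 2 ^ p * y := by gcongr
      _ ≤ ε * 1 := by rw [mul_one]; exact h2
      _ ≤ ε * r ^ p := by gcongr; exact one_le_pow₀ hr
  have h5 : A ^ (p + 1) ≤ 2 ^ p * (x ^ (p + 1) + y ^ (p + 1)) :=
    (pow_le_pow_left₀ hA hAxy _).trans (add_pow_le hx hy (p + 1))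
  have h6 := mul_le_mul_of_nonneg_left h5 (by positivity : (0 : ℝ) ≤ 12 * 8 ^ (p + 1))
  linarith

theorem eight_mul_div_le_one {p : ℕ} {A ε r : ℝ} (hA : 0 ≤ A) (hr : 1 ≤ r) (hε : ε ≤ 2)
    (h : 12 * 8 ^ (p + 1) * A ^ (p + 1) ≤ ε * r ^ p) : 8 * (A / r) ≤ 1 := by
  have hr0 : 0 < r := by linarith
  have h1 : (8 * (A / r)) ^ (p + 1) ≤ 1 := by
    rw [mul_pow, div_pow, ← mul_div_assoc, div_le_one (by positivity), pow_succ r p]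
    have h2 : (0 : ℝ) < r ^ p := by positivity
    nlinarith
  exact (pow_le_one_iff_of_nonneg (by positivity) (by omega)).1 h1

theorem mul_six_mul_div_pow_le {p : ℕ} {A ε r : ℝ} (hA : 0 ≤ A) (hr : 1 ≤ r)
    (h : 12 * 8 ^ (p + 1) * A ^ (p + 1) ≤ ε * r ^ p) :
    r * (6 * (A / r) ^ (p + 1)) ≤ ε / 2 := by
  have hr0 : 0 < r := by linarith
  have h8 : (1 : ℝ) ≤ 8 ^ (p + 1) := one_le_pow₀ (by norm_num)
  have h3 : r * (6 * (A / r) ^ (p + 1)) = 6 * A ^ (p + 1) / r ^ p := by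
    rw [div_pow, pow_succ r p]
    field_simp
  rw [h3, div_le_iff₀ (by positivity)]
  have h4 : 0 ≤ A ^ (p + 1) := by positivity
  have h5 : A ^ (p + 1) ≤ 8 ^ (p + 1) * A ^ (p + 1) := le_mul_of_one_le_left h4 h8
  linarith

theorem add_one_mul_exp_neg_le (n : ℝ) :
    (n + 1) * Real.exp (-n) ≤ 2 * Real.exp (-n / 2) := by
  have h1 := Real.add_one_le_exp (n / 2)
  have h2 : Real.exp (-n) = Real.exp (-n / 2) * Real.exp (-n / 2) := by
    rw [← Real.exp_add]; congr 1; ring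
  have h3 : Real.exp (n / 2) * Real.exp (-n / 2) = 1 := by
    rw [← Real.exp_add, ← Real.exp_zero]; congr 1; ring
  have h4 := Real.exp_pos (-n / 2)
  rw [h2]
  nlinarith

theorem exp_two_le : Real.exp 2 ≤ 8 := by
  have h1 : Real.exp 2 = Real.exp 1 * Real.exp 1 := by rw [← Real.exp_add]; norm_num
  have := Real.exp_one_lt_d9
  have := Real.exp_pos 1
  nlinarith

theorem le_exp_neg_one_of_eight_mul_le_one {x : ℝ} (hx : 8 * x ≤ 1) : x ≤ Real.exp (-1) := by
  have h1 : x ≤ 1 / 8 := by linarith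
  have h2 : Real.exp 1 ≤ 8 := by
    have := Real.exp_one_lt_d9
    linarith
  rw [Real.exp_neg, ← one_div]
  exact h1.trans (one_div_le_one_div_of_le (Real.exp_pos 1) h2)

theorem le_two_pow_of_le_exp {q k : ℕ} {N : ℝ} (hq : (q : ℝ) ≤ Real.exp N) (hk : 2 * N ≤ k) :
    q ≤ 2 ^ k := by
  have h1 : Real.exp (1 / 2) ≤ 2 := by
    have := Real.exp_bound' (x := 1 / 2) (by norm_num) (by norm_num) (n := 2) (by norm_num)
    norm_num [Finset.sum_range_succ] at this
    linarith
  have h2 : Real.exp N ≤ (2 : ℝ) ^ k := by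
    calc Real.exp N ≤ Real.exp (k * (1 / 2)) := Real.exp_le_exp.2 (by linarith)
      _ = Real.exp (1 / 2) ^ k := Real.exp_nat_mul _ _
      _ ≤ 2 ^ k := by gcongr
  exact_mod_cast hq.trans h2

/-- The inverse radius `t / R` of the disc on which the truncated product formula is bounded. -/
theorem inv_radius_le {κ N t Δ g M Z : ℝ} {L n k m : ℕ} (hN : 1 ≤ N) (ht : 0 ≤ t)
    (hΔ : 0 ≤ Δ) (hg : 0 ≤ g) (hM : 0 ≤ M) (hgZ : Δ + g ≤ Z) (hk : (k : ℝ) + 1 ≤ 4 * N)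
    (hn : (n : ℝ) + 1 ≤ (m + 2) * N) (hL : (L : ℝ) ≤ Real.exp N) (htM : t * M ≤ Real.exp N) :
    4 * κ ^ 2 * (k + 1) * ((Δ + n * (2 * Real.exp 2 * g * (n + 1))) +
      L * (2 * (n + 1) * (M * Real.exp (-n)))) * t ≤
      256 * κ ^ 2 * (m + 2) ^ 2 * N ^ 3 * (t * Z) + 64 * κ ^ 2 * Real.exp (3 * N - n / 2) := by
  have hNexp : N ≤ Real.exp N := by have := Real.add_one_le_exp N; linarith
  have hN0 : 0 ≤ N := by linarith
  obtain ⟨b, hb⟩ : ∃ b, b = ((m : ℝ) + 2) * N := ⟨_, rfl⟩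
  have hb1 : 1 ≤ b := by
    have : (0 : ℝ) ≤ n := Nat.cast_nonneg n
    linarith
  have h1 : Δ + n * (2 * Real.exp 2 * g * (n + 1)) ≤ 16 * (b * b) * Z := by
    have h2 : (n : ℝ) * (n + 1) ≤ b * b := by
      rw [← hb] at hn
      exact mul_le_mul (by linarith) hn (by positivity) (by linarith)
    have h3 : n * (2 * Real.exp 2 * g * (n + 1)) ≤ 16 * (b * b) * g := by
      calc n * (2 * Real.exp 2 * g * (n + 1)) = 2 * Real.exp 2 * (n * (n + 1)) * g := by ring
        _ ≤ 2 * 8 * (b * b) * g := by gcongr; exact exp_two_le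
        _ = _ := by ring
    have h4 : 1 ≤ 16 * (b * b) := by nlinarith
    calc _ ≤ 16 * (b * b) * Δ + 16 * (b * b) * g :=
          add_le_add (le_mul_of_one_le_left hΔ h4) h3
      _ = 16 * (b * b) * (Δ + g) := by ring
      _ ≤ _ := by gcongr
  have h5 : t * (L * (2 * (n + 1) * (M * Real.exp (-n)))) ≤ 4 * Real.exp (2 * N - n / 2) := by
    calc t * (L * (2 * (n + 1) * (M * Real.exp (-n))))
        = 2 * L * (t * M) * ((n + 1) * Real.exp (-n)) := by ring
      _ ≤ 2 * Real.exp N * Real.exp N * (2 * Real.exp (-n / 2)) := by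
          have h6 := add_one_mul_exp_neg_le n
          have h7 : 0 ≤ (n + 1) * Real.exp (-n) := by positivity
          exact mul_le_mul (mul_le_mul (by linarith) htM (by positivity) (by positivity)) h6 h7
            (by positivity)
      _ = 4 * (Real.exp N * Real.exp N * Real.exp (-n / 2)) := by ring
      _ = 4 * Real.exp (2 * N - n / 2) := by
          rw [← Real.exp_add, ← Real.exp_add]; congr 2; ring
  calc _ = 4 * κ ^ 2 * (k + 1) * (t * (Δ + n * (2 * Real.exp 2 * g * (n + 1))) +
        t * (L * (2 * (n + 1) * (M * Real.exp (-n))))) := by ring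
    _ ≤ 4 * κ ^ 2 * (4 * N) * (t * (16 * (b * b) * Z) + 4 * Real.exp (2 * N - n / 2)) := by gcongr
    _ = 256 * κ ^ 2 * (m + 2) ^ 2 * N ^ 3 * (t * Z) +
        64 * κ ^ 2 * (N * Real.exp (2 * N - n / 2)) := by
        rw [hb]; ring
    _ ≤ 256 * κ ^ 2 * (m + 2) ^ 2 * N ^ 3 * (t * Z) +
        64 * κ ^ 2 * (Real.exp N * Real.exp (2 * N - n / 2)) := by gcongr
    _ = _ := by rw [← Real.exp_add]; congr 3; ring

/-- The total effect of the truncation to band parts over all steps. -/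
theorem leakage_le {κ q t M N n x ε r : ℝ} {j : ℕ} (hκ : 0 ≤ κ) (hq0 : 0 ≤ q) (hr : 0 < r)
    (ht : 0 ≤ t) (hM : 0 ≤ M)
    (hq : q ≤ Real.exp N) (htM : t * M ≤ Real.exp N) (hn : 0 ≤ n) (hx : x ^ j ≤ Real.exp (-n))
    (h : 8 * κ * Real.exp (2 * N - n / 2) ≤ ε / 2) :
    r * (κ * q * (t / r) * (2 * n * (M * Real.exp (-n)) + M * (4 * x ^ j))) ≤ ε / 2 := by
  calc r * (κ * q * (t / r) * (2 * n * (M * Real.exp (-n)) + M * (4 * x ^ j)))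
      = κ * q * (t * M) * (2 * n * Real.exp (-n) + 4 * x ^ j) := by
        field_simp
    _ ≤ κ * q * (t * M) * (2 * n * Real.exp (-n) + 4 * Real.exp (-n)) := by gcongr
    _ ≤ κ * q * (t * M) * (4 * ((n + 1) * Real.exp (-n))) := by
        gcongr
        nlinarith [Real.exp_pos (-n)]
    _ ≤ κ * Real.exp N * Real.exp N * (4 * (2 * Real.exp (-n / 2))) := by
        have h1 := add_one_mul_exp_neg_le n
        have h2 : 0 ≤ (n + 1) * Real.exp (-n) := by positivity
        exact mul_le_mul (mul_le_mul (by gcongr) htM (by positivity) (by positivity))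
          (by linarith) (by linarith) (by positivity)
    _ = 8 * κ * (Real.exp N * Real.exp N * Real.exp (-n / 2)) := by ring
    _ = 8 * κ * Real.exp (2 * N - n / 2) := by
        rw [← Real.exp_add, ← Real.exp_add]; congr 2; ring
    _ ≤ ε / 2 := h

/-- With `n` of the order of `N = log (e + q + t (Δ + g + M) + 1 / ε)` blocks of width of order
`g n`, all error terms that decay exponentially in `n` are negligible, and the remaining ones are
controlled by the number `r` of steps. -/
theorem exists_parameters {p : ℕ} (hp : 1 ≤ p) {κ : ℝ} (hκ : 1 ≤ κ) :
    ∃ C : ℝ, 1 ≤ C ∧ ∀ (L q r : ℕ) (g M Δ t ε : ℝ), 2 ≤ q → L ≤ q → 1 ≤ r → 0 < g → 0 ≤ M →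
      0 ≤ Δ → 0 ≤ t → 0 < ε → ε ≤ 2 →
      C * (t ^ (1 + 1 / (p : ℝ)) / ε ^ (1 / (p : ℝ)) *
        (Δ + g * (q * Real.log q)) ^ (1 + 1 / (p : ℝ)) *
        Real.log (Real.exp 1 + q + t * (Δ + g + M) + 1 / ε) ^ 6) ≤ r →
      ∃ (n k : ℕ) (R : ℝ), q ≤ 2 ^ k ∧ 0 < R ∧ t / r ≤ R ∧
        4 * κ ^ 2 * (k + 1) * ((Δ + n * (2 * Real.exp 2 * g * (n + 1))) +
          L * (2 * (n + 1) * (M * Real.exp (-n)))) * R ≤ 1 ∧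
        r * (κ * q * (t / r) * (2 * n * (M * Real.exp (-n)) + M * (4 * (t / r / R) ^ n)) +
          6 * (t / r / R) ^ (p + 1)) ≤ ε := by
  obtain ⟨B, hB⟩ : ∃ B : ℝ, B = 24 * 8 ^ (p + 1) * 2 ^ p := ⟨_, rfl⟩
  have hB1 : 1 ≤ B := by
    have h8 : (1 : ℝ) ≤ 8 ^ (p + 1) := one_le_pow₀ (by norm_num)
    have h2p : (1 : ℝ) ≤ 2 ^ p := one_le_pow₀ (by norm_num)
    rw [hB]
    exact one_le_mul_of_one_le_of_one_le (by linarith) h2p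
  -- `m` is so large that `exp (-n / 2)`, for `n ≥ m N`, beats all constants and powers of `exp N`
  obtain ⟨d, hd⟩ := exists_nat_ge (64 * κ ^ 2 * B)
  obtain ⟨m, hm⟩ : ∃ m : ℕ, m = 8 + 2 * d := ⟨_, rfl⟩
  have hm' : (m : ℝ) = 8 + 2 * d := by rw [hm]; push_cast; ring
  have hd0 : (0 : ℝ) ≤ d := Nat.cast_nonneg d
  have hκ2 : 1 ≤ κ ^ 2 := one_le_pow₀ hκ
  obtain ⟨c, hc⟩ : ∃ c : ℝ, c = 256 * κ ^ 2 * (m + 2) ^ 2 := ⟨_, rfl⟩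
  have hc1 : 1 ≤ c := by
    have : (1 : ℝ) ≤ (m + 2 : ℝ) ^ 2 := one_le_pow₀ (by linarith)
    rw [hc]
    exact one_le_mul_of_one_le_of_one_le (by linarith) this
  refine ⟨B * c ^ (p + 1), one_le_mul_of_one_le_of_one_le hB1 (one_le_pow₀ hc1), ?_⟩
  intro L q r g M Δ t ε hq hLq hr hg hM hΔ ht hε hε2 hrC
  have hq' : (2 : ℝ) ≤ q := by exact_mod_cast hq
  have hr' : (1 : ℝ) ≤ r := by exact_mod_cast hr
  have hLq' : (L : ℝ) ≤ q := by exact_mod_cast hLq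
  obtain ⟨N, hN⟩ : ∃ N, N = Real.log (Real.exp 1 + q + t * (Δ + g + M) + 1 / ε) := ⟨_, rfl⟩
  obtain ⟨Z, hZ⟩ : ∃ Z, Z = Δ + g * (q * Real.log q) := ⟨_, rfl⟩
  rw [← hN, ← hZ] at hrC
  have hbase0 : 0 < Real.exp 1 + q + t * (Δ + g + M) + 1 / ε := by positivity
  have hexpN : Real.exp N = Real.exp 1 + q + t * (Δ + g + M) + 1 / ε := by
    rw [hN, Real.exp_log hbase0]
  have he1 : 0 < Real.exp 1 := Real.exp_pos 1
  have hε' : 0 < 1 / ε := by positivity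
  have htg : 0 ≤ t * (Δ + g) := by positivity
  have htM0 : 0 ≤ t * M := by positivity
  have htsum : t * (Δ + g + M) = t * (Δ + g) + t * M := by ring
  have hqN : (q : ℝ) ≤ Real.exp N := by linarith
  have htMN : t * M ≤ Real.exp N := by linarith
  have hN1 : 1 ≤ N := Real.exp_le_exp.1 (by linarith)
  have hεN : Real.exp (-N) ≤ ε := by
    rw [Real.exp_neg, inv_le_comm₀ (Real.exp_pos N) hε, ← one_div]
    linarith
  clear hexpN hbase0 hN
  have hgZ : Δ + g ≤ Z := by
    have h1 : 1 / 2 ≤ Real.log q := by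
      have h2 : Real.log 2 ≤ Real.log q := Real.log_le_log (by norm_num) hq'
      have := Real.log_two_gt_d9
      linarith
    have h3 : 1 ≤ q * Real.log q := by nlinarith
    rw [hZ]
    have := mul_le_mul_of_nonneg_left h3 hg.le
    linarith
  have hZ0 : 0 ≤ Z := by linarith
  obtain ⟨n, hn⟩ : ∃ n : ℕ, n = ⌈(m : ℝ) * N⌉₊ := ⟨_, rfl⟩
  obtain ⟨k, hk⟩ : ∃ k : ℕ, k = ⌈2 * N⌉₊ := ⟨_, rfl⟩
  have hn1 : (m : ℝ) * N ≤ n := by rw [hn]; exact Nat.le_ceil _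
  have hn2 : (n : ℝ) < m * N + 1 := by rw [hn]; exact Nat.ceil_lt_add_one (by positivity)
  have hk1 : 2 * N ≤ k := by rw [hk]; exact Nat.le_ceil _
  have hk2 : (k : ℝ) < 2 * N + 1 := by rw [hk]; exact Nat.ceil_lt_add_one (by positivity)
  have hn0 : (0 : ℝ) < n := lt_of_lt_of_le (by rw [hm']; positivity) hn1
  have hdexp : ∀ x : ℝ, 64 * κ ^ 2 * B * Real.exp (x - n / 2) ≤ Real.exp (x - 4 * N) := by
    intro x
    have h1 : 64 * κ ^ 2 * B ≤ Real.exp (d * N) := by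
      have h2 := Real.add_one_le_exp ((d : ℝ) * N)
      have h3 : (d : ℝ) ≤ d * N := le_mul_of_one_le_right hd0 hN1
      linarith
    calc _ ≤ Real.exp (d * N) * Real.exp (x - n / 2) := by gcongr
      _ = Real.exp (d * N + (x - n / 2)) := (Real.exp_add _ _).symm
      _ ≤ Real.exp (x - 4 * N) := by
          refine Real.exp_le_exp.2 ?_
          rw [hm'] at hn1
          linarith
  obtain ⟨S, hS⟩ : ∃ S, S = (Δ + n * (2 * Real.exp 2 * g * (n + 1))) +
    L * (2 * (n + 1) * (M * Real.exp (-n))) := ⟨_, rfl⟩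
  have hS0 : 0 < S := by rw [hS]; positivity
  obtain ⟨A, hA⟩ : ∃ A, A = 4 * κ ^ 2 * (k + 1) * S * t := ⟨_, rfl⟩
  have hA0 : 0 ≤ A := by rw [hA]; positivity
  have hAR : t / r / (4 * κ ^ 2 * (k + 1) * S)⁻¹ = A / r := by rw [hA, div_inv_eq_mul]; ring
  have hAle : A ≤ c * N ^ 3 * (t * Z) + 64 * κ ^ 2 * Real.exp (3 * N - n / 2) := by
    rw [hA, hS, hc]
    exact inv_radius_le hN1 ht hΔ hg.le hM hgZ (by linarith) (by linarith) (hLq'.trans hqN) htMN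
  have hyB : B * (64 * κ ^ 2 * Real.exp (3 * N - n / 2)) ≤ Real.exp (-N) := by
    calc _ = 64 * κ ^ 2 * B * Real.exp (3 * N - n / 2) := by ring
      _ ≤ _ := hdexp (3 * N)
      _ = _ := by congr 1; ring
  have hy1 : 64 * κ ^ 2 * Real.exp (3 * N - n / 2) ≤ 1 :=
    (le_mul_of_one_le_left (by positivity) hB1).trans
      (hyB.trans (Real.exp_le_one_iff.2 (by linarith)))
  have hApow : 12 * 8 ^ (p + 1) * A ^ (p + 1) ≤ ε * r ^ p := by
    refine mul_pow_succ_le_of_add hA0 (by positivity) (by positivity) hAle hr' hε ?_ ?_ hy1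
    · rw [← hB]
      exact mul_pow_succ_le_of_steps hp hB1 hc1 hN1 ht hZ0 hε hrC
    · rw [← hB]
      exact hyB.trans hεN
  have hAr := eight_mul_div_le_one hA0 hr' hε2 hApow
  have hAr0 : 0 ≤ A / r := by positivity
  have hAn : (A / r) ^ n ≤ Real.exp (-n) := by
    calc (A / r) ^ n ≤ Real.exp (-1) ^ n :=
          pow_le_pow_left₀ hAr0 (le_exp_neg_one_of_eight_mul_le_one hAr) n
      _ = Real.exp (-n) := by rw [← Real.exp_nat_mul]; congr 1; ring
  refine ⟨n, k, (4 * κ ^ 2 * (k + 1) * S)⁻¹, le_two_pow_of_le_exp hqN hk1, by positivity,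
    ?_, ?_, ?_⟩
  · rw [← div_le_one (by positivity), hAR]
    linarith
  · rw [← hS]
    exact (mul_inv_cancel₀ (by positivity)).le
  · rw [hAR, mul_add]
    have h1 := leakage_le (ε := ε) (r := r) (by linarith : 0 ≤ κ) (by linarith) (by linarith) ht hM
      hqN htMN hn0.le hAn ?_
    · have h2 := mul_six_mul_div_pow_le hA0 hr' hApow
      linarith
    · have h3 := hdexp (2 * N)
      have h4 : Real.exp (2 * N - 4 * N) ≤ Real.exp (-N) := Real.exp_le_exp.2 (by linarith)
      have h5 : 16 * κ ≤ 64 * κ ^ 2 * B := by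
        have h6 : κ ≤ κ ^ 2 := le_self_pow₀ hκ (by norm_num)
        have h7 : 64 * κ ^ 2 ≤ 64 * κ ^ 2 * B := le_mul_of_one_le_right (by positivity) hB1
        linarith
      have h8 := mul_le_mul_of_nonneg_right h5 (Real.exp_pos (2 * N - n / 2)).le
      linarith

/-! ### Trotter number and gate count -/

theorem ProductFormula.gateCount_trotter {L : ℕ} (W : ProductFormula L) (t : ℝ) (r : ℕ) :
    (W.trotter t r).gateCount = r * W.length := by
  simp [trotter, Circuit.gateCount, step, length]

/-- The number of steps that suffices. The parameters can be chosen only if `g > 0` and `q ≥ 2`; in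
the other cases the parts commute and the product formula is exact. -/
theorem PowerLawHamiltonian.lowEnergyError_le_of_steps {p : ℕ} (hp : 1 ≤ p) {κ : ℝ} (hκ : 1 ≤ κ) :
    ∃ C : ℝ, 1 ≤ C ∧ ∀ {D : ℕ} {α : ℝ} {Λ : Finset (Fin D → ℤ)} {L : ℕ}
      (H : PowerLawHamiltonian D α Λ L) {W : ProductFormula L} {g M Δ t ε : ℝ} {r : ℕ},
      (∀ l, (H.part l).IsPositive) → 0 ≤ g → (∀ v, H.siteStrength v ≤ g) → 0 ≤ M →
      (∀ l, H.partStrength l ≤ M) → W.HasOrder p → W.BoundedBy κ → 0 ≤ Δ → 0 ≤ t → 0 < ε →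
      1 ≤ r →
      C * (t ^ (1 + 1 / (p : ℝ)) * (L : ℝ) ^ (1 / (p : ℝ)) / ε ^ (1 / (p : ℝ)) *
        (Δ + g * (W.length * Real.log W.length)) ^ (1 + 1 / (p : ℝ)) *
        Real.log (Real.exp 1 + W.length + t * (Δ + g + M) + 1 / ε) ^ 6) ≤ r →
      H.lowEnergyError W Δ t r ≤ ε := by
  obtain ⟨C, hC1, hC⟩ := exists_parameters hp hκ
  refine ⟨C, hC1, ?_⟩
  intro D α Λ L H W g M Δ t ε r hpos hg0 hg hM0 hM hW hb hΔ ht hε hr hle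
  -- the parameters are chosen for `ε ≤ 2`, and the error never exceeds `2`
  rcases le_or_gt 2 ε with hε2 | hε2
  · exact (H.lowEnergyError_le_two Δ t r).trans hε2
  by_cases hc : ∀ l l', Commute (H.part l) (H.part l')
  · rw [H.lowEnergyError_eq_zero_of_commute hp hW hc hr]
    exact hε.le
  have hg0' : 0 < g := by
    refine lt_of_le_of_ne hg0 fun h => hc ?_
    rw [← h] at hg
    exact H.commute_part_of_siteStrength_le_zero hg
  have hL : 2 ≤ L := by
    by_contra hL
    have : Subsingleton (Fin L) := Fin.subsingleton_iff_le_one.2 (by omega)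
    exact hc fun l l' => by rw [Subsingleton.elim l l']
  have hq : L ≤ W.length := hW.le_length hp
  have hlog : 0 ≤ Real.log W.length := Real.log_natCast_nonneg _
  have hle' : C * (t ^ (1 + 1 / (p : ℝ)) / ε ^ (1 / (p : ℝ)) *
      (Δ + g * (W.length * Real.log W.length)) ^ (1 + 1 / (p : ℝ)) *
      Real.log (Real.exp 1 + W.length + t * (Δ + g + M) + 1 / ε) ^ 6) ≤ r := by
    refine le_trans ?_ hle
    have h1 : 1 ≤ (L : ℝ) ^ (1 / (p : ℝ)) :=
      Real.one_le_rpow (by exact_mod_cast (by omega : 1 ≤ L)) (by positivity)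
    have h2 : t ^ (1 + 1 / (p : ℝ)) ≤ t ^ (1 + 1 / (p : ℝ)) * (L : ℝ) ^ (1 / (p : ℝ)) :=
      le_mul_of_one_le_right (by positivity) h1
    gcongr
  obtain ⟨n, k, R, hlen, hR0, htr, hR, hle⟩ :=
    hC L W.length r g M Δ t ε (hL.trans hq) hq hr hg0' hM0 hΔ ht hε hε2.le hle'
  exact (H.lowEnergyError_le hpos hg0' hg hM0 hM hW hκ hb hΔ ht hr hlen hR0 hR htr).trans hle

end LowEnergySim

/-- Low-energy simulation of power-law Hamiltonians by product formulas of order `p`: Trotter number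
and gate complexity. The constants `C` and `k` depend only on `p` and on `κ`; the power of the
logarithm is the polylogarithmic factor of the first summand. -/
theorem theorem4 (p : ℕ) (hp : 1 ≤ p) (κ : ℝ) :
    ∃ (C : ℝ) (k : ℕ), 0 < C ∧
      ∀ (D : ℕ) (α : ℝ) (_ : 0 ≤ α) (Λ : Finset (Fin D → ℤ)) (L : ℕ)
        (H : LowEnergySim.PowerLawHamiltonian D α Λ L)
        (W : LowEnergySim.ProductFormula L) (g M Δ t ε : ℝ),
        (∀ l, (H.part l).IsPositive) →
        0 ≤ g → (∀ v, H.siteStrength v ≤ g) →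
        0 ≤ M → (∀ l, H.partStrength l ≤ M) →
        W.HasOrder p → W.BoundedBy κ →
        0 ≤ Δ → 0 ≤ t → 0 < ε →
        ∃ r₀ : ℕ, 1 ≤ r₀ ∧
          (∀ r : ℕ, r₀ ≤ r → H.lowEnergyError W Δ t r ≤ ε) ∧
          (r₀ : ℝ) ≤ 1 + C *
            (t ^ (1 + 1 / (p : ℝ)) * (L : ℝ) ^ (1 / (p : ℝ)) / ε ^ (1 / (p : ℝ)) *
                (Δ + g * (W.length * Real.log W.length)) ^ (1 + 1 / (p : ℝ)) *
                Real.log (Real.exp 1 + W.length + t * (Δ + g + M) + 1 / ε) ^ k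
              + t ^ (1 + 1 / (2 * (p : ℝ) + 1)) / ε ^ (1 / (2 * (p : ℝ) + 1)) *
                (L * M * g) ^ (1 / 2 + 1 / (4 * (p : ℝ) + 2))) ∧
          ((W.trotter t r₀).gateCount : ℝ) ≤ C *
            (L + t ^ (1 + 1 / (p : ℝ)) * (L : ℝ) ^ (1 / (p : ℝ) + 1) / ε ^ (1 / (p : ℝ)) *
                (Δ + g * (W.length * Real.log W.length)) ^ (1 + 1 / (p : ℝ)) *
                Real.log (Real.exp 1 + W.length + t * (Δ + g + M) + 1 / ε) ^ k
              + L * t ^ (1 + 1 / (2 * (p : ℝ) + 1)) / ε ^ (1 / (2 * (p : ℝ) + 1)) *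
                (L * M * g) ^ (1 / 2 + 1 / (4 * (p : ℝ) + 2))) := by
  have hK1 : 1 ≤ max κ 1 := le_max_right κ 1
  -- the number of gates per step is at most `κ L`, which accounts for the factor `max κ 1`
  obtain ⟨C, hC1, hC⟩ := LowEnergySim.PowerLawHamiltonian.lowEnergyError_le_of_steps hp hK1
  refine ⟨max κ 1 * C, 6, by positivity, ?_⟩
  intro D α _ Λ L H W g M Δ t ε hpos hg0 hg hM0 hM hW hb hΔ ht hε
  obtain ⟨Z, hZ⟩ : ∃ Z, Z = (Δ + g * (W.length * Real.log W.length)) ^ (1 + 1 / (p : ℝ)) :=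
    ⟨_, rfl⟩
  obtain ⟨N, hN⟩ : ∃ N, N = Real.log (Real.exp 1 + W.length + t * (Δ + g + M) + 1 / ε) ^ 6 :=
    ⟨_, rfl⟩
  obtain ⟨Y, hY⟩ : ∃ Y, Y = t ^ (1 + 1 / (2 * (p : ℝ) + 1)) / ε ^ (1 / (2 * (p : ℝ) + 1)) *
    (L * M * g) ^ (1 / 2 + 1 / (4 * (p : ℝ) + 2)) := ⟨_, rfl⟩
  obtain ⟨X, hX⟩ : ∃ X, X = t ^ (1 + 1 / (p : ℝ)) * (L : ℝ) ^ (1 / (p : ℝ)) / ε ^ (1 / (p : ℝ)) *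
    Z * N := ⟨_, rfl⟩
  have hXL : t ^ (1 + 1 / (p : ℝ)) * (L : ℝ) ^ (1 / (p : ℝ) + 1) / ε ^ (1 / (p : ℝ)) * Z * N =
      L * X := by
    rw [hX, Real.rpow_add_one' (Nat.cast_nonneg L) (by positivity)]
    ring
  have hYL : L * t ^ (1 + 1 / (2 * (p : ℝ) + 1)) / ε ^ (1 / (2 * (p : ℝ) + 1)) *
      (L * M * g) ^ (1 / 2 + 1 / (4 * (p : ℝ) + 2)) = L * Y := by
    rw [hY]
    ring
  rw [← hZ, ← hN, ← hY, hXL, hYL, ← hX]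
  have hX0 : 0 ≤ X := by
    have hlog : 0 ≤ Real.log W.length := Real.log_natCast_nonneg _
    rw [hX, hZ, hN]
    positivity
  have hY0 : 0 ≤ Y := by
    rw [hY]
    positivity
  have hr₀ : ((⌊C * X⌋₊ + 1 : ℕ) : ℝ) ≤ 1 + C * X := by
    push_cast
    linarith [Nat.floor_le (by positivity : 0 ≤ C * X)]
  refine ⟨⌊C * X⌋₊ + 1, Nat.le_add_left _ _, ?_, ?_, ?_⟩
  · intro r hr
    refine hC H hpos hg0 hg hM0 hM hW (hb.mono (le_max_left κ 1)) hΔ ht hε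
      ((Nat.le_add_left _ _).trans hr) ?_
    rw [← hZ, ← hN, ← hX]
    exact (Nat.lt_floor_add_one (C * X)).le.trans (by exact_mod_cast hr)
  · calc ((⌊C * X⌋₊ + 1 : ℕ) : ℝ) ≤ 1 + C * X := hr₀
      _ ≤ 1 + max κ 1 * C * (X + Y) := by
          have h1 : C * X ≤ max κ 1 * (C * X) := le_mul_of_one_le_left (by positivity) hK1
          have h2 : 0 ≤ max κ 1 * C * Y := by positivity
          linarith
  · rw [LowEnergySim.ProductFormula.gateCount_trotter, Nat.cast_mul]
    have hlen : (W.length : ℝ) ≤ max κ 1 * L :=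
      LowEnergySim.ProductFormula.BoundedBy.length_le (c := W.seq) (hb.mono (le_max_left κ 1))
    calc ((⌊C * X⌋₊ + 1 : ℕ) : ℝ) * W.length ≤ (1 + C * X) * (max κ 1 * L) := by gcongr
      _ = max κ 1 * L + max κ 1 * C * (L * X) := by ring
      _ ≤ max κ 1 * C * (L + L * X + L * Y) := by
          have h1 : max κ 1 * L ≤ max κ 1 * L * C := le_mul_of_one_le_right (by positivity) hC1
          have h2 : 0 ≤ max κ 1 * C * (L * Y) := by positivity
          linarith
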